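/- **Setting.** Let $L_1,L_2,T>0$, $\Omega=(0,L_1)\times(0,L_2)$, and let $p\in C^2[1,2]$ with $p>0$ on $[1,2]$. Let $f(x,y,t,u)$ be continuous on $\Omega\times[0,T]\times\mathbb R$ with $|f(x,y,t,u_1)-f(x,y,t,u_2)|\le L_f|u_1-u_2|$ for some constant $L_f>0$, let $\phi$ be continuous on $\partial\Omega\times[0,T]$, and let $\psi_1,\psi_2$ be continuous on $\Omega$. Consider $$\int_1^2p(\beta)\,{}_0^CD_t^\beta u(x,y,t)\,d\beta=u_{xx}+u_{yy}+f\big(x,y,t,u(x,y,t)\big),\quad (x,y)\in\Omega,\ t\in(0,T],$$ $$u=\phi\ \text{ on }\partial\Omega\times[0,T),\qquad u(x,y,0)=\psi_1(x,y),\quad u_t(x,y,0)=\psi_2(x,y)\ \text{ in }\Omega,$$ where ${}_0^CD_t^\beta v(t)=\frac1{\Gamma(2-\beta)}\int_0^t(t-\xi)^{1-\beta}v''(\xi)\,d\xi$ for $1<\beta<2$ is the Caputo derivative (equal to $v'(t)-v'(0)$ for $\beta=1$ and to $v''(t)$ for $\beta=2$). **Scheme.** For positive integers $M_1,M_2,N,K$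 put $h_1=L_1/M_1$, $h_2=L_2/M_2$, $\tau=T/N$, $\Delta\beta=1/K$, $x_i=ih_1$, $y_j=jh_2$, $t_n=n\tau$, $\beta_l=1+\frac{2l-1}2\Delta\beta$, $a_k^{(\beta)}=(k+1)^{2-\beta}-k^{2-\beta}$ and $\mu=\Delta\beta\sum_{l=1}^K\frac{p(\beta_l)}{\tau^{\beta_l}\Gamma(3-\beta_l)}$. Let $\delta_x^2,\delta_y^2$ be the usual central second difference quotients, $u^{n-\frac12}=\frac12(u^n+u^{n-1})$ and $\delta_tu^{n-\frac12}=\frac1\tau(u^n-u^{n-1})$. A grid function $u=(u_{ij}^n)$, $0\le i\le M_1$, $0\le j\le M_2$, $0\le n\le N$, solves the scheme if $$\Delta\beta\sum_{l=1}^Kp(\beta_l)\frac{\tau^{1-\beta_l}}{\Gamma(3-\beta_l)}\Big[a_0^{(\beta_l)}\delta_tu_{ij}^{n-\frac12}-\sum_{k=1}^{n-1}\big(a_{n-k-1}^{(\beta_l)}-a_{n-k}^{(\beta_l)}\big)\delta_tu_{ij}^{k-\frac12}-a_{n-1}^{(\beta_l)}\psi_2(x_i,y_j)\Big]+\frac{\tau}{4\mu}\delta_x^2\delta_y^2\delta_tu_{ij}^{n-\frac12}$$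 $$=\delta_x^2u_{ij}^{n-\frac12}+\delta_y^2u_{ij}^{n-\frac12}+f\big(x_i,y_j,t_{n-1},u_{ij}^{n-1}\big),\qquad 1\le i\le M_1-1,\ 1\le j\le M_2-1,\ 1\le n\le N,$$ with $u_{ij}^0=\psi_1(x_i,y_j)$ at interior nodes and $u_{ij}^n=\phi(x_i,y_j,t_n)$ at boundary nodes, $0\le n\le N$. The ADI procedure computes $u$ with the same initial and boundary values by solving on each level $n=1,\dots,N$, for intermediate values $u^*_{ij}$ $(0\le i\le M_1,\ 1\le j\le M_2-1)$, $$\Big(\sqrt\mu I-\tfrac1{2\sqrt\mu}\delta_x^2\Big)u_{ij}^*=\Big(\sqrt\mu I+\tfrac1{2\sqrt\mu}\delta_x^2\Big)\Big(\sqrt\mu I+\tfrac1{2\sqrt\mu}\delta_y^2\Big)u_{ij}^{n-1}+f\big(x_i,y_j,t_{n-1},u_{ij}^{n-1}\big)$$ $$+\Delta\beta\sum_{l=1}^K\frac{p(\beta_l)}{\tau^{\beta_l}\Gamma(3-\beta_l)}\Big[\sum_{k=1}^{n-1}\big(a_{n-k-1}^{(\beta_l)}-a_{n-k}^{(\beta_l)}\big)(u_{ij}^k-u_{ij}^{k-1})+\tau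 a_{n-1}^{(\beta_l)}\psi_2(x_i,y_j)\Big]$$ at the interior nodes, with $u^*_{ij}=\big(\sqrt\mu I-\frac1{2\sqrt\mu}\delta_y^2\big)u^n_{ij}$ for $i\in\{0,M_1\}$, and then $\big(\sqrt\mu I-\frac1{2\sqrt\mu}\delta_y^2\big)u_{ij}^n=u_{ij}^*$ at the interior nodes. **Theorem.** Suppose the continuous problem has a solution $U\in C^{4,4,3}_{x,y,t}(\bar\Omega\times[0,T])$, i.e. all derivatives $\partial_x^a\partial_y^b\partial_t^cU$ with $a\le4$, $b\le4$, $c\le3$ exist and are continuous on $\bar\Omega\times[0,T]$. Then there is a constant $C>0$, independent of $M_1,M_2,N,K$, such that for all positive integers $M_1,M_2,N,K$, every solution $u$ of the difference scheme or of the ADI procedure, and all $0\le n\le N$, the error $e_{ij}^n=U(x_i,y_j,t_n)-u_{ij}^n$ satisfies $$\|e^n\|=\Big(h_1h_2\sum_{i=1}^{M_1-1}\sum_{j=1}^{M_2-1}|e_{ij}^n|^2\Big)^{1/2}\le C\big(\tau+h_1^2+h_2^2+\Delta\beta^2\big).$$ -/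

import Mathlib

open Set

noncomputable section

namespace DistributedWave

/-- The data of the initial-boundary value problem on the rectangle `(0, L₁) × (0, L₂)` and the time
interval `[0, T]`: weight `p`, source `f x y t u`, boundary values `φ x y t`, initial value `ψ₁` and
initial velocity `ψ₂`. -/
structure Data where
  L₁ : ℝ
  L₂ : ℝ
  T : ℝ
  p : ℝ → ℝ
  f : ℝ → ℝ → ℝ → ℝ → ℝ
  φ : ℝ → ℝ → ℝ → ℝ
  ψ₁ : ℝ → ℝ → ℝ
  ψ₂ : ℝ → ℝ → ℝ

namespace Data

/-- The open rectangle. -/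
def Ω (P : Data) : Set (ℝ × ℝ) := Ioo 0 P.L₁ ×ˢ Ioo 0 P.L₂

/-- The standing assumptions on the data. -/
structure Admissible (P : Data) : Prop where
  L₁_pos : 0 < P.L₁
  L₂_pos : 0 < P.L₂
  T_pos : 0 < P.T
  p_contDiff : ContDiffOn ℝ 2 P.p (Icc 1 2)
  p_pos : ∀ β ∈ Icc (1 : ℝ) 2, 0 < P.p β
  φ_cont : ContinuousOn (fun z : (ℝ × ℝ) × ℝ => P.φ z.1.1 z.1.2 z.2)
    (frontier P.Ω ×ˢ Icc 0 P.T)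
  ψ₁_cont : ContinuousOn (fun z : ℝ × ℝ => P.ψ₁ z.1 z.2) P.Ω
  ψ₂_cont : ContinuousOn (fun z : ℝ × ℝ => P.ψ₂ z.1 z.2) P.Ω
  f_cont : ContinuousOn (fun z : (ℝ × ℝ) × ℝ × ℝ => P.f z.1.1 z.1.2 z.2.1 z.2.2)
    (P.Ω ×ˢ (Icc 0 P.T ×ˢ univ))
  f_lipschitz : ∃ Lf : ℝ, 0 < Lf ∧ ∀ x y t : ℝ, (x, y) ∈ P.Ω → t ∈ Icc 0 P.T → ∀ u₁ u₂ : ℝ,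
    |P.f x y t u₁ - P.f x y t u₂| ≤ Lf * |u₁ - u₂|

end Data

/-- The Caputo derivative of order `β ∈ [1, 2]`, started at `0`, of a function `v` on `[0, T]`;
time derivatives are one-sided at the end points of `[0, T]`. -/
def caputo (T : ℝ) (v : ℝ → ℝ) (β t : ℝ) : ℝ :=
  if β = 1 then derivWithin v (Icc 0 T) t - derivWithin v (Icc 0 T) 0
  else if β = 2 then iteratedDerivWithin 2 v (Icc 0 T) t
  else 1 / Real.Gamma (2 - β) *
    ∫ ξ in (0 : ℝ)..t, (t - ξ) ^ (1 - β) * iteratedDerivWithin 2 v (Icc 0 T) ξ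

/-- The closed space-time box. -/
def box (L₁ L₂ T : ℝ) : Set (ℝ × ℝ × ℝ) := Icc 0 L₁ ×ˢ Icc 0 L₂ ×ˢ Icc 0 T

/-- `u` has continuous partial derivatives `∂ₓᵃ ∂_yᵇ ∂ₜᶜ u` on the closed box for all `a ≤ 4`, `b ≤ 4`,
`c ≤ 3`; here `D a b c` is that derivative (one-sided at the faces of the box). -/
def IsC443 (L₁ L₂ T : ℝ) (u : ℝ → ℝ → ℝ → ℝ) : Prop :=
  ∃ D : ℕ → ℕ → ℕ → ℝ → ℝ → ℝ → ℝ,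
    (∀ x y t, (x, y, t) ∈ box L₁ L₂ T → D 0 0 0 x y t = u x y t) ∧
    (∀ a b c, a ≤ 4 → b ≤ 4 → c ≤ 3 →
      ContinuousOn (fun z : ℝ × ℝ × ℝ => D a b c z.1 z.2.1 z.2.2) (box L₁ L₂ T)) ∧
    (∀ a b c, a < 4 → b ≤ 4 → c ≤ 3 → ∀ x y t, (x, y, t) ∈ box L₁ L₂ T →
      HasDerivWithinAt (fun s => D a b c s y t) (D (a + 1) b c x y t) (Icc 0 L₁) x) ∧
    (∀ a b c, a ≤ 4 → b < 4 → c ≤ 3 → ∀ x y t, (x, y, t) ∈ box L₁ L₂ T →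
      HasDerivWithinAt (fun s => D a b c x s t) (D a (b + 1) c x y t) (Icc 0 L₂) y) ∧
    (∀ a b c, a ≤ 4 → b ≤ 4 → c < 3 → ∀ x y t, (x, y, t) ∈ box L₁ L₂ T →
      HasDerivWithinAt (fun s => D a b c x y s) (D a b (c + 1) x y t) (Icc 0 T) t)

/-- `u` solves the distributed-order wave equation with its boundary and initial conditions. -/
structure IsSolution (P : Data) (u : ℝ → ℝ → ℝ → ℝ) : Prop where
  equation : ∀ x y t : ℝ, (x, y) ∈ P.Ω → t ∈ Ioc 0 P.T →
    ∫ β in (1 : ℝ)..2, P.p β * caputo P.T (fun s => u x y s) β t =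
      iteratedDerivWithin 2 (fun s => u s y t) (Icc 0 P.L₁) x
        + iteratedDerivWithin 2 (fun s => u x s t) (Icc 0 P.L₂) y + P.f x y t (u x y t)
  boundary : ∀ x y t : ℝ, (x, y) ∈ frontier P.Ω → t ∈ Ico 0 P.T → u x y t = P.φ x y t
  initial : ∀ x y : ℝ, (x, y) ∈ P.Ω → u x y 0 = P.ψ₁ x y
  initial_velocity : ∀ x y : ℝ, (x, y) ∈ P.Ω →
    derivWithin (fun s => u x y s) (Icc 0 P.T) 0 = P.ψ₂ x y

/-- The discretization numbers: `M₁`, `M₂` space intervals, `N` time steps, `K` quadrature nodes. -/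
structure Mesh where
  M₁ : ℕ
  M₂ : ℕ
  N : ℕ
  K : ℕ
  M₁_pos : 0 < M₁
  M₂_pos : 0 < M₂
  N_pos : 0 < N
  K_pos : 0 < K

namespace Mesh

variable (m : Mesh) (P : Data)

def h₁ : ℝ := P.L₁ / m.M₁
def h₂ : ℝ := P.L₂ / m.M₂
def τ : ℝ := P.T / m.N
def Δβ : ℝ := 1 / m.K
def x (i : ℕ) : ℝ := i * m.h₁ P
def y (j : ℕ) : ℝ := j * m.h₂ P
def t (n : ℕ) : ℝ := n * m.τ P

/-- The quadrature nodes `β_l`, `1 ≤ l ≤ K`. -/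
def β (l : ℕ) : ℝ := 1 + (2 * (l : ℝ) - 1) / 2 * m.Δβ

/-- Interior grid indices. -/
def Interior (i j : ℕ) : Prop := 1 ≤ i ∧ i < m.M₁ ∧ 1 ≤ j ∧ j < m.M₂

/-- Boundary grid indices (corners included). -/
def Boundary (i j : ℕ) : Prop :=
  i ≤ m.M₁ ∧ j ≤ m.M₂ ∧ (i = 0 ∨ i = m.M₁ ∨ j = 0 ∨ j = m.M₂)

/-- `μ = Δβ ∑ p(β_l) / (τ^β_l Γ(3 - β_l))`. -/
def μ : ℝ :=
  m.Δβ * ∑ l ∈ Finset.Icc 1 m.K,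
    P.p (m.β l) * (1 / (m.τ P ^ m.β l * Real.Gamma (3 - m.β l)))

/-- The discrete `L²` norm of a grid function vanishing on the boundary. -/
def norm (v : ℕ → ℕ → ℝ) : ℝ :=
  Real.sqrt (m.h₁ P * m.h₂ P * ∑ i ∈ Finset.Ico 1 m.M₁, ∑ j ∈ Finset.Ico 1 m.M₂, |v i j| ^ 2)

end Mesh

/-- The backward difference in the first index: the value `δₓ v` at `(i - 1/2, j)`. -/
def dx (h : ℝ) (v : ℕ → ℕ → ℝ) (i j : ℕ) : ℝ := (v i j - v (i - 1) j) / h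

/-- The backward difference in the second index: the value `δ_y v` at `(i, j - 1/2)`. -/
def dy (h : ℝ) (v : ℕ → ℕ → ℝ) (i j : ℕ) : ℝ := (v i j - v i (j - 1)) / h

/-- The second difference `δₓ² v` at `(i, j)`. -/
def dxx (h : ℝ) (v : ℕ → ℕ → ℝ) (i j : ℕ) : ℝ := (dx h v (i + 1) j - dx h v i j) / h

/-- The second difference `δ_y² v` at `(i, j)`. -/
def dyy (h : ℝ) (v : ℕ → ℕ → ℝ) (i j : ℕ) : ℝ := (dy h v i (j + 1) - dy h v i j) / h

/-- The coefficients `a_k^(β) = (k + 1)^(2 - β) - k^(2 - β)`. -/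
def coeff (β : ℝ) (k : ℕ) : ℝ := ((k : ℝ) + 1) ^ (2 - β) - (k : ℝ) ^ (2 - β)

/-- Grid functions in space and time; `u n i j` is the value at `(x_i, y_j, t_n)`. -/
abbrev GridFun := ℕ → ℕ → ℕ → ℝ

/-- The mean `u^(n - 1/2)` of two consecutive time levels. -/
def mean (u : GridFun) (n : ℕ) (i j : ℕ) : ℝ := (u n i j + u (n - 1) i j) / 2

/-- The time difference `δₜ u^(n - 1/2)`. -/
def dt (τ : ℝ) (u : GridFun) (n : ℕ) (i j : ℕ) : ℝ := (u n i j - u (n - 1) i j) / τ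

/-- `u` solves the linearly implicit difference scheme. -/
structure IsSchemeSolution (P : Data) (m : Mesh) (u : GridFun) : Prop where
  step : ∀ n i j : ℕ, 1 ≤ n → n ≤ m.N → m.Interior i j →
    m.Δβ * ∑ l ∈ Finset.Icc 1 m.K,
        P.p (m.β l) * (m.τ P ^ (1 - m.β l) / Real.Gamma (3 - m.β l)) *
          (coeff (m.β l) 0 * dt (m.τ P) u n i j
            - ∑ k ∈ Finset.Ico 1 n,
                (coeff (m.β l) (n - k - 1) - coeff (m.β l) (n - k)) * dt (m.τ P) u k i j
            - coeff (m.β l) (n - 1) * P.ψ₂ (m.x P i) (m.y P j))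
      + m.τ P / (4 * m.μ P) * dxx (m.h₁ P) (dyy (m.h₂ P) (dt (m.τ P) u n)) i j
    = dxx (m.h₁ P) (mean u n) i j + dyy (m.h₂ P) (mean u n) i j
      + P.f (m.x P i) (m.y P j) (m.t P (n - 1)) (u (n - 1) i j)
  initial : ∀ i j : ℕ, m.Interior i j → u 0 i j = P.ψ₁ (m.x P i) (m.y P j)
  boundary : ∀ n i j : ℕ, n ≤ m.N → m.Boundary i j →
    u n i j = P.φ (m.x P i) (m.y P j) (m.t P n)

/-- The operator `√μ I + (s / (2 √μ)) δₓ²`. -/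
def factorX (μ h s : ℝ) (v : ℕ → ℕ → ℝ) (i j : ℕ) : ℝ :=
  Real.sqrt μ * v i j + s / (2 * Real.sqrt μ) * dxx h v i j

/-- The operator `√μ I + (s / (2 √μ)) δ_y²`. -/
def factorY (μ h s : ℝ) (v : ℕ → ℕ → ℝ) (i j : ℕ) : ℝ :=
  Real.sqrt μ * v i j + s / (2 * Real.sqrt μ) * dyy h v i j

/-- `u` is produced by the alternating direction procedure: on each time level a sweep in the
`x`-direction for the intermediate values `w`, then a sweep in the `y`-direction. -/
structure IsADISolution (P : Data) (m : Mesh) (u : GridFun) : Prop where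
  step : ∀ n : ℕ, 1 ≤ n → n ≤ m.N → ∃ w : ℕ → ℕ → ℝ,
    (∀ i j : ℕ, m.Interior i j →
      factorX (m.μ P) (m.h₁ P) (-1) w i j =
        factorX (m.μ P) (m.h₁ P) 1 (factorY (m.μ P) (m.h₂ P) 1 (u (n - 1))) i j
        + m.Δβ * ∑ l ∈ Finset.Icc 1 m.K,
            P.p (m.β l) * (1 / (m.τ P ^ m.β l * Real.Gamma (3 - m.β l))) *
              (∑ k ∈ Finset.Ico 1 n,
                  (coeff (m.β l) (n - k - 1) - coeff (m.β l) (n - k)) *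
                    (u k i j - u (k - 1) i j)
                + m.τ P * coeff (m.β l) (n - 1) * P.ψ₂ (m.x P i) (m.y P j))
        + P.f (m.x P i) (m.y P j) (m.t P (n - 1)) (u (n - 1) i j)) ∧
    (∀ j : ℕ, 1 ≤ j → j < m.M₂ →
      w 0 j = factorY (m.μ P) (m.h₂ P) (-1) (u n) 0 j ∧
      w m.M₁ j = factorY (m.μ P) (m.h₂ P) (-1) (u n) m.M₁ j) ∧
    (∀ i j : ℕ, m.Interior i j → factorY (m.μ P) (m.h₂ P) (-1) (u n) i j = w i j)
  initial : ∀ i j : ℕ, m.Interior i j → u 0 i j = P.ψ₁ (m.x P i) (m.y P j)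
  boundary : ∀ n i j : ℕ, n ≤ m.N → m.Boundary i j →
    u n i j = P.φ (m.x P i) (m.y P j) (m.t P n)

end DistributedWave

end

noncomputable section

namespace DistributedWave

/-! ### Finite differences in one variable -/

/-! The ADI procedure reduces to the scheme by eliminating the intermediate values
(`IsADISolution.isSchemeSolution`), so the theorem is consistency plus stability for the scheme. The
error `e` solves the scheme with zero initial and boundary values and a residual `F`.

Stability comes from testing with `δₜe`. The Laplacian of the mean telescopes in time, the mixed ADI
term is nonnegative (`sum_dxx_dyy_mul_self_nonneg`), and the memory term, whose weights `C k`
decrease, has a lower bound that telescopes (`memory_lower_bound`). Hence `energy_estimate`: the sum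
of `(C (m - k) + C (k - 1)) ‖δₜeᵏ‖²` is at most twice the sum of the pairings of `F` with `δₜe`. The
weights stay above a positive constant independent of the mesh (`exists_le_weight`), because `2 - β`
has average `1/2` over the orders. So the first half of the sum controls `‖δₜe‖²`, Cauchy–Schwarz in
time controls `‖e‖²`, and Gronwall handles the Lipschitz source.

Two parts of the residual are not uniformly of the desired order. First, the difference quotient of
the first time step misses the initial velocity by `O(τ)`, which contributes `O(τ) C (n - 1)` at
level `n`, and `C 0` is unbounded as `τ → 0`. The second half of the energy, `C (k - 1) ‖δₜeᵏ‖²`,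
absorbs this part: Young's inequality weighted by `C` itself leaves `τ² C (k - 1)`, and `τ ∑ C` is
bounded (`exists_sum_weight_le`).

Second, the midpoint rule in the order `β` meets `log² s` when `s ^ (2 - β)` is differentiated
twice. Integrating by parts in the fractional integral (`frac_eq`) leaves only such powers, with the
smooth weight `p(β) / Γ(3 - β)`, and `log²` is dominated by `s ^ (-1/4)`. The resulting factor `tₙ ^
(-1/4)` is square summable in time (`sum_rpow_sq_le`), which is all that the energy argument needs.

The residual at level `n` is measured against the differential equation at `tₙ₋₁`, so the equation
is also needed at `t = 0`; `IsSolution.equation_frac` obtains it by continuity. -/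

theorem abs_le_of_abs_deriv_le {φ φ' : ℝ → ℝ} {h B : ℝ}
    (hd : ∀ s ∈ Icc 0 h, HasDerivWithinAt φ (φ' s) (Icc 0 h) s) (h0 : φ 0 = 0)
    (hb : ∀ s ∈ Icc 0 h, |φ' s| ≤ B) : ∀ s ∈ Icc 0 h, |φ s| ≤ B * h := by
  intro s hs
  have hh : 0 ≤ h := hs.1.trans hs.2
  have hB : 0 ≤ B := (abs_nonneg _).trans (hb s hs)
  have := (convex_Icc 0 h).norm_image_sub_le_of_norm_hasDerivWithin_le hd hb
    (left_mem_Icc.2 hh) hs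
  simp only [h0, sub_zero, Real.norm_eq_abs] at this
  rw [abs_of_nonneg hs.1] at this
  exact this.trans (mul_le_mul_of_nonneg_left hs.2 hB)

theorem hasDerivWithinAt_shift_add {F F₁ : ℝ → ℝ} {a b x h : ℝ}
    (hF : ∀ z ∈ Icc a b, HasDerivWithinAt F (F₁ z) (Icc a b) z)
    (hx : a ≤ x - h) (hx' : x + h ≤ b) {s : ℝ} (hs : s ∈ Icc 0 h) :
    HasDerivWithinAt (fun s => F (x + s)) (F₁ (x + s)) (Icc 0 h) s := by
  have h1 : HasDerivWithinAt (fun s : ℝ => x + s) 1 (Icc 0 h) s :=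
    (hasDerivWithinAt_id s _).const_add x
  have h2 := HasDerivWithinAt.comp s (hF (x + s) ⟨by linarith [hs.1, hs.2], by linarith [hs.2]⟩) h1
    (fun r hr => ⟨by linarith [hr.1, hr.2], by linarith [hr.2]⟩)
  simpa [Function.comp_def] using h2

theorem hasDerivWithinAt_shift_sub {F F₁ : ℝ → ℝ} {a b x h : ℝ}
    (hF : ∀ z ∈ Icc a b, HasDerivWithinAt F (F₁ z) (Icc a b) z)
    (hx : a ≤ x - h) (hx' : x + h ≤ b) {s : ℝ} (hs : s ∈ Icc 0 h) :
    HasDerivWithinAt (fun s => F (x - s)) (-F₁ (x - s)) (Icc 0 h) s := by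
  have h1 : HasDerivWithinAt (fun s : ℝ => x - s) (-1) (Icc 0 h) s :=
    (hasDerivWithinAt_id s _).const_sub x
  have h2 := HasDerivWithinAt.comp s (hF (x - s) ⟨by linarith [hs.1, hs.2], by linarith [hs.1, hs.2]⟩) h1
    (fun r hr => ⟨by linarith [hr.1, hr.2], by linarith [hr.1, hr.2]⟩)
  simpa [Function.comp_def] using h2

/-- A second difference is bounded by the second derivative. -/
theorem abs_second_diff_le {F F₁ F₂ : ℝ → ℝ} {a b x h M : ℝ} (hh : 0 ≤ h)
    (hF : ∀ z ∈ Icc a b, HasDerivWithinAt F (F₁ z) (Icc a b) z)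
    (hF₁ : ∀ z ∈ Icc a b, HasDerivWithinAt F₁ (F₂ z) (Icc a b) z)
    (hM : ∀ z ∈ Icc a b, |F₂ z| ≤ M)
    (hx : a ≤ x - h) (hx' : x + h ≤ b) :
    |F (x + h) - 2 * F x + F (x - h)| ≤ 2 * M * h ^ 2 := by
  have m1 : ∀ s ∈ Icc 0 h, x + s ∈ Icc a b := fun s hs =>
    ⟨by linarith [hs.1, hs.2], by linarith [hs.2]⟩
  have m2 : ∀ s ∈ Icc 0 h, x - s ∈ Icc a b := fun s hs =>
    ⟨by linarith [hs.1, hs.2], by linarith [hs.1, hs.2]⟩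
  -- As a function of the step `s`, the symmetric difference and its first derivative vanish at `0`,
  -- so the mean value inequality applies twice. The factorials of Taylor's formula are given up,
  -- hence `2 * M` instead of `M`.
  have e1 := abs_le_of_abs_deriv_le (φ := fun s => F₁ (x + s) - F₁ (x - s))
    (φ' := fun s => F₂ (x + s) - -F₂ (x - s)) (h := h) (B := 2 * M)
    (fun s hs => (hasDerivWithinAt_shift_add hF₁ hx hx' hs).sub
      (hasDerivWithinAt_shift_sub hF₁ hx hx' hs)) (by simp)
    (fun s hs => (abs_sub _ _).trans (by
      rw [abs_neg]; linarith [hM _ (m1 s hs), hM _ (m2 s hs)]))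
  have e2 := abs_le_of_abs_deriv_le (φ := fun s => F (x + s) - 2 * F x + F (x - s))
    (φ' := fun s => F₁ (x + s) + -F₁ (x - s)) (h := h) (B := 2 * M * h)
    (fun s hs => ((hasDerivWithinAt_shift_add hF hx hx' hs).sub_const _).add
      (hasDerivWithinAt_shift_sub hF hx hx' hs)) (by simp; ring)
    (fun s hs => by simpa [sub_eq_add_neg] using e1 s hs)
  have := e2 h ⟨hh, le_rfl⟩
  calc _ ≤ _ := this
    _ = _ := by ring

/-- Consistency of the second difference for a three times differentiable function. -/
theorem abs_second_diff_sub_le_cube {F F₁ F₂ F₃ : ℝ → ℝ} {a b x h M : ℝ} (hh : 0 ≤ h)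
    (hF : ∀ z ∈ Icc a b, HasDerivWithinAt F (F₁ z) (Icc a b) z)
    (hF₁ : ∀ z ∈ Icc a b, HasDerivWithinAt F₁ (F₂ z) (Icc a b) z)
    (hF₂ : ∀ z ∈ Icc a b, HasDerivWithinAt F₂ (F₃ z) (Icc a b) z)
    (hM : ∀ z ∈ Icc a b, |F₃ z| ≤ M)
    (hx : a ≤ x - h) (hx' : x + h ≤ b) :
    |F (x + h) - 2 * F x + F (x - h) - h ^ 2 * F₂ x| ≤ 2 * M * h ^ 3 := by
  have m1 : ∀ s ∈ Icc 0 h, x + s ∈ Icc a b := fun s hs =>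
    ⟨by linarith [hs.1, hs.2], by linarith [hs.2]⟩
  have m2 : ∀ s ∈ Icc 0 h, x - s ∈ Icc a b := fun s hs =>
    ⟨by linarith [hs.1, hs.2], by linarith [hs.1, hs.2]⟩
  have e0 := abs_le_of_abs_deriv_le (φ := fun s => F₂ (x + s) - 2 * F₂ x + F₂ (x - s))
    (φ' := fun s => F₃ (x + s) + -F₃ (x - s)) (h := h) (B := 2 * M)
    (fun s hs => ((hasDerivWithinAt_shift_add hF₂ hx hx' hs).sub_const _).add
      (hasDerivWithinAt_shift_sub hF₂ hx hx' hs)) (by simp; ring)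
    (fun s hs => (abs_add_le _ _).trans (by
      rw [abs_neg]; linarith [hM _ (m1 s hs), hM _ (m2 s hs)]))
  have e1 := abs_le_of_abs_deriv_le (φ := fun s => F₁ (x + s) - F₁ (x - s) - (2 * F₂ x) * s)
    (φ' := fun s => F₂ (x + s) - -F₂ (x - s) - (2 * F₂ x) * 1) (h := h) (B := 2 * M * h)
    (fun s hs => ((hasDerivWithinAt_shift_add hF₁ hx hx' hs).sub
      (hasDerivWithinAt_shift_sub hF₁ hx hx' hs)).sub
        ((hasDerivWithinAt_id s _).const_mul (2 * F₂ x))) (by simp)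
    (fun s hs => by
      have := e0 s hs
      convert this using 2; ring)
  have e2 := abs_le_of_abs_deriv_le
    (φ := fun s => F (x + s) - 2 * F x + F (x - s) - F₂ x * (s * s))
    (φ' := fun s => F₁ (x + s) + -F₁ (x - s) - F₂ x * (1 * s + s * 1)) (h := h)
    (B := 2 * M * h * h)
    (fun s hs => (((hasDerivWithinAt_shift_add hF hx hx' hs).sub_const _).add
      (hasDerivWithinAt_shift_sub hF hx hx' hs)).sub
        (((hasDerivWithinAt_id s _).mul (hasDerivWithinAt_id s _)).const_mul (F₂ x)))
    (by simp; ring)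
    (fun s hs => by
      have := e1 s hs
      convert this using 2; ring)
  have := e2 h ⟨hh, le_rfl⟩
  calc _ = |F (x + h) - 2 * F x + F (x - h) - F₂ x * (h * h)| := by congr 1; ring
    _ ≤ _ := this
    _ = _ := by ring

/-- Consistency of the second difference for a four times differentiable function. -/
theorem abs_second_diff_sub_le {F F₁ F₂ F₃ F₄ : ℝ → ℝ} {a b x h M : ℝ} (hh : 0 ≤ h)
    (hF : ∀ z ∈ Icc a b, HasDerivWithinAt F (F₁ z) (Icc a b) z)
    (hF₁ : ∀ z ∈ Icc a b, HasDerivWithinAt F₁ (F₂ z) (Icc a b) z)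
    (hF₂ : ∀ z ∈ Icc a b, HasDerivWithinAt F₂ (F₃ z) (Icc a b) z)
    (hF₃ : ∀ z ∈ Icc a b, HasDerivWithinAt F₃ (F₄ z) (Icc a b) z)
    (hM : ∀ z ∈ Icc a b, |F₄ z| ≤ M)
    (hx : a ≤ x - h) (hx' : x + h ≤ b) :
    |F (x + h) - 2 * F x + F (x - h) - h ^ 2 * F₂ x| ≤ 2 * M * h ^ 4 := by
  -- Differentiating twice in the step leaves the second difference of `F₂`, which is already of
  -- order two.
  have key : ∀ s ∈ Icc 0 h, |F₂ (x + s) - 2 * F₂ x + F₂ (x - s)| ≤ 2 * M * h ^ 2 := by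
    intro s hs
    have hM0 : 0 ≤ M := (abs_nonneg _).trans (hM x ⟨by linarith [hs.1], by linarith⟩)
    refine (abs_second_diff_le hs.1 hF₂ hF₃ hM (by linarith [hs.2]) (by linarith [hs.2])).trans ?_
    have := hs.1
    have := hs.2
    gcongr
  have e1 := abs_le_of_abs_deriv_le (φ := fun s => F₁ (x + s) - F₁ (x - s) - (2 * F₂ x) * s)
    (φ' := fun s => F₂ (x + s) - -F₂ (x - s) - (2 * F₂ x) * 1) (h := h) (B := 2 * M * h ^ 2)
    (fun s hs => ((hasDerivWithinAt_shift_add hF₁ hx hx' hs).sub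
      (hasDerivWithinAt_shift_sub hF₁ hx hx' hs)).sub
        ((hasDerivWithinAt_id s _).const_mul (2 * F₂ x))) (by simp)
    (fun s hs => by
      have := key s hs
      convert this using 2; ring)
  have e2 := abs_le_of_abs_deriv_le
    (φ := fun s => F (x + s) - 2 * F x + F (x - s) - F₂ x * (s * s))
    (φ' := fun s => F₁ (x + s) + -F₁ (x - s) - F₂ x * (1 * s + s * 1)) (h := h)
    (B := 2 * M * h ^ 2 * h)
    (fun s hs => (((hasDerivWithinAt_shift_add hF hx hx' hs).sub_const _).add
      (hasDerivWithinAt_shift_sub hF hx hx' hs)).sub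
        (((hasDerivWithinAt_id s _).mul (hasDerivWithinAt_id s _)).const_mul (F₂ x)))
    (by simp; ring)
    (fun s hs => by
      have := e1 s hs
      convert this using 2; ring)
  have := e2 h ⟨hh, le_rfl⟩
  calc _ = |F (x + h) - 2 * F x + F (x - h) - F₂ x * (h * h)| := by congr 1; ring
    _ ≤ _ := this
    _ = _ := by ring

theorem abs_sub_le_of_deriv {F F₁ : ℝ → ℝ} {a b M : ℝ}
    (hF : ∀ z ∈ Icc a b, HasDerivWithinAt F (F₁ z) (Icc a b) z)
    (hM : ∀ z ∈ Icc a b, |F₁ z| ≤ M) {x z : ℝ} (hx : x ∈ Icc a b) (hz : z ∈ Icc a b) :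
    |F z - F x| ≤ M * |z - x| :=
  (convex_Icc a b).norm_image_sub_le_of_norm_hasDerivWithin_le hF hM hx hz

/-- Mean value inequality for `F` minus its tangent, on the segment between `x` and `z`. The point
`z` may lie on either side of `x`, as the midpoint rule requires. -/
theorem abs_taylor_one_le {F F₁ F₂ : ℝ → ℝ} {a b M : ℝ}
    (hF : ∀ z ∈ Icc a b, HasDerivWithinAt F (F₁ z) (Icc a b) z)
    (hF₁ : ∀ z ∈ Icc a b, HasDerivWithinAt F₁ (F₂ z) (Icc a b) z)
    (hM : ∀ z ∈ Icc a b, |F₂ z| ≤ M) {x z : ℝ} (hx : x ∈ Icc a b) (hz : z ∈ Icc a b) :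
    |F z - F x - F₁ x * (z - x)| ≤ M * |z - x| ^ 2 := by
  have hM0 : 0 ≤ M := (abs_nonneg _).trans (hM x hx)
  have hsub : uIcc x z ⊆ Icc a b := uIcc_subset_Icc hx hz
  have h := (convex_uIcc x z).norm_image_sub_le_of_norm_hasDerivWithin_le
    (f := fun y => F y - F x - F₁ x * (y - x)) (f' := fun y => F₁ y - F₁ x * 1)
    (C := M * |z - x|) (x := x) (y := z)
    (fun y hy => (((hF y (hsub hy)).mono hsub).sub_const _).sub
        (((hasDerivWithinAt_id y _).sub_const x).const_mul (F₁ x)))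
    (fun y hy => by
      rw [mul_one]
      refine (abs_sub_le_of_deriv hF₁ hM hx (hsub hy)).trans ?_
      exact mul_le_mul_of_nonneg_left (abs_sub_left_of_mem_uIcc hy) hM0)
    left_mem_uIcc right_mem_uIcc
  simp only [sub_self, mul_zero, sub_zero, Real.norm_eq_abs] at h
  calc _ ≤ _ := h
    _ = _ := by ring

/-! ### Summation by parts -/

theorem sum_by_parts (a b : ℕ → ℝ) {M : ℕ} (hM : 1 ≤ M) :
    ∑ i ∈ Finset.Ico 1 M, (a (i + 1) - a i) * b i
      + ∑ i ∈ Finset.Ico 1 (M + 1), a i * (b i - b (i - 1)) = a M * b M - a 1 * b 0 := by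
  induction M, hM using Nat.le_induction with
  | base => simp; ring
  | succ M hM ih =>
    rw [Finset.sum_Ico_succ_top hM, Finset.sum_Ico_succ_top (by omega : 1 ≤ M + 1)]
    simp only [Nat.add_sub_cancel]
    linarith

/-- Abel summation in the first index. Only the test function `w` has to vanish at the ends; `v` is
arbitrary, so `v` may itself be a second difference. -/
theorem sum_dxx_mul {M₁ M₂ : ℕ} (hM : 1 ≤ M₁) (h : ℝ) (v w : ℕ → ℕ → ℝ)
    (h0 : ∀ j ∈ Finset.Ico 1 M₂, w 0 j = 0) (h1 : ∀ j ∈ Finset.Ico 1 M₂, w M₁ j = 0) :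
    ∑ s ∈ Finset.Ico 1 M₁ ×ˢ Finset.Ico 1 M₂, dxx h v s.1 s.2 * w s.1 s.2
      = -∑ s ∈ Finset.Ico 1 (M₁ + 1) ×ˢ Finset.Ico 1 M₂, dx h v s.1 s.2 * dx h w s.1 s.2 := by
  rw [Finset.sum_product_right, Finset.sum_product_right, ← Finset.sum_neg_distrib]
  refine Finset.sum_congr rfl fun j hj => ?_
  have := sum_by_parts (fun i => dx h v i j / h) (fun i => w i j) hM
  rw [h0 j hj, h1 j hj, mul_zero, mul_zero, sub_zero] at this
  rw [← Finset.sum_neg_distrib]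
  rw [add_eq_zero_iff_eq_neg, ← Finset.sum_neg_distrib] at this
  convert this using 2 with i hi i hi
  · simp only [dxx]; ring
  · simp only [dx]; ring

theorem sum_dyy_mul {M₂ : ℕ} (s : Finset ℕ) (hM : 1 ≤ M₂) (h : ℝ) (v w : ℕ → ℕ → ℝ)
    (h0 : ∀ i ∈ s, w i 0 = 0) (h1 : ∀ i ∈ s, w i M₂ = 0) :
    ∑ s ∈ s ×ˢ Finset.Ico 1 M₂, dyy h v s.1 s.2 * w s.1 s.2
      = -∑ s ∈ s ×ˢ Finset.Ico 1 (M₂ + 1), dy h v s.1 s.2 * dy h w s.1 s.2 := by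
  rw [Finset.sum_product, Finset.sum_product, ← Finset.sum_neg_distrib]
  refine Finset.sum_congr rfl fun i hi => ?_
  have := sum_by_parts (fun j => dy h v i j / h) (fun j => w i j) hM
  rw [h0 i hi, h1 i hi, mul_zero, mul_zero, sub_zero] at this
  rw [← Finset.sum_neg_distrib]
  rw [add_eq_zero_iff_eq_neg, ← Finset.sum_neg_distrib] at this
  convert this using 2 with i hi i hi
  · simp only [dyy]; ring
  · simp only [dy]; ring

/-- Differences in the two directions commute, so summing by parts once in each direction gives the
sum of squares of the mixed first difference. -/
theorem sum_dxx_dyy_mul_self_nonneg {M₁ M₂ : ℕ} (hM₁ : 1 ≤ M₁) (hM₂ : 1 ≤ M₂) (h k : ℝ)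
    (w : ℕ → ℕ → ℝ)
    (hw : ∀ i j, i ≤ M₁ → j ≤ M₂ → (i = 0 ∨ i = M₁ ∨ j = 0 ∨ j = M₂) → w i j = 0) :
    0 ≤ ∑ s ∈ Finset.Ico 1 M₁ ×ˢ Finset.Ico 1 M₂, dxx h (dyy k w) s.1 s.2 * w s.1 s.2 := by
  rw [sum_dxx_mul hM₁]
  rotate_left
  · intro j hj; rw [Finset.mem_Ico] at hj; exact hw _ _ (by omega) (by omega) (by omega)
  · intro j hj; rw [Finset.mem_Ico] at hj; exact hw _ _ (by omega) (by omega) (by omega)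
  have : ∀ s : ℕ × ℕ, dx h (dyy k w) s.1 s.2 = dyy k (dx h w) s.1 s.2 := by
    intro s; simp only [dx, dyy, dy]; ring
  simp only [this]
  rw [sum_dyy_mul _ hM₂, neg_neg]
  · exact Finset.sum_nonneg fun s _ => mul_self_nonneg _
  · intro i hi; rw [Finset.mem_Ico] at hi
    rw [dx, hw i 0 (by omega) (by omega) (by omega), hw (i - 1) 0 (by omega) (by omega) (by omega)]
    simp
  · intro i hi; rw [Finset.mem_Ico] at hi
    rw [dx, hw i M₂ (by omega) (by omega) (by omega),
      hw (i - 1) M₂ (by omega) (by omega) (by omega)]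
    simp

/-! ### The energy estimate -/

/-- Young's inequality on each product `w k * w n`, with coefficients nonnegative because `C`
decreases. These coefficients telescope to `C 0 - C (n - 1)`, so half of `(C 0 + C (n - 1)) * w n ^
2` survives. The left side is a difference in `n` of the sums of `C (n - k) * w k ^ 2`, ready to
telescope, plus the extra term with `C (n - 1)`. -/
theorem memory_lower_bound {C : ℕ → ℝ} (hC : Antitone C) (w : ℕ → ℝ) {n : ℕ} (hn : 1 ≤ n) :
    (∑ k ∈ Finset.Ico 1 (n + 1), C (n - k) * w k ^ 2
        - ∑ k ∈ Finset.Ico 1 n, C (n - 1 - k) * w k ^ 2 + C (n - 1) * w n ^ 2) / 2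
      ≤ (C 0 * w n - ∑ k ∈ Finset.Ico 1 n, (C (n - k - 1) - C (n - k)) * w k) * w n := by
  have htel : ∑ k ∈ Finset.Ico 1 n, (C (n - k - 1) - C (n - k)) = C 0 - C (n - 1) := by
    obtain ⟨r, rfl⟩ := Nat.exists_eq_add_of_le' hn
    have e : ∀ k ∈ Finset.Ico 1 (r + 1), C (r + 1 - k - 1) - C (r + 1 - k)
        = -(fun j => C j) (r + 1 - k) + (fun j => C j) (r - k) := by
      intro k _
      rw [show r + 1 - k - 1 = r - k by omega]; ring
    rw [Finset.sum_congr rfl e]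
    clear e hn
    rw [Finset.sum_Ico_eq_sum_range]
    have e2 : ∀ k ∈ Finset.range (r + 1 - 1), -(fun j => C j) (r + 1 - (1 + k))
        + (fun j => C j) (r - (1 + k)) = (fun i => C (r - i)) (k + 1) - (fun i => C (r - i)) k := by
      intro k _
      simp only
      rw [show r + 1 - (1 + k) = r - k by omega, show 1 + k = k + 1 by omega]; ring
    rw [Finset.sum_congr rfl e2, Finset.sum_range_sub (fun i => C (r - i))]
    simp
  have h1 : ∑ k ∈ Finset.Ico 1 n, (C (n - k - 1) - C (n - k)) * w k * w n
      ≤ ∑ k ∈ Finset.Ico 1 n, ((C (n - k - 1) - C (n - k)) * w k ^ 2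
        + (C (n - k - 1) - C (n - k)) * w n ^ 2) / 2 := by
    refine Finset.sum_le_sum fun k _ => ?_
    have : 0 ≤ C (n - k - 1) - C (n - k) := sub_nonneg.2 (hC (by omega))
    nlinarith [mul_nonneg this (sq_nonneg (w k - w n))]
  rw [← Finset.sum_div, Finset.sum_add_distrib, ← Finset.sum_mul, ← Finset.sum_mul, htel] at h1
  have h2 : ∑ k ∈ Finset.Ico 1 n, (C (n - k - 1) - C (n - k)) * w k ^ 2
      = ∑ k ∈ Finset.Ico 1 n, C (n - 1 - k) * w k ^ 2
        - ∑ k ∈ Finset.Ico 1 n, C (n - k) * w k ^ 2 := by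
    rw [← Finset.sum_sub_distrib]
    refine Finset.sum_congr rfl fun k _ => ?_
    rw [show n - 1 - k = n - k - 1 by omega]; ring
  rw [Finset.sum_Ico_succ_top hn, Nat.sub_self]
  rw [h2] at h1
  nlinarith [h1]

/-- The sum of squared first differences. -/
def gradSq (M₁ M₂ : ℕ) (h₁ h₂ : ℝ) (v : ℕ → ℕ → ℝ) : ℝ :=
  ∑ s ∈ Finset.Ico 1 (M₁ + 1) ×ˢ Finset.Ico 1 M₂, dx h₁ v s.1 s.2 ^ 2
    + ∑ s ∈ Finset.Ico 1 M₁ ×ˢ Finset.Ico 1 (M₂ + 1), dy h₂ v s.1 s.2 ^ 2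

theorem gradSq_nonneg (M₁ M₂ : ℕ) (h₁ h₂ : ℝ) (v : ℕ → ℕ → ℝ) : 0 ≤ gradSq M₁ M₂ h₁ h₂ v :=
  add_nonneg (Finset.sum_nonneg fun _ _ => sq_nonneg _) (Finset.sum_nonneg fun _ _ => sq_nonneg _)

/-- The mean of two levels times their difference is half a difference of squares; this makes the
Laplacian telescope. -/
theorem sum_laplace_mean_mul_dt {M₁ M₂ : ℕ} (hM₁ : 1 ≤ M₁) (hM₂ : 1 ≤ M₂) (h₁ h₂ τ : ℝ)
    (e : GridFun) (n : ℕ)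
    (hb : ∀ i j, i ≤ M₁ → j ≤ M₂ → (i = 0 ∨ i = M₁ ∨ j = 0 ∨ j = M₂) → dt τ e n i j = 0) :
    ∑ s ∈ Finset.Ico 1 M₁ ×ˢ Finset.Ico 1 M₂,
        (dxx h₁ (mean e n) s.1 s.2 + dyy h₂ (mean e n) s.1 s.2) * dt τ e n s.1 s.2
      = -(gradSq M₁ M₂ h₁ h₂ (e n) - gradSq M₁ M₂ h₁ h₂ (e (n - 1))) / (2 * τ) := by
  simp only [add_mul, Finset.sum_add_distrib]
  rw [sum_dxx_mul hM₁, sum_dyy_mul _ hM₂]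
  · have ex : ∀ s : ℕ × ℕ, dx h₁ (mean e n) s.1 s.2 * dx h₁ (dt τ e n) s.1 s.2
        = (dx h₁ (e n) s.1 s.2 ^ 2 - dx h₁ (e (n - 1)) s.1 s.2 ^ 2) / (2 * τ) := by
      intro s; simp only [dx, mean, dt]; ring
    have ey : ∀ s : ℕ × ℕ, dy h₂ (mean e n) s.1 s.2 * dy h₂ (dt τ e n) s.1 s.2
        = (dy h₂ (e n) s.1 s.2 ^ 2 - dy h₂ (e (n - 1)) s.1 s.2 ^ 2) / (2 * τ) := by
      intro s; simp only [dy, mean, dt]; ring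
    simp only [ex, ey, ← Finset.sum_div, Finset.sum_sub_distrib, gradSq]
    ring
  all_goals
    intro i hi; rw [Finset.mem_Ico] at hi; exact hb _ _ (by omega) (by omega) (by omega)

/-- The error equation, an abstract form of the difference scheme. -/
structure IsErrorGrid (M₁ M₂ N : ℕ) (h₁ h₂ τ κ : ℝ) (C : ℕ → ℝ) (F e : GridFun) : Prop where
  step : ∀ n i j : ℕ, 1 ≤ n → n ≤ N → i ∈ Finset.Ico 1 M₁ → j ∈ Finset.Ico 1 M₂ →
    C 0 * dt τ e n i j - ∑ k ∈ Finset.Ico 1 n, (C (n - k - 1) - C (n - k)) * dt τ e k i j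
      + κ * dxx h₁ (dyy h₂ (dt τ e n)) i j
    = dxx h₁ (mean e n) i j + dyy h₂ (mean e n) i j + F n i j
  initial : ∀ i j, i ≤ M₁ → j ≤ M₂ → e 0 i j = 0
  boundary : ∀ n i j, n ≤ N → i ≤ M₁ → j ≤ M₂ → (i = 0 ∨ i = M₁ ∨ j = 0 ∨ j = M₂) → e n i j = 0

/-- The tested error equation is summed over the time levels. The terms with `C (k - 1)` are kept
because they later absorb the defect of the first time step. -/
theorem energy_estimate {M₁ M₂ N : ℕ} (hM₁ : 1 ≤ M₁) (hM₂ : 1 ≤ M₂) {h₁ h₂ τ κ : ℝ}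
    (hτ : 0 < τ) (hκ : 0 ≤ κ) {C : ℕ → ℝ} (hC : Antitone C) {F e : GridFun}
    (he : IsErrorGrid M₁ M₂ N h₁ h₂ τ κ C F e) {m : ℕ} (hm : m ≤ N) :
    ∑ k ∈ Finset.Ico 1 (m + 1), (C (m - k) + C (k - 1)) *
        ∑ s ∈ Finset.Ico 1 M₁ ×ˢ Finset.Ico 1 M₂, dt τ e k s.1 s.2 ^ 2
      ≤ 2 * ∑ n ∈ Finset.Ico 1 (m + 1),
        ∑ s ∈ Finset.Ico 1 M₁ ×ˢ Finset.Ico 1 M₂, F n s.1 s.2 * dt τ e n s.1 s.2 := by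
  set S := Finset.Ico 1 M₁ ×ˢ Finset.Ico 1 M₂ with hS
  set Q : ℕ → ℝ := fun k => ∑ s ∈ S, dt τ e k s.1 s.2 ^ 2 with hQ
  -- The gradient term, nonnegative and dropped at the end, has to be carried through the induction.
  suffices H : ∀ m ≤ N, ∑ k ∈ Finset.Ico 1 (m + 1), (C (m - k) + C (k - 1)) * Q k
      + gradSq M₁ M₂ h₁ h₂ (e m) / τ ≤ 2 * ∑ n ∈ Finset.Ico 1 (m + 1),
        ∑ s ∈ S, F n s.1 s.2 * dt τ e n s.1 s.2 by
    have h1 := H m hm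
    have h2 : 0 ≤ gradSq M₁ M₂ h₁ h₂ (e m) / τ := div_nonneg (gradSq_nonneg _ _ _ _ _) hτ.le
    linarith
  clear hm m
  intro m
  induction m with
  | zero =>
    intro _
    have : gradSq M₁ M₂ h₁ h₂ (e 0) = 0 := by
      rw [gradSq, Finset.sum_eq_zero, Finset.sum_eq_zero, add_zero]
      · rintro ⟨i, j⟩ hs
        simp only [Finset.mem_product, Finset.mem_Ico] at hs
        rw [dy, he.initial _ _ (by omega) (by omega), he.initial _ _ (by omega) (by omega)]
        simp
      · rintro ⟨i, j⟩ hs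
        simp only [Finset.mem_product, Finset.mem_Ico] at hs
        rw [dx, he.initial _ _ (by omega) (by omega), he.initial _ _ (by omega) (by omega)]
        simp
    simp [this]
  | succ m ih =>
    intro hm
    have ih := ih (by omega)
    set n := m + 1 with hn
    have hbt : ∀ i j, i ≤ M₁ → j ≤ M₂ → (i = 0 ∨ i = M₁ ∨ j = 0 ∨ j = M₂) →
        dt τ e n i j = 0 := by
      intro i j hi hj hij
      rw [dt, he.boundary n i j hm hi hj hij, he.boundary (n - 1) i j (by omega) hi hj hij]
      simp
    have e1 : ∑ s ∈ S, (C 0 * dt τ e n s.1 s.2 - ∑ k ∈ Finset.Ico 1 n,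
          (C (n - k - 1) - C (n - k)) * dt τ e k s.1 s.2) * dt τ e n s.1 s.2
        + κ * ∑ s ∈ S, dxx h₁ (dyy h₂ (dt τ e n)) s.1 s.2 * dt τ e n s.1 s.2
        = -(gradSq M₁ M₂ h₁ h₂ (e n) - gradSq M₁ M₂ h₁ h₂ (e (n - 1))) / (2 * τ)
          + ∑ s ∈ S, F n s.1 s.2 * dt τ e n s.1 s.2 := by
      rw [← sum_laplace_mean_mul_dt hM₁ hM₂ h₁ h₂ τ e n hbt, Finset.mul_sum,
        ← Finset.sum_add_distrib, ← Finset.sum_add_distrib]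
      refine Finset.sum_congr rfl fun s hs => ?_
      rw [Finset.mem_product] at hs
      have := he.step n s.1 s.2 (by omega) hm hs.1 hs.2
      rw [← add_mul, ← this]; ring
    have e2 := mul_nonneg hκ (sum_dxx_dyy_mul_self_nonneg hM₁ hM₂ h₁ h₂ (dt τ e n) hbt)
    have e3 : (∑ k ∈ Finset.Ico 1 (n + 1), C (n - k) * Q k
        - ∑ k ∈ Finset.Ico 1 n, C (n - 1 - k) * Q k + C (n - 1) * Q n) / 2
        ≤ ∑ s ∈ S, (C 0 * dt τ e n s.1 s.2 - ∑ k ∈ Finset.Ico 1 n,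
          (C (n - k - 1) - C (n - k)) * dt τ e k s.1 s.2) * dt τ e n s.1 s.2 := by
      have := Finset.sum_le_sum fun s (_ : s ∈ S) =>
        memory_lower_bound hC (fun k => dt τ e k s.1 s.2) (show 1 ≤ n by omega)
      refine le_trans (le_of_eq ?_) this
      simp only [hQ, Finset.mul_sum]
      rw [← Finset.sum_div, Finset.sum_add_distrib, Finset.sum_sub_distrib,
        Finset.sum_comm, Finset.sum_comm (s := S) (t := Finset.Ico 1 n)]
    rw [← hS] at e2
    rw [show n - 1 = m by omega] at e1 e3
    have hg : (gradSq M₁ M₂ h₁ h₂ (e n) - gradSq M₁ M₂ h₁ h₂ (e m)) / (2 * τ)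
        = (gradSq M₁ M₂ h₁ h₂ (e n) / τ - gradSq M₁ M₂ h₁ h₂ (e m) / τ) / 2 := by
      ring
    rw [neg_div, hg] at e1
    rw [Finset.sum_Ico_succ_top (show 1 ≤ n by omega) (fun n => ∑ s ∈ S, F n s.1 s.2 * dt τ e n s.1 s.2)]
    simp only [add_mul, Finset.sum_add_distrib] at ih ⊢
    rw [Finset.sum_Ico_succ_top (show 1 ≤ n by omega) (fun k => C (k - 1) * Q k)]
    rw [show n - 1 = m by omega]
    linarith

/-! ### Discrete Gronwall inequality and stability -/

theorem discrete_gronwall {G : ℕ → ℝ} {a b : ℝ} (hb : 0 ≤ b) {N : ℕ}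
    (hG : ∀ m ≤ N, G m ≤ a + b * ∑ k ∈ Finset.range m, G k) :
    ∀ m ≤ N, G m ≤ a * (1 + b) ^ m := by
  intro m
  induction m using Nat.strong_induction_on with
  | _ m ih =>
    intro hm
    refine (hG m hm).trans ?_
    have h1 : ∑ k ∈ Finset.range m, G k ≤ ∑ k ∈ Finset.range m, a * (1 + b) ^ k :=
      Finset.sum_le_sum fun k hk => ih k (Finset.mem_range.1 hk)
        ((Finset.mem_range.1 hk).le.trans hm)
    -- The geometric sequence solves the recursion with equality.
    have h2 : ∀ m : ℕ, a + b * ∑ k ∈ Finset.range m, a * (1 + b) ^ k = a * (1 + b) ^ m := by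
      intro m
      induction m with
      | zero => simp
      | succ m ih => rw [Finset.sum_range_succ, mul_add, ← add_assoc, ih]; ring
    rw [← h2 m]
    gcongr

/-- Cauchy–Schwarz applied to the telescoping sum of time differences, starting from the zero
initial value. -/
theorem sq_le_sum_dt {τ T : ℝ} (hτ : 0 < τ) (e : GridFun) {m i j : ℕ} (hm : m * τ ≤ T)
    (h0 : e 0 i j = 0) :
    e m i j ^ 2 ≤ T * (τ * ∑ k ∈ Finset.Ico 1 (m + 1), dt τ e k i j ^ 2) := by
  have h1 : e m i j = τ * ∑ k ∈ Finset.range m, dt τ e (k + 1) i j := by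
    rw [Finset.mul_sum]
    have : ∀ k ∈ Finset.range m, τ * dt τ e (k + 1) i j
        = (fun k => e k i j) (k + 1) - (fun k => e k i j) k := by
      intro k _
      simp only [dt, Nat.add_sub_cancel]
      field_simp
    rw [Finset.sum_congr rfl this, Finset.sum_range_sub (fun k => e k i j), h0, sub_zero]
  have h2 : ∑ k ∈ Finset.Ico 1 (m + 1), dt τ e k i j ^ 2
      = ∑ k ∈ Finset.range m, dt τ e (k + 1) i j ^ 2 := by
    rw [Finset.sum_Ico_eq_sum_range]
    simp [add_comm]
  have h3 := sq_sum_le_card_mul_sum_sq (s := Finset.range m) (f := fun k => dt τ e (k + 1) i j)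
  rw [Finset.card_range] at h3
  rw [h2, h1, mul_pow]
  set X := ∑ k ∈ Finset.range m, dt τ e (k + 1) i j ^ 2 with hX
  have hX0 : 0 ≤ X := Finset.sum_nonneg fun _ _ => sq_nonneg _
  calc _ ≤ τ ^ 2 * (m * X) := by gcongr
    _ = (m * τ) * (τ * X) := by ring
    _ ≤ _ := by gcongr

/-- The part `L * |E| + S` is paid for by `c / 2 * w ^ 2`, while `B * D` is paid for by `D * w ^ 2`.
The remainder is then linear in `D`, not quadratic, so `D` need not be bounded. -/
theorem two_mul_mul_le_young {c F w E S D B L : ℝ} (hc : 0 < c) (hD : 0 ≤ D)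
    (hF : |F| ≤ L * |E| + S + B * D) :
    2 * (F * w) ≤ c / 2 * w ^ 2 + 4 / c * (L ^ 2 * E ^ 2 + S ^ 2) + D * w ^ 2 + B ^ 2 * D := by
  have h1 : 2 * (F * w) ≤ 2 * ((L * |E| + S + B * D) * |w|) := by
    have := le_abs_self (F * w)
    rw [abs_mul] at this
    nlinarith [abs_nonneg w, mul_le_mul_of_nonneg_right hF (abs_nonneg w)]
  have hw : |w| ^ 2 = w ^ 2 := sq_abs w
  have hE : |E| ^ 2 = E ^ 2 := sq_abs E
  have h2 : 2 * (B * D * |w|) ≤ D * w ^ 2 + B ^ 2 * D := by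
    nlinarith [mul_nonneg hD (sq_nonneg (|w| - B))]
  have h3 : ∀ a : ℝ, 2 * (a * |w|) ≤ c / 2 * w ^ 2 + 2 / c * a ^ 2 := by
    intro a
    have : c / 2 * w ^ 2 + 2 / c * a ^ 2 - 2 * (a * |w|) = (2 / c) * (c / 2 * |w| - a) ^ 2 := by
      rw [← hw]; field_simp; ring
    have h : 0 ≤ (2 / c) * (c / 2 * |w| - a) ^ 2 := by positivity
    linarith
  have h4 : 2 / c * (L * |E| + S) ^ 2 ≤ 4 / c * (L ^ 2 * E ^ 2 + S ^ 2) := by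
    rw [← hE, show 4 / c = 2 / c * 2 by ring, mul_assoc]
    have : 0 ≤ 2 / c := by positivity
    refine mul_le_mul_of_nonneg_left ?_ this
    nlinarith [sq_nonneg (L * |E| - S)]
  have := h3 (L * |E| + S)
  nlinarith

/-- Stability of the scheme: the part of the residual that is dominated by the memory kernel `C` is
absorbed by the memory term. -/
theorem stability {M₁ M₂ N : ℕ} (hM₁ : 1 ≤ M₁) (hM₂ : 1 ≤ M₂) {h₁ h₂ τ κ c Lf B T Cs Sb : ℝ}
    (hτ : 0 < τ) (hκ : 0 ≤ κ) (hc : 0 < c) (hT : N * τ ≤ T)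
    {C S : ℕ → ℝ} (hC : Antitone C) (hCc : ∀ k < N, c ≤ C k)
    (hCs : τ * ∑ k ∈ Finset.range N, C k ≤ Cs)
    (hSb : τ * ∑ k ∈ Finset.range N, S (k + 1) ^ 2 ≤ Sb) {F e : GridFun}
    (he : IsErrorGrid M₁ M₂ N h₁ h₂ τ κ C F e)
    (hF : ∀ n i j : ℕ, 1 ≤ n → n ≤ N → i ∈ Finset.Ico 1 M₁ → j ∈ Finset.Ico 1 M₂ →
      |F n i j| ≤ Lf * |e (n - 1) i j| + S n + B * τ * C (n - 1)) {m : ℕ} (hm : m ≤ N) :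
    ∑ s ∈ Finset.Ico 1 M₁ ×ˢ Finset.Ico 1 M₂, e m s.1 s.2 ^ 2
      ≤ (Finset.Ico 1 M₁ ×ˢ Finset.Ico 1 M₂).card *
          (2 * T / c * (4 / c * Sb + B ^ 2 * τ ^ 2 * Cs)) * Real.exp (8 * T ^ 2 * Lf ^ 2 / c ^ 2) := by
  set I := Finset.Ico 1 M₁ ×ˢ Finset.Ico 1 M₂ with hI
  set J : ℝ := (I.card : ℝ) with hJ
  have hJ0 : 0 ≤ J := Nat.cast_nonneg _
  have hT0 : 0 ≤ T := le_trans (by positivity) hT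
  have hCpos : ∀ k < N, 0 ≤ C k := fun k hk => hc.le.trans (hCc k hk)
  have hCs0 : 0 ≤ Cs := le_trans (mul_nonneg hτ.le
    (Finset.sum_nonneg fun k hk => hCpos k (Finset.mem_range.1 hk))) hCs
  have hSb0 : 0 ≤ Sb := le_trans (mul_nonneg hτ.le (Finset.sum_nonneg fun k _ => sq_nonneg _)) hSb
  set G : ℕ → ℝ := fun m => ∑ s ∈ I, e m s.1 s.2 ^ 2 with hG
  set Q : ℕ → ℝ := fun k => ∑ s ∈ I, dt τ e k s.1 s.2 ^ 2 with hQ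
  have hQ0 : ∀ k, 0 ≤ Q k := fun k => Finset.sum_nonneg fun _ _ => sq_nonneg _
  set a : ℝ := J * (2 * T / c * (4 / c * Sb + B ^ 2 * τ ^ 2 * Cs)) with ha
  have ha0 : 0 ≤ a := by positivity
  set b : ℝ := 8 * T * Lf ^ 2 / c ^ 2 * τ with hb
  have hb0 : 0 ≤ b := by positivity
  have main : ∀ m ≤ N, G m ≤ a + b * ∑ k ∈ Finset.range m, G k := by
    intro m hm
    have hen := energy_estimate hM₁ hM₂ hτ hκ hC he hm
    rw [← hI] at hen
    have hlow : c * ∑ k ∈ Finset.Ico 1 (m + 1), Q k + ∑ k ∈ Finset.Ico 1 (m + 1), C (k - 1) * Q k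
        ≤ ∑ k ∈ Finset.Ico 1 (m + 1), (C (m - k) + C (k - 1)) * Q k := by
      rw [Finset.mul_sum, ← Finset.sum_add_distrib]
      refine Finset.sum_le_sum fun k hk => ?_
      rw [Finset.mem_Ico] at hk
      rw [add_mul]
      gcongr
      exact hCc _ (by omega)
    have hup : ∀ n ∈ Finset.Ico 1 (m + 1), 2 * ∑ s ∈ I, F n s.1 s.2 * dt τ e n s.1 s.2
        ≤ c / 2 * Q n + 4 / c * (Lf ^ 2 * G (n - 1) + J * S n ^ 2) + C (n - 1) * Q n
          + B ^ 2 * τ ^ 2 * J * C (n - 1) := by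
      intro n hn
      rw [Finset.mem_Ico] at hn
      have hp : ∀ s ∈ I, 2 * (F n s.1 s.2 * dt τ e n s.1 s.2)
          ≤ c / 2 * dt τ e n s.1 s.2 ^ 2 + 4 / c * (Lf ^ 2 * e (n - 1) s.1 s.2 ^ 2 + S n ^ 2)
            + C (n - 1) * dt τ e n s.1 s.2 ^ 2 + (B * τ) ^ 2 * C (n - 1) := by
        intro s hs
        rw [Finset.mem_product] at hs
        exact two_mul_mul_le_young hc (hCpos _ (by omega))
          (hF n s.1 s.2 hn.1 (by omega) hs.1 hs.2)
      rw [Finset.mul_sum]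
      refine (Finset.sum_le_sum hp).trans (le_of_eq ?_)
      simp only [Finset.sum_add_distrib, ← Finset.mul_sum, Finset.sum_const, nsmul_eq_mul, hQ, hG]
      rw [← hJ]
      ring
    have hup' := Finset.sum_le_sum hup
    have e1 : ∑ n ∈ Finset.Ico 1 (m + 1), G (n - 1) = ∑ k ∈ Finset.range m, G k := by
      rw [Finset.sum_Ico_eq_sum_range]; simp
    have e2 : τ * ∑ n ∈ Finset.Ico 1 (m + 1), C (n - 1) ≤ Cs := by
      refine le_trans (mul_le_mul_of_nonneg_left ?_ hτ.le) hCs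
      rw [Finset.sum_Ico_eq_sum_range]
      simp only [Nat.add_sub_cancel, Nat.add_sub_cancel_left]
      exact Finset.sum_le_sum_of_subset_of_nonneg (Finset.range_subset_range.2 hm)
        fun k hk _ => hCpos k (Finset.mem_range.1 hk)
    have e3 : τ * ∑ n ∈ Finset.Ico 1 (m + 1), S n ^ 2 ≤ Sb := by
      refine le_trans (mul_le_mul_of_nonneg_left ?_ hτ.le) hSb
      rw [Finset.sum_Ico_eq_sum_range]
      simp only [Nat.add_sub_cancel, add_comm 1]
      exact Finset.sum_le_sum_of_subset_of_nonneg (Finset.range_subset_range.2 hm)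
        fun k _ _ => sq_nonneg _
    simp only [Finset.sum_add_distrib, ← Finset.mul_sum] at hup'
    rw [e1] at hup'
    have hlow' := hlow.trans hen
    have hQsum : τ * ∑ k ∈ Finset.Ico 1 (m + 1), Q k ≤ 2 / c * (4 / c * (Lf ^ 2 *
        (τ * ∑ k ∈ Finset.range m, G k) + J * Sb) + B ^ 2 * τ ^ 2 * J * Cs) := by
      -- The sums of `C (k - 1) * Q k` cancel between `hlow'` and `hup'`, and half of `c * ∑ Q` is
      -- absorbed on the left.
      have h1 : c / 2 * ∑ k ∈ Finset.Ico 1 (m + 1), Q k ≤ 4 / c * (Lf ^ 2 *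
        (∑ k ∈ Finset.range m, G k) + J * ∑ n ∈ Finset.Ico 1 (m + 1), S n ^ 2)
          + B ^ 2 * τ ^ 2 * J * ∑ n ∈ Finset.Ico 1 (m + 1), C (n - 1) := by
        linarith
      calc τ * ∑ k ∈ Finset.Ico 1 (m + 1), Q k
          = 2 / c * (τ * (c / 2 * ∑ k ∈ Finset.Ico 1 (m + 1), Q k)) := by field_simp
        _ ≤ 2 / c * (τ * (4 / c * (Lf ^ 2 *
            (∑ k ∈ Finset.range m, G k) + J * ∑ n ∈ Finset.Ico 1 (m + 1), S n ^ 2)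
              + B ^ 2 * τ ^ 2 * J * ∑ n ∈ Finset.Ico 1 (m + 1), C (n - 1))) := by gcongr
        _ = 2 / c * (4 / c * (Lf ^ 2 * (τ * ∑ k ∈ Finset.range m, G k)
              + J * (τ * ∑ n ∈ Finset.Ico 1 (m + 1), S n ^ 2))
              + B ^ 2 * τ ^ 2 * J * (τ * ∑ n ∈ Finset.Ico 1 (m + 1), C (n - 1))) := by ring
        _ ≤ _ := by gcongr
    have hGm : G m ≤ T * (τ * ∑ k ∈ Finset.Ico 1 (m + 1), Q k) := by
      have : ∀ s ∈ I, e m s.1 s.2 ^ 2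
          ≤ T * (τ * ∑ k ∈ Finset.Ico 1 (m + 1), dt τ e k s.1 s.2 ^ 2) := by
        intro s hs
        rw [Finset.mem_product, Finset.mem_Ico, Finset.mem_Ico] at hs
        refine sq_le_sum_dt hτ e (le_trans ?_ hT) (he.initial _ _ (by omega) (by omega))
        gcongr
      refine (Finset.sum_le_sum this).trans (le_of_eq ?_)
      simp only [hQ, ← Finset.mul_sum]
      rw [Finset.sum_comm]
    refine hGm.trans ((mul_le_mul_of_nonneg_left hQsum hT0).trans (le_of_eq ?_))
    rw [ha, hb]
    field_simp
    ring
  refine (discrete_gronwall hb0 main m hm).trans ?_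
  refine mul_le_mul_of_nonneg_left ?_ ha0
  calc (1 + b) ^ m ≤ Real.exp b ^ m := by
        gcongr; linarith [Real.add_one_le_exp b]
    _ = Real.exp (m * b) := (Real.exp_nat_mul b m).symm
    _ ≤ _ := by
      refine Real.exp_le_exp.2 ?_
      have : (m : ℝ) * τ ≤ T := le_trans (by gcongr) hT
      calc (m : ℝ) * b = 8 * T * Lf ^ 2 / c ^ 2 * (m * τ) := by rw [hb]; ring
        _ ≤ 8 * T * Lf ^ 2 / c ^ 2 * T := by gcongr
        _ = _ := by ring

/-! ### The memory weights -/

theorem coeff_nonneg {β : ℝ} (hβ : β ≤ 2) (k : ℕ) : 0 ≤ coeff β k := by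
  rw [coeff, sub_nonneg]
  exact Real.rpow_le_rpow (by positivity) (by linarith) (by linarith)

theorem coeff_zero {β : ℝ} (hβ : β < 2) : coeff β 0 = 1 := by
  simp [coeff, Real.zero_rpow (by linarith : 2 - β ≠ 0)]

/-- Concavity of `s ^ (2 - β)` at the midpoint `k + 1` of `k` and `k + 2`. -/
theorem coeff_antitone {β : ℝ} (h1 : 1 ≤ β) (h2 : β ≤ 2) : Antitone (coeff β) := by
  refine antitone_nat_of_succ_le fun k => ?_
  have h := (Real.concaveOn_rpow (p := 2 - β) (by linarith) (by linarith)).2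
    (show (k : ℝ) ∈ Ici (0 : ℝ) by simp) (show (k : ℝ) + 2 ∈ Ici (0 : ℝ) by simp; positivity)
    (show (0 : ℝ) ≤ 1 / 2 by norm_num) (show (0 : ℝ) ≤ 1 / 2 by norm_num) (by norm_num)
  simp only [smul_eq_mul] at h
  rw [show 1 / 2 * (k : ℝ) + 1 / 2 * (k + 2) = k + 1 by ring] at h
  simp only [coeff]
  push_cast
  rw [show (k : ℝ) + 1 + 1 = k + 2 by ring]
  linarith

/-- Bernoulli's inequality for an exponent in `[0, 1]`, applied to `(1 - 1 / (k + 1)) ^ (2 - β)`. -/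
theorem le_coeff {β : ℝ} (h1 : 1 ≤ β) (h2 : β ≤ 2) (k : ℕ) :
    (2 - β) * ((k : ℝ) + 1) ^ (1 - β) ≤ coeff β k := by
  have hk : (0 : ℝ) < k + 1 := by positivity
  have h := rpow_one_add_le_one_add_mul_self (s := -1 / ((k : ℝ) + 1)) (p := 2 - β)
    (by rw [le_div_iff₀ hk]; linarith [(Nat.cast_nonneg k : (0 : ℝ) ≤ k)])
    (by linarith) (by linarith)
  have e : 1 + -1 / ((k : ℝ) + 1) = k / (k + 1) := by field_simp; ring
  rw [e, Real.div_rpow (by positivity) hk.le, div_le_iff₀ (by positivity)] at h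
  rw [coeff, show 1 - β = (2 - β) - 1 by ring, Real.rpow_sub_one hk.ne']
  have e2 : (1 + (2 - β) * (-1 / ((k : ℝ) + 1))) * ((k : ℝ) + 1) ^ (2 - β)
      = ((k : ℝ) + 1) ^ (2 - β) - (2 - β) * (((k : ℝ) + 1) ^ (2 - β) / (k + 1)) := by
    field_simp
    ring
  linarith

theorem sum_coeff {β : ℝ} (hβ : β < 2) (n : ℕ) :
    ∑ k ∈ Finset.range n, coeff β k = (n : ℝ) ^ (2 - β) := by
  have h := Finset.sum_range_sub (fun k : ℕ => (k : ℝ) ^ (2 - β)) n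
  simp only [Nat.cast_zero, Real.zero_rpow (by linarith : 2 - β ≠ 0), sub_zero] at h
  rw [← h]
  simp [coeff]

/-- A crude bound, but uniform in the exponent, so that constants do not depend on the order `β`. -/
theorem rpow_le_one_add {s γ : ℝ} (hs : 0 ≤ s) (h0 : 0 ≤ γ) (h1 : γ ≤ 1) : s ^ γ ≤ 1 + s := by
  rcases le_total s 1 with h | h
  · exact (Real.rpow_le_one hs h h0).trans (by linarith)
  · calc s ^ γ ≤ s ^ (1 : ℝ) := Real.rpow_le_rpow_of_exponent_le h h1
      _ = s := Real.rpow_one s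
      _ ≤ _ := by linarith

namespace Mesh

variable (m : Mesh) (P : Data)

theorem β_mem {l : ℕ} (hl : l ∈ Finset.Icc 1 m.K) : m.β l ∈ Ioo (1 : ℝ) 2 := by
  rw [Finset.mem_Icc] at hl
  have hK : (0 : ℝ) < m.K := by exact_mod_cast m.K_pos
  have h1 : (1 : ℝ) ≤ l := by exact_mod_cast hl.1
  have h2 : (l : ℝ) ≤ m.K := by exact_mod_cast hl.2
  have e : m.β l = 1 + (2 * (l : ℝ) - 1) / (2 * m.K) := by
    rw [β, Δβ]; field_simp
  rw [e]
  constructor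
  · have : 0 < (2 * (l : ℝ) - 1) / (2 * m.K) := div_pos (by linarith) (by linarith)
    linarith
  · have : (2 * (l : ℝ) - 1) / (2 * m.K) < 1 := by rw [div_lt_one (by linarith)]; linarith
    linarith

theorem Δβ_pos : 0 < m.Δβ := one_div_pos.2 (by exact_mod_cast m.K_pos)

theorem Δβ_mul_K : m.Δβ * m.K = 1 := by
  have hK : (m.K : ℝ) ≠ 0 := by exact_mod_cast m.K_pos.ne'
  rw [Δβ, one_div_mul_cancel hK]

/-- The midpoint rule is exact on affine functions. The factor `2 - β` of `le_coeff` degenerates as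
`β → 2`, but its average is independent of `K`; this is the source of the uniform lower bound on the
weights. -/
theorem sum_two_sub_β : m.Δβ * ∑ l ∈ Finset.Icc 1 m.K, (2 - m.β l) = 1 / 2 := by
  have h : ∀ K : ℕ, ∑ l ∈ Finset.Icc 1 K, (2 * (l : ℝ) - 1) = (K : ℝ) ^ 2 := by
    intro K
    induction K with
    | zero => simp
    | succ K ih =>
      rw [Finset.sum_Icc_succ_top (by omega), ih]; push_cast; ring
  have e : ∀ l ∈ Finset.Icc 1 m.K, 2 - m.β l = 1 - (2 * (l : ℝ) - 1) * (m.Δβ / 2) := by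
    intro l _; rw [β]; ring
  rw [Finset.sum_congr rfl e, Finset.sum_sub_distrib, ← Finset.sum_mul, h]
  simp only [Finset.sum_const, Nat.card_Icc, Nat.add_sub_cancel, nsmul_eq_mul, mul_one]
  have := m.Δβ_mul_K
  calc m.Δβ * (m.K - (m.K : ℝ) ^ 2 * (m.Δβ / 2))
      = m.Δβ * m.K - (m.Δβ * m.K) ^ 2 / 2 := by ring
    _ = _ := by rw [this]; norm_num

/-- The memory weights of the scheme. -/
def weight (k : ℕ) : ℝ :=
  m.Δβ * ∑ l ∈ Finset.Icc 1 m.K,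
    P.p (m.β l) * (m.τ P ^ (1 - m.β l) / Real.Gamma (3 - m.β l)) * coeff (m.β l) k

end Mesh

variable {P : Data}

theorem Data.Admissible.τ_pos (hP : P.Admissible) (m : Mesh) : 0 < m.τ P :=
  div_pos hP.T_pos (by exact_mod_cast m.N_pos)

theorem Data.Admissible.h₁_pos (hP : P.Admissible) (m : Mesh) : 0 < m.h₁ P :=
  div_pos hP.L₁_pos (by exact_mod_cast m.M₁_pos)

theorem Data.Admissible.h₂_pos (hP : P.Admissible) (m : Mesh) : 0 < m.h₂ P :=
  div_pos hP.L₂_pos (by exact_mod_cast m.M₂_pos)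

theorem Mesh.N_mul_τ (m : Mesh) : m.N * m.τ P = P.T := by
  have : (m.N : ℝ) ≠ 0 := by exact_mod_cast m.N_pos.ne'
  rw [Mesh.τ]; field_simp

theorem Mesh.M₁_mul_h₁ (m : Mesh) : m.M₁ * m.h₁ P = P.L₁ := by
  have : (m.M₁ : ℝ) ≠ 0 := by exact_mod_cast m.M₁_pos.ne'
  rw [Mesh.h₁]; field_simp

theorem Mesh.M₂_mul_h₂ (m : Mesh) : m.M₂ * m.h₂ P = P.L₂ := by
  have : (m.M₂ : ℝ) ≠ 0 := by exact_mod_cast m.M₂_pos.ne'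
  rw [Mesh.h₂]; field_simp

theorem Mesh.Δβ_mul_sum_le (m : Mesh) {g : ℝ → ℝ} {A : ℝ} (hg : ∀ β ∈ Ioo (1 : ℝ) 2, g β ≤ A) :
    m.Δβ * ∑ l ∈ Finset.Icc 1 m.K, g (m.β l) ≤ A := by
  have h : ∑ l ∈ Finset.Icc 1 m.K, g (m.β l) ≤ ∑ l ∈ Finset.Icc 1 m.K, A :=
    Finset.sum_le_sum fun l hl => hg _ (m.β_mem hl)
  simp only [Finset.sum_const, Nat.card_Icc, Nat.add_sub_cancel, nsmul_eq_mul] at h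
  calc _ ≤ m.Δβ * (m.K * A) := mul_le_mul_of_nonneg_left h m.Δβ_pos.le
    _ = (m.Δβ * m.K) * A := by ring
    _ = A := by rw [m.Δβ_mul_K, one_mul]

/-- The weight `p(β) / Γ(3 - β)`. -/
def Data.q (P : Data) (β : ℝ) : ℝ := P.p β * (Real.Gamma (3 - β))⁻¹

/-- The reciprocal Gamma function is entire, hence smooth on the real line. -/
theorem contDiff_inv_Gamma : ContDiff ℝ 2 (fun s : ℝ => (Real.Gamma s)⁻¹) := by
  have h1 : ContDiff ℂ 2 (fun s : ℂ => (Complex.Gamma s)⁻¹) :=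
    Complex.differentiable_one_div_Gamma.contDiff
  have h2 : ContDiff ℝ 2 (fun s : ℝ => ((Complex.Gamma (s : ℂ))⁻¹).re) := by
    have := (h1.restrict_scalars ℝ)
    exact Complex.reCLM.contDiff.comp (this.comp Complex.ofRealCLM.contDiff)
  convert h2 using 2 with s
  rw [Complex.Gamma_ofReal, ← Complex.ofReal_inv, Complex.ofReal_re]

theorem Data.Admissible.q_contDiffOn (hP : P.Admissible) : ContDiffOn ℝ 2 P.q (Icc 1 2) :=
  hP.p_contDiff.mul (contDiff_inv_Gamma.comp (contDiff_const.sub contDiff_id)).contDiffOn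

theorem Data.Admissible.q_pos (hP : P.Admissible) {β : ℝ} (hβ : β ∈ Icc (1 : ℝ) 2) : 0 < P.q β :=
  mul_pos (hP.p_pos β hβ) (inv_pos.2 (Real.Gamma_pos_of_pos (by linarith [hβ.2])))

theorem Data.Admissible.exists_q_bounds (hP : P.Admissible) :
    ∃ q₀ q₁ : ℝ, 0 < q₀ ∧ 0 < q₁ ∧ ∀ β ∈ Icc (1 : ℝ) 2, q₀ ≤ P.q β ∧ P.q β ≤ q₁ := by
  have hc := hP.q_contDiffOn.continuousOn
  have hne : (Icc (1 : ℝ) 2).Nonempty := ⟨1, by norm_num⟩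
  obtain ⟨a, ha, hA⟩ := isCompact_Icc.exists_isMinOn hne hc
  obtain ⟨b, hb, hB⟩ := isCompact_Icc.exists_isMaxOn hne hc
  exact ⟨P.q a, P.q b, hP.q_pos ha, hP.q_pos hb, fun β hβ => ⟨hA hβ, hB hβ⟩⟩

theorem Mesh.weight_eq (m : Mesh) (k : ℕ) : m.weight P k = m.Δβ * ∑ l ∈ Finset.Icc 1 m.K,
    P.q (m.β l) * (m.τ P ^ (1 - m.β l) * coeff (m.β l) k) := by
  rw [Mesh.weight]
  congr 1
  refine Finset.sum_congr rfl fun l _ => ?_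
  rw [Data.q]; ring

theorem Data.Admissible.weight_antitone (hP : P.Admissible) (m : Mesh) :
    Antitone (m.weight P) := by
  intro a b hab
  rw [m.weight_eq, m.weight_eq]
  refine mul_le_mul_of_nonneg_left (Finset.sum_le_sum fun l hl => ?_) m.Δβ_pos.le
  have hβ := m.β_mem hl
  have := coeff_antitone hβ.1.le hβ.2.le hab
  have := (hP.q_pos ⟨hβ.1.le, hβ.2.le⟩).le
  have := Real.rpow_nonneg (hP.τ_pos m).le (1 - m.β l)
  gcongr

/-- By `le_coeff`, each order contributes at least `2 - β` times the power `1 - β` of `(k + 1) τ ≤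
T`, which is at least `1 / (1 + T)`; then the factor `2 - β` is averaged. -/
theorem Data.Admissible.exists_le_weight (hP : P.Admissible) :
    ∃ c : ℝ, 0 < c ∧ ∀ (m : Mesh) (k : ℕ), k < m.N → c ≤ m.weight P k := by
  obtain ⟨q₀, q₁, hq₀, -, hq⟩ := hP.exists_q_bounds
  have hT := hP.T_pos
  refine ⟨q₀ * (1 + P.T)⁻¹ * (1 / 2), by positivity, fun m k hk => ?_⟩
  have hτ := hP.τ_pos m
  rw [m.weight_eq, ← m.sum_two_sub_β, mul_left_comm, Finset.mul_sum]
  refine mul_le_mul_of_nonneg_left (Finset.sum_le_sum fun l hl => ?_) m.Δβ_pos.le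
  obtain ⟨hβ₁, hβ₂⟩ := m.β_mem hl
  set β := m.β l
  rw [mul_assoc]
  refine mul_le_mul (hq β ⟨hβ₁.le, hβ₂.le⟩).1 ?_ (by
    have : 0 ≤ 2 - β := by linarith
    positivity) (hP.q_pos ⟨hβ₁.le, hβ₂.le⟩).le
  have h1 : ((k : ℝ) + 1) * m.τ P ≤ P.T := by
    rw [← m.N_mul_τ]
    have : (k : ℝ) + 1 ≤ m.N := by exact_mod_cast hk
    gcongr
  have h2 : (1 + P.T)⁻¹ ≤ m.τ P ^ (1 - β) * ((k : ℝ) + 1) ^ (1 - β) := by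
    rw [← Real.mul_rpow hτ.le (by positivity), mul_comm (m.τ P),
      show 1 - β = -(β - 1) by ring, Real.rpow_neg (by positivity)]
    refine inv_anti₀ (by positivity) ?_
    exact (rpow_le_one_add (by positivity) (by linarith) (by linarith)).trans (by linarith)
  calc (1 + P.T)⁻¹ * (2 - β)
      ≤ m.τ P ^ (1 - β) * ((k : ℝ) + 1) ^ (1 - β) * (2 - β) :=
        mul_le_mul_of_nonneg_right h2 (by linarith)
    _ = m.τ P ^ (1 - β) * ((2 - β) * ((k : ℝ) + 1) ^ (1 - β)) := by ring
    _ ≤ _ := mul_le_mul_of_nonneg_left (le_coeff hβ₁.le hβ₂.le k) (by positivity)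

/-- The coefficients telescope, and `τ * τ ^ (1 - β) * N ^ (2 - β) = T ^ (2 - β)`. Single weights
may be large for small `τ`, but their time integral is not. -/
theorem Data.Admissible.exists_sum_weight_le (hP : P.Admissible) :
    ∃ A : ℝ, 0 < A ∧ ∀ m : Mesh, m.τ P * ∑ k ∈ Finset.range m.N, m.weight P k ≤ A := by
  obtain ⟨q₀, q₁, -, hq₁, hq⟩ := hP.exists_q_bounds
  have hT := hP.T_pos
  refine ⟨q₁ * (1 + P.T), by positivity, fun m => ?_⟩
  have hτ := hP.τ_pos m
  simp only [m.weight_eq]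
  rw [← Finset.mul_sum, Finset.sum_comm, mul_left_comm, Finset.mul_sum]
  have e : ∀ l ∈ Finset.Icc 1 m.K, m.τ P * ∑ k ∈ Finset.range m.N,
      P.q (m.β l) * (m.τ P ^ (1 - m.β l) * coeff (m.β l) k)
      = (fun β => P.q β * P.T ^ (2 - β)) (m.β l) := by
    intro l hl
    obtain ⟨hβ₁, hβ₂⟩ := m.β_mem hl
    simp only [← Finset.mul_sum]
    rw [sum_coeff hβ₂, ← m.N_mul_τ, Real.mul_rpow (by positivity) hτ.le,
      show 2 - m.β l = 1 + (1 - m.β l) by ring, Real.rpow_add hτ, Real.rpow_one]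
    ring
  rw [Finset.sum_congr rfl e]
  refine m.Δβ_mul_sum_le (g := fun β => P.q β * P.T ^ (2 - β)) fun β hβ => ?_
  have hβ' : β ∈ Icc (1 : ℝ) 2 := ⟨hβ.1.le, hβ.2.le⟩
  exact mul_le_mul (hq β hβ').2 (rpow_le_one_add hT.le (by linarith [hβ.2]) (by linarith [hβ.1]))
    (by positivity) hq₁.le

/-- Since `a_0 = 1`, a lower bound on the weights gives `μ ≥ c / τ`, which makes the ADI
perturbation small. -/
theorem Data.Admissible.τ_mul_μ (hP : P.Admissible) (m : Mesh) :
    m.τ P * m.μ P = m.weight P 0 := by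
  have hτ := hP.τ_pos m
  rw [Mesh.μ, Mesh.weight, mul_left_comm, Finset.mul_sum]
  congr 1
  refine Finset.sum_congr rfl fun l hl => ?_
  rw [coeff_zero (m.β_mem hl).2, Real.rpow_sub hτ, Real.rpow_one]
  ring

theorem Data.Admissible.μ_pos (hP : P.Admissible) (m : Mesh) : 0 < m.μ P := by
  obtain ⟨c, hc, h⟩ := hP.exists_le_weight
  have h1 := h m 0 m.N_pos
  rw [← hP.τ_mul_μ] at h1
  exact pos_of_mul_pos_right (hc.trans_le h1) (hP.τ_pos m).le

/-! ### The fractional integral of the second derivative -/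

/-- The fractional integral of order `2 - β`. -/
def frac (g : ℝ → ℝ) (β t : ℝ) : ℝ :=
  (Real.Gamma (2 - β))⁻¹ * ∫ ξ in (0 : ℝ)..t, (t - ξ) ^ (1 - β) * g ξ

/-- The factor `2 - β` from integrating the kernel turns `Γ(2 - β)` into `Γ(3 - β)`, so nothing
blows up or degenerates at `β = 2`. -/
theorem inv_Gamma_div {β : ℝ} (hβ : β < 2) :
    (Real.Gamma (2 - β))⁻¹ / (2 - β) = (Real.Gamma (3 - β))⁻¹ := by
  rw [show 3 - β = (2 - β) + 1 by ring, Real.Gamma_add_one (by linarith), mul_inv, div_eq_inv_mul]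

theorem inv_Gamma_pos {s : ℝ} (hs : 0 < s) : 0 < (Real.Gamma s)⁻¹ :=
  inv_pos.2 (Real.Gamma_pos_of_pos hs)

theorem intervalIntegrable_kernel {β : ℝ} (hβ : β < 2) (t a b : ℝ) :
    IntervalIntegrable (fun ξ => (t - ξ) ^ (1 - β)) MeasureTheory.volume a b := by
  have h : IntervalIntegrable (fun x : ℝ => x ^ (1 - β)) MeasureTheory.volume (t - a) (t - b) :=
    intervalIntegral.intervalIntegrable_rpow' (by linarith)
  simpa using h.comp_sub_left t

theorem integral_kernel {β : ℝ} (hβ : β < 2) (t a b : ℝ) :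
    ∫ ξ in a..b, (t - ξ) ^ (1 - β) = ((t - a) ^ (2 - β) - (t - b) ^ (2 - β)) / (2 - β) := by
  rw [intervalIntegral.integral_comp_sub_left (fun x => x ^ (1 - β)) t,
    integral_rpow (Or.inl (by linarith)), show 1 - β + 1 = 2 - β by ring]

theorem intervalIntegrable_kernel_mul {β T : ℝ} (hβ : β < 2) {g : ℝ → ℝ}
    (hg : ContinuousOn g (Icc 0 T)) (t : ℝ) {a b : ℝ} (ha : 0 ≤ a) (hab : a ≤ b) (hb : b ≤ T) :
    IntervalIntegrable (fun ξ => (t - ξ) ^ (1 - β) * g ξ) MeasureTheory.volume a b := by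
  refine (intervalIntegrable_kernel hβ t a b).mul_continuousOn (hg.mono ?_)
  rw [uIcc_of_le hab]
  exact Icc_subset_Icc ha hb

/-- The kernel is nonnegative and is integrated exactly; only `g` is frozen. -/
theorem abs_integral_kernel_mul_sub_le {β T : ℝ} (hβ : β < 2) {g : ℝ → ℝ}
    (hg : ContinuousOn g (Icc 0 T)) {t a b G ε : ℝ} (ha : 0 ≤ a) (hab : a ≤ b) (hbt : b ≤ t)
    (hb : b ≤ T) (hG : ∀ ξ ∈ Icc a b, |g ξ - G| ≤ ε) :
    |(∫ ξ in a..b, (t - ξ) ^ (1 - β) * g ξ)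
        - ((t - a) ^ (2 - β) - (t - b) ^ (2 - β)) / (2 - β) * G|
      ≤ ((t - a) ^ (2 - β) - (t - b) ^ (2 - β)) / (2 - β) * ε := by
  have hk := intervalIntegrable_kernel hβ t a b
  have e : (∫ ξ in a..b, (t - ξ) ^ (1 - β) * g ξ)
        - ((t - a) ^ (2 - β) - (t - b) ^ (2 - β)) / (2 - β) * G
      = ∫ ξ in a..b, (t - ξ) ^ (1 - β) * (g ξ - G) := by
    rw [← integral_kernel hβ, ← intervalIntegral.integral_mul_const,
      ← intervalIntegral.integral_sub (intervalIntegrable_kernel_mul hβ hg t ha hab hb)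
        (hk.mul_const G)]
    simp only [mul_sub]
  rw [e, ← integral_kernel hβ, ← intervalIntegral.integral_mul_const, ← Real.norm_eq_abs]
  refine intervalIntegral.norm_integral_le_of_norm_le hab ?_ (hk.mul_const ε)
  refine Filter.Eventually.of_forall fun ξ hξ => ?_
  have h0 : 0 ≤ (t - ξ) ^ (1 - β) := Real.rpow_nonneg (by linarith [hξ.2]) _
  rw [norm_mul, Real.norm_eq_abs, Real.norm_eq_abs, abs_of_nonneg h0]
  exact mul_le_mul_of_nonneg_left (hG ξ ⟨hξ.1.le, hξ.2⟩) h0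

theorem abs_frac_le {β T M : ℝ} (hβ : β < 2) {g : ℝ → ℝ} (hg : ContinuousOn g (Icc 0 T))
    (hM : ∀ t ∈ Icc 0 T, |g t| ≤ M) {t : ℝ} (ht : t ∈ Icc 0 T) :
    |frac g β t| ≤ (Real.Gamma (3 - β))⁻¹ * t ^ (2 - β) * M := by
  have h := abs_integral_kernel_mul_sub_le (t := t) (G := 0) hβ hg le_rfl ht.1 le_rfl ht.2
    (fun ξ hξ => by simpa using hM ξ ⟨hξ.1, hξ.2.trans ht.2⟩)
  rw [mul_zero, sub_zero, sub_zero, sub_self, Real.zero_rpow (by linarith), sub_zero] at h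
  have hΓ := (inv_Gamma_pos (show 0 < 2 - β by linarith)).le
  rw [frac, abs_mul, abs_of_nonneg hΓ, ← inv_Gamma_div hβ]
  calc _ ≤ _ := mul_le_mul_of_nonneg_left h hΓ
    _ = _ := by ring

/-- The coefficients `τ^(2 - β) a_k^(β) / Γ(3 - β)`. -/
def fracCoeff (β τ : ℝ) (k : ℕ) : ℝ :=
  τ ^ (2 - β) * coeff β k * (Real.Gamma (3 - β))⁻¹

theorem fracCoeff_nonneg {β τ : ℝ} (hβ : β < 2) (hτ : 0 < τ) (k : ℕ) : 0 ≤ fracCoeff β τ k :=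
  mul_nonneg (mul_nonneg (Real.rpow_nonneg hτ.le _) (coeff_nonneg hβ.le k))
    (inv_Gamma_pos (by linarith)).le

theorem sum_fracCoeff {β τ : ℝ} (hβ : β < 2) (hτ : 0 < τ) (n : ℕ) :
    ∑ k ∈ Finset.range n, fracCoeff β τ k = (n * τ) ^ (2 - β) * (Real.Gamma (3 - β))⁻¹ := by
  simp only [fracCoeff, ← Finset.sum_mul, ← Finset.mul_sum]
  rw [sum_coeff hβ, Real.mul_rpow (by positivity) hτ.le]
  ring

/-- The rectangle rule for the fractional integral. -/
theorem abs_frac_sub_sum_le {β T τ M : ℝ} (hβ : β < 2) (hτ : 0 < τ) {g g' : ℝ → ℝ}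
    (hg : ∀ t ∈ Icc 0 T, HasDerivWithinAt g (g' t) (Icc 0 T) t)
    (hM : ∀ t ∈ Icc 0 T, |g' t| ≤ M) {m : ℕ} (hm : m * τ ≤ T) :
    |frac g β (m * τ) - ∑ k ∈ Finset.range m, fracCoeff β τ (m - 1 - k) * g ((k + 1 : ℕ) * τ)|
      ≤ ∑ k ∈ Finset.range m, fracCoeff β τ (m - 1 - k) * (M * τ) := by
  have hgc : ContinuousOn g (Icc 0 T) := fun t ht => (hg t ht).continuousWithinAt
  have hmem : ∀ k : ℕ, k ≤ m → (k : ℝ) * τ ≤ T := fun k hk =>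
    le_trans (mul_le_mul_of_nonneg_right (by exact_mod_cast hk) hτ.le) hm
  have hsum : ∫ ξ in (0 : ℝ)..(m * τ), ((m : ℝ) * τ - ξ) ^ (1 - β) * g ξ
      = ∑ k ∈ Finset.range m, ∫ ξ in ((k : ℕ) * τ)..((k + 1 : ℕ) * τ),
          ((m : ℝ) * τ - ξ) ^ (1 - β) * g ξ := by
    rw [intervalIntegral.sum_integral_adjacent_intervals (a := fun k : ℕ => (k : ℝ) * τ)]
    · simp
    · intro k hk
      exact intervalIntegrable_kernel_mul hβ hgc _ (by positivity)
        (mul_le_mul_of_nonneg_right (by push_cast; linarith) hτ.le) (hmem _ hk)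
  rw [frac, hsum, Finset.mul_sum, ← Finset.sum_sub_distrib]
  refine (Finset.abs_sum_le_sum_abs _ _).trans (Finset.sum_le_sum fun k hk => ?_)
  rw [Finset.mem_range] at hk
  have hk' : ((m - 1 - k : ℕ) : ℝ) = m - 1 - k := by
    rw [Nat.cast_sub (by omega), Nat.cast_sub (by omega)]; simp
  have hkT := hmem (k + 1) hk
  have hle : (k : ℝ) * τ ≤ (k + 1 : ℕ) * τ :=
    mul_le_mul_of_nonneg_right (by push_cast; linarith) hτ.le
  have hk0 : 0 ≤ (k : ℝ) * τ := by positivity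
  -- On each cell `g` is frozen at the right end `(k + 1) τ`, the node at which the scheme's second
  -- difference is centred.
  have h := abs_integral_kernel_mul_sub_le (t := m * τ) (G := g ((k + 1 : ℕ) * τ)) (ε := M * τ)
    hβ hgc hk0 hle
    (mul_le_mul_of_nonneg_right (by exact_mod_cast hk) hτ.le) hkT (fun ξ hξ => by
      have hM0 : 0 ≤ M := (abs_nonneg _).trans (hM _ ⟨hk0, hle.trans hkT⟩)
      refine (abs_sub_le_of_deriv hg hM ⟨hk0.trans hle, hkT⟩
        ⟨hk0.trans hξ.1, hξ.2.trans hkT⟩).trans (mul_le_mul_of_nonneg_left ?_ hM0)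
      have := hξ.1
      have := hξ.2
      push_cast at *
      rw [abs_le]; constructor <;> linarith)
  have hco : ((m * τ - (k : ℝ) * τ) ^ (2 - β) - (m * τ - (k + 1 : ℕ) * τ) ^ (2 - β)) / (2 - β)
      = τ ^ (2 - β) * coeff β (m - 1 - k) / (2 - β) := by
    have hm' : (0 : ℝ) ≤ m - 1 - k := hk' ▸ Nat.cast_nonneg _
    rw [coeff, hk', show (m : ℝ) * τ - k * τ = τ * ((m - 1 - k) + 1) by ring,
      show (m : ℝ) * τ - (k + 1 : ℕ) * τ = τ * (m - 1 - k) by push_cast; ring,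
      Real.mul_rpow hτ.le (by linarith), Real.mul_rpow hτ.le hm']
    ring
  rw [hco] at h
  have hΓ := (inv_Gamma_pos (show 0 < 2 - β by linarith)).le
  have hfc : fracCoeff β τ (m - 1 - k) = (Real.Gamma (2 - β))⁻¹ *
      (τ ^ (2 - β) * coeff β (m - 1 - k) / (2 - β)) := by
    rw [fracCoeff, ← inv_Gamma_div hβ]; ring
  rw [hfc, mul_assoc, mul_assoc, ← mul_sub, abs_mul, abs_of_nonneg hΓ]
  exact mul_le_mul_of_nonneg_left h hΓ

/-- Abel summation moves the differences from the coefficients onto `w`. The memory term becomes a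
quadrature of second time differences plus a defect `w 1 - ψ` of the initial velocity. -/
theorem memory_sum_by_parts (a w : ℕ → ℝ) (ψ : ℝ) (m : ℕ) :
    a 0 * w (m + 1) - ∑ k ∈ Finset.Ico 1 (m + 1), (a (m + 1 - k - 1) - a (m + 1 - k)) * w k - a m * ψ
      = a m * (w 1 - ψ) + ∑ k ∈ Finset.range m, a (m - 1 - k) * (w (k + 2) - w (k + 1)) := by
  have h := Finset.sum_range_sub (fun k => a (m - k) * w (k + 1)) m
  rw [Finset.sum_Ico_eq_sum_range]
  have e : ∀ k ∈ Finset.range m, a (m - 1 - k) * (w (k + 2) - w (k + 1))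
      = (a (m - (k + 1)) * w (k + 1 + 1) - a (m - k) * w (k + 1))
        - (a (m + 1 - (1 + k) - 1) - a (m + 1 - (1 + k))) * w (1 + k) := by
    intro k _
    rw [show m - 1 - k = m - (k + 1) by omega, show m + 1 - (1 + k) - 1 = m - (k + 1) by omega,
      show m + 1 - (1 + k) = m - k by omega, add_comm 1 k]
    ring
  rw [Finset.sum_congr rfl e, Finset.sum_sub_distrib, h]
  simp only [Nat.sub_self, Nat.sub_zero, Nat.add_sub_cancel, zero_add]
  ring

/-- Consistency of the discrete memory term. -/
theorem abs_memory_sub_frac_le {β T τ M : ℝ} (hβ : β < 2) (hτ : 0 < τ) {v v' g g' : ℝ → ℝ}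
    (hv : ∀ t ∈ Icc 0 T, HasDerivWithinAt v (v' t) (Icc 0 T) t)
    (hv' : ∀ t ∈ Icc 0 T, HasDerivWithinAt v' (g t) (Icc 0 T) t)
    (hg : ∀ t ∈ Icc 0 T, HasDerivWithinAt g (g' t) (Icc 0 T) t)
    (hM : ∀ t ∈ Icc 0 T, |g t| ≤ M)
    (hM' : ∀ t ∈ Icc 0 T, |g' t| ≤ M) {m : ℕ} (hm : (m + 1 : ℕ) * τ ≤ T) {w : ℕ → ℝ}
    (hw : ∀ k : ℕ, w (k + 1) = (v ((k + 1 : ℕ) * τ) - v (k * τ)) / τ) :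
    |τ ^ (1 - β) / Real.Gamma (3 - β) * (coeff β 0 * w (m + 1)
        - ∑ k ∈ Finset.Ico 1 (m + 1), (coeff β (m + 1 - k - 1) - coeff β (m + 1 - k)) * w k
        - coeff β m * v' 0) - frac g β (m * τ)|
      ≤ M * fracCoeff β τ m
        + 3 * M * τ * ((m * τ) ^ (2 - β) * (Real.Gamma (3 - β))⁻¹) := by
  have hmem : ∀ k : ℕ, k ≤ m + 1 → (k : ℝ) * τ ≤ T := fun k hk =>
    le_trans (mul_le_mul_of_nonneg_right (by exact_mod_cast hk) hτ.le) hm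
  have hT : 0 ≤ T := le_trans (by positivity) hm
  have hmT : (m : ℝ) * τ ≤ T := hmem m (by omega)
  rw [memory_sum_by_parts]
  have hpow : τ ^ (2 - β) = τ * τ ^ (1 - β) := by
    rw [show 2 - β = 1 + (1 - β) by ring, Real.rpow_add hτ, Real.rpow_one]
  have hsplit : τ ^ (1 - β) / Real.Gamma (3 - β) * (coeff β m * (w 1 - v' 0)
        + ∑ k ∈ Finset.range m, coeff β (m - 1 - k) * (w (k + 2) - w (k + 1)))
      = fracCoeff β τ m * ((w 1 - v' 0) / τ)
        + ∑ k ∈ Finset.range m, fracCoeff β τ (m - 1 - k) * ((w (k + 2) - w (k + 1)) / τ) := by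
    rw [mul_add, Finset.mul_sum]
    have : ∀ (j : ℕ) (z : ℝ), τ ^ (1 - β) / Real.Gamma (3 - β) * (coeff β j * z)
        = fracCoeff β τ j * (z / τ) := by
      intro j z
      rw [fracCoeff, hpow]; field_simp
    simp only [this]
  rw [hsplit]
  -- The first quotient approximates the initial velocity only to `O(τ)`, so this term is merely
  -- bounded. It produces the summand `M * fracCoeff β τ m`.
  have h1 : |(w 1 - v' 0) / τ| ≤ M := by
    have h := abs_taylor_one_le hv hv' hM (x := 0) (z := τ) ⟨le_rfl, hT⟩
      ⟨hτ.le, by simpa using hmem 1 (by omega)⟩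
    have e : (w 1 - v' 0) / τ = (v τ - v 0 - v' 0 * (τ - 0)) / τ ^ 2 := by
      rw [hw 0]; simp; field_simp
    rw [e, abs_div, abs_of_pos (pow_pos hτ 2), div_le_iff₀ (by positivity)]
    rw [sub_zero]
    rwa [sub_zero, abs_of_pos hτ] at h
  have h2 : ∀ k < m, |(w (k + 2) - w (k + 1)) / τ - g ((k + 1 : ℕ) * τ)| ≤ 2 * M * τ := by
    intro k hk
    have hx : (0 : ℝ) ≤ (k + 1 : ℕ) * τ - τ := by
      push_cast; have : 0 ≤ (k : ℝ) * τ := by positivity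
      linarith
    have hx' : ((k + 1 : ℕ) : ℝ) * τ + τ ≤ T := by
      have := hmem (k + 2) (by omega)
      push_cast at *; linarith
    have h := abs_second_diff_sub_le_cube hτ.le hv hv' hg hM' hx hx'
    have e : (w (k + 2) - w (k + 1)) / τ - g ((k + 1 : ℕ) * τ)
        = (v ((k + 1 : ℕ) * τ + τ) - 2 * v ((k + 1 : ℕ) * τ) + v ((k + 1 : ℕ) * τ - τ)
            - τ ^ 2 * g ((k + 1 : ℕ) * τ)) / τ ^ 2 := by
      rw [hw (k + 1), hw k, show ((k + 1 : ℕ) : ℝ) * τ + τ = (k + 1 + 1 : ℕ) * τ by push_cast; ring,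
        show ((k + 1 : ℕ) : ℝ) * τ - τ = k * τ by push_cast; ring]
      field_simp
      ring
    rw [e, abs_div, abs_of_pos (pow_pos hτ 2), div_le_iff₀ (by positivity)]
    exact h.trans (le_of_eq (by ring))
  have h3 := abs_frac_sub_sum_le hβ hτ hg hM' hmT
  have h4 : |∑ k ∈ Finset.range m, fracCoeff β τ (m - 1 - k) * ((w (k + 2) - w (k + 1)) / τ)
      - ∑ k ∈ Finset.range m, fracCoeff β τ (m - 1 - k) * g ((k + 1 : ℕ) * τ)|
      ≤ ∑ k ∈ Finset.range m, fracCoeff β τ (m - 1 - k) * (2 * M * τ) := by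
    rw [← Finset.sum_sub_distrib]
    refine (Finset.abs_sum_le_sum_abs _ _).trans (Finset.sum_le_sum fun k hk => ?_)
    rw [← mul_sub, abs_mul, abs_of_nonneg (fracCoeff_nonneg hβ hτ _)]
    exact mul_le_mul_of_nonneg_left (h2 k (Finset.mem_range.1 hk)) (fracCoeff_nonneg hβ hτ _)
  have h5 : |fracCoeff β τ m * ((w 1 - v' 0) / τ)| ≤ M * fracCoeff β τ m := by
    rw [abs_mul, abs_of_nonneg (fracCoeff_nonneg hβ hτ _), mul_comm]
    exact mul_le_mul_of_nonneg_right h1 (fracCoeff_nonneg hβ hτ _)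
  -- The constant `3 * M` is `2 * M` from the second differences plus `M` from the rectangle rule.
  rw [← Finset.sum_mul, Finset.sum_range_reflect (fun j => fracCoeff β τ j), sum_fracCoeff hβ hτ]
    at h3 h4
  rw [abs_le] at *
  constructor <;> linarith [h3.1, h3.2, h4.1, h4.2, h5.1, h5.2]

/-- Integration by parts in the fractional integral. -/
theorem frac_eq {β T : ℝ} (hβ : β < 2) {g g' : ℝ → ℝ}
    (hg : ∀ t ∈ Icc 0 T, HasDerivWithinAt g (g' t) (Icc 0 T) t)
    (hg' : ContinuousOn g' (Icc 0 T)) {t : ℝ} (ht : t ∈ Icc 0 T) :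
    frac g β t = (Real.Gamma (3 - β))⁻¹ *
      (t ^ (2 - β) * g 0 + ∫ ξ in (0 : ℝ)..t, (t - ξ) ^ (2 - β) * g' ξ) := by
  have hγ : 0 < 2 - β := by linarith
  have hgc : ContinuousOn g (Icc 0 T) := fun t ht => (hg t ht).continuousWithinAt
  have hsub : uIcc 0 t ⊆ Icc 0 T := by
    rw [uIcc_of_le ht.1]; exact Icc_subset_Icc_right ht.2
  have hrc : Continuous fun ξ : ℝ => (t - ξ) ^ (2 - β) :=
    (continuous_const.sub continuous_id).rpow_const fun _ => Or.inr hγ.le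
  -- The primitive of the kernel is continuous up to `ξ = t` although the kernel may be singular
  -- there, so derivatives are used only in the open interval.
  have h := intervalIntegral.integral_mul_deriv_eq_deriv_mul_of_hasDerivAt (a := 0) (b := t)
    (u := g) (u' := g') (v := fun ξ => -((t - ξ) ^ (2 - β) / (2 - β)))
    (v' := fun ξ => (t - ξ) ^ (1 - β)) (hgc.mono hsub) (hrc.div_const _).neg.continuousOn
    (fun x hx => by
      rw [min_eq_left ht.1, max_eq_right ht.1] at hx
      exact (hg x ⟨hx.1.le, hx.2.le.trans ht.2⟩).hasDerivAt
        (Icc_mem_nhds hx.1 (hx.2.trans_le ht.2)))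
    (fun x hx => by
      rw [min_eq_left ht.1, max_eq_right ht.1] at hx
      have h1 : HasDerivAt (fun ξ : ℝ => t - ξ) (-1) x := (hasDerivAt_id x).const_sub t
      have h2 := (h1.rpow_const (p := 2 - β) (Or.inl (by linarith [hx.2]))).div_const (2 - β)
      refine h2.neg.congr_deriv ?_
      rw [show 2 - β - 1 = 1 - β by ring]
      field_simp)
    (hg'.mono hsub).intervalIntegrable (intervalIntegrable_kernel hβ t 0 t)
  have e1 : ∫ ξ in (0 : ℝ)..t, (t - ξ) ^ (1 - β) * g ξ
      = ∫ ξ in (0 : ℝ)..t, g ξ * (t - ξ) ^ (1 - β) := by simp only [mul_comm]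
  have e2 : ∫ ξ in (0 : ℝ)..t, g' ξ * -((t - ξ) ^ (2 - β) / (2 - β))
      = -((∫ ξ in (0 : ℝ)..t, (t - ξ) ^ (2 - β) * g' ξ) / (2 - β)) := by
    rw [← intervalIntegral.integral_div, ← intervalIntegral.integral_neg]
    congr 1; ext ξ; ring
  rw [frac, e1, h, e2, ← inv_Gamma_div hβ, sub_self, Real.zero_rpow hγ.ne', sub_zero]
  ring

/-! ### The midpoint rule in the order of differentiation -/

theorem Mesh.abs_midpoint_sub_integral_le (m : Mesh) {g g₁ g₂ : ℝ → ℝ} {M : ℝ}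
    (hg : ∀ β ∈ Icc (1 : ℝ) 2, HasDerivWithinAt g (g₁ β) (Icc 1 2) β)
    (hg₁ : ∀ β ∈ Icc (1 : ℝ) 2, HasDerivWithinAt g₁ (g₂ β) (Icc 1 2) β)
    (hM : ∀ β ∈ Icc (1 : ℝ) 2, |g₂ β| ≤ M) :
    |m.Δβ * ∑ l ∈ Finset.Icc 1 m.K, g (m.β l) - ∫ β in (1 : ℝ)..2, g β| ≤ M * m.Δβ ^ 2 := by
  set d := m.Δβ with hd
  have hd0 : 0 < d := m.Δβ_pos
  have hdK : d * m.K = 1 := m.Δβ_mul_K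
  have hM0 : 0 ≤ M := (abs_nonneg _).trans (hM 1 (by norm_num))
  have hgc : ContinuousOn g (Icc 1 2) := fun t ht => (hg t ht).continuousWithinAt
  have hmem : ∀ k : ℕ, k ≤ m.K → 1 + (k : ℝ) * d ≤ 2 := by
    intro k hk
    have : (k : ℝ) * d ≤ m.K * d := mul_le_mul_of_nonneg_right (by exact_mod_cast hk) hd0.le
    linarith
  have hint : ∀ k < m.K, IntervalIntegrable g MeasureTheory.volume
      ((fun k : ℕ => 1 + (k : ℝ) * d) k) ((fun k : ℕ => 1 + (k : ℝ) * d) (k + 1)) := by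
    intro k hk
    refine (hgc.mono ?_).intervalIntegrable
    have h1 : 0 ≤ (k : ℝ) * d := by positivity
    have h2 := hmem (k + 1) hk
    push_cast at h2 ⊢
    rw [uIcc_of_le (by linarith)]
    exact Icc_subset_Icc (by linarith) h2
  have hsum := intervalIntegral.sum_integral_adjacent_intervals hint
  have e0 : (1 : ℝ) + (0 : ℕ) * d = 1 := by simp
  have e1 : (1 : ℝ) + m.K * d = 2 := by linarith
  simp only [e0, e1] at hsum
  rw [← hsum, Finset.range_eq_Ico, Finset.mul_sum]
  have hre : ∑ l ∈ Finset.Icc 1 m.K, d * g (m.β l)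
      = ∑ k ∈ Finset.Ico 0 m.K, d * g (m.β (k + 1)) := by
    rw [Finset.sum_Ico_add' (fun l => d * g (m.β l)) 0 m.K 1]
    rfl
  rw [hre, ← Finset.sum_sub_distrib]
  have hcell : ∀ k ∈ Finset.Ico 0 m.K, |d * g (m.β (k + 1))
      - ∫ β in (1 + (k : ℝ) * d)..(1 + ((k + 1 : ℕ) : ℝ) * d), g β| ≤ M * d ^ 3 := by
    intro k hk
    rw [Finset.mem_Ico] at hk
    have h2 := hmem (k + 1) hk.2
    have h1 : 0 ≤ (k : ℝ) * d := by positivity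
    have hβ : m.β (k + 1) = 1 + k * d + d / 2 := by
      rw [Mesh.β, ← hd]; push_cast; ring
    have hi := hint k hk.2
    simp only at hi
    set a := 1 + (k : ℝ) * d with ha
    have hb : 1 + ((k + 1 : ℕ) : ℝ) * d = a + d := by rw [ha]; push_cast; ring
    rw [hb] at h2 hi ⊢
    rw [hβ]
    set c := a + d / 2 with hc
    have hcm : c ∈ Icc (1 : ℝ) 2 := ⟨by linarith, by linarith⟩
    -- The tangent at the midpoint integrates to the midpoint value exactly; only the quadratic
    -- remainder is left.
    have hlin : ∫ β in a..(a + d), (g c + g₁ c * (β - c)) = d * g c := by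
      have hi1 : Continuous fun β : ℝ => g₁ c * (β - c) := by fun_prop
      have hi2 : Continuous fun β : ℝ => β := continuous_id
      rw [intervalIntegral.integral_add (by simp) (hi1.intervalIntegrable _ _),
        intervalIntegral.integral_const, intervalIntegral.integral_const_mul,
        intervalIntegral.integral_sub (hi2.intervalIntegrable _ _) (by simp),
        integral_id, intervalIntegral.integral_const, hc]
      simp only [smul_eq_mul]
      ring
    have hi3 : Continuous fun β : ℝ => g c + g₁ c * (β - c) := by fun_prop
    rw [← hlin, ← intervalIntegral.integral_sub (hi3.intervalIntegrable _ _) hi]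
    have := intervalIntegral.norm_integral_le_of_norm_le_const (a := a) (b := a + d)
      (f := fun β => g c + g₁ c * (β - c) - g β) (C := M * d ^ 2) (fun β hβ => by
        rw [uIoc_of_le (by linarith)] at hβ
        rw [Real.norm_eq_abs, abs_sub_comm]
        have h := abs_taylor_one_le hg hg₁ hM hcm (z := β)
          ⟨by linarith [hβ.1], by linarith [hβ.2]⟩
        rw [sub_sub] at h
        refine h.trans (mul_le_mul_of_nonneg_left ?_ hM0)
        have : |β - c| ≤ d := by
          rw [abs_le]; constructor <;> linarith [hβ.1, hβ.2]
        exact pow_le_pow_left₀ (abs_nonneg _) this 2)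
    rw [Real.norm_eq_abs, add_sub_cancel_left, abs_of_pos hd0] at this
    exact this.trans (le_of_eq (by ring))
  refine (Finset.abs_sum_le_sum_abs _ _).trans ((Finset.sum_le_sum hcell).trans (le_of_eq ?_))
  rw [Finset.sum_const, Nat.card_Ico, nsmul_eq_mul, Nat.sub_zero]
  calc (m.K : ℝ) * (M * d ^ 3) = (d * m.K) * (M * d ^ 2) := by ring
    _ = _ := by rw [hdK, one_mul]

/-- The logarithm is bounded by `s ^ (1/8)` and `s ^ (-1/8)`, and squaring costs `s ^ (-1/4)`. Any
exponent above `-1/2` would keep the singularity square integrable. -/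
theorem one_add_abs_log_sq_le {T s : ℝ} (hs : 0 < s) (hsT : s ≤ T) :
    (1 + |Real.log s|) ^ 2 ≤ (9 * (1 + T) + 8) ^ 2 * s ^ (-(1 / 4) : ℝ) := by
  have hr : 0 < s ^ (1 / 8 : ℝ) := Real.rpow_pos_of_pos hs _
  have h1 : |Real.log s| ≤ 8 * (s ^ (1 / 8 : ℝ) + (s ^ (1 / 8 : ℝ))⁻¹) := by
    have ha := Real.log_le_rpow_div hs.le (show (0 : ℝ) < 1 / 8 by norm_num)
    have hb := Real.log_le_rpow_div (inv_pos.2 hs).le (show (0 : ℝ) < 1 / 8 by norm_num)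
    rw [Real.log_inv, Real.inv_rpow hs.le] at hb
    have := inv_pos.2 hr
    rw [abs_le]; constructor <;> linarith
  have h8 : s ^ (1 / 8 : ℝ) ≤ 1 + T :=
    (rpow_le_one_add hs.le (by norm_num) (by norm_num)).trans (by linarith)
  have h4 : s ^ (1 / 8 : ℝ) * s ^ (1 / 8 : ℝ) ≤ 1 + T := by
    rw [← Real.rpow_add hs]
    exact (rpow_le_one_add hs.le (by norm_num) (by norm_num)).trans (by linarith)
  have h2 : (1 + |Real.log s|) * s ^ (1 / 8 : ℝ) ≤ 9 * (1 + T) + 8 := by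
    have := mul_le_mul_of_nonneg_right h1 hr.le
    have e : 8 * (s ^ (1 / 8 : ℝ) + (s ^ (1 / 8 : ℝ))⁻¹) * s ^ (1 / 8 : ℝ)
        = 8 * (s ^ (1 / 8 : ℝ) * s ^ (1 / 8 : ℝ)) + 8 := by field_simp
    rw [e] at this
    linarith
  have e : s ^ (-(1 / 4) : ℝ) = ((s ^ (1 / 8 : ℝ)) ^ 2)⁻¹ := by
    rw [Real.rpow_neg hs.le, ← Real.rpow_natCast, ← Real.rpow_mul hs.le]; norm_num
  rw [e, ← div_eq_mul_inv, le_div_iff₀ (by positivity), ← mul_pow]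
  exact pow_le_pow_left₀ (by positivity) h2 2

theorem exists_hasDerivWithinAt_of_contDiffOn {q : ℝ → ℝ} {a b : ℝ} (hab : a < b)
    (hq : ContDiffOn ℝ 2 q (Icc a b)) : ∃ (q₁ q₂ : ℝ → ℝ) (A : ℝ), 0 ≤ A ∧
      (∀ β ∈ Icc a b, HasDerivWithinAt q (q₁ β) (Icc a b) β) ∧
      (∀ β ∈ Icc a b, HasDerivWithinAt q₁ (q₂ β) (Icc a b) β) ∧
      ∀ β ∈ Icc a b, |q β| ≤ A ∧ |q₁ β| ≤ A ∧ |q₂ β| ≤ A := by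
  have hu := uniqueDiffOn_Icc hab
  have h1 : ContDiffOn ℝ 1 (derivWithin q (Icc a b)) (Icc a b) :=
    hq.derivWithin hu (by norm_num)
  have h2 : ContDiffOn ℝ 0 (derivWithin (derivWithin q (Icc a b)) (Icc a b)) (Icc a b) :=
    h1.derivWithin hu (by norm_num)
  obtain ⟨A, hA⟩ := isCompact_Icc.exists_bound_of_continuousOn hq.continuousOn
  obtain ⟨B, hB⟩ := isCompact_Icc.exists_bound_of_continuousOn h1.continuousOn
  obtain ⟨C, hC⟩ := isCompact_Icc.exists_bound_of_continuousOn h2.continuousOn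
  refine ⟨derivWithin q (Icc a b), derivWithin (derivWithin q (Icc a b)) (Icc a b),
    max (max A B) C, ?_, fun β hβ => ?_, fun β hβ => ?_, fun β hβ =>
    ⟨?_, ?_, ?_⟩⟩
  · exact ((norm_nonneg _).trans (hA a ⟨le_rfl, hab.le⟩)).trans
      ((le_max_left _ _).trans (le_max_left _ _))
  · exact (hq.differentiableOn (by norm_num) β hβ).hasDerivWithinAt
  · exact (h1.differentiableOn (by norm_num) β hβ).hasDerivWithinAt
  · exact (hA β hβ).trans ((le_max_left _ _).trans (le_max_left _ _))
  · exact (hB β hβ).trans ((le_max_right _ _).trans (le_max_left _ _))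
  · exact (hC β hβ).trans (le_max_right _ _)

/-- The midpoint rule for the power functions in the order. -/
theorem Data.Admissible.exists_midpoint_rpow (hP : P.Admissible) :
    ∃ A : ℝ, 0 ≤ A ∧ ∀ (m : Mesh) (s : ℝ), 0 < s → s ≤ P.T →
      |m.Δβ * ∑ l ∈ Finset.Icc 1 m.K, P.q (m.β l) * s ^ (2 - m.β l)
          - ∫ β in (1 : ℝ)..2, P.q β * s ^ (2 - β)| ≤ A * s ^ (-(1 / 4) : ℝ) * m.Δβ ^ 2 := by
  obtain ⟨q₁, q₂, A, hA, hq, hq₁, hb⟩ :=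
    exists_hasDerivWithinAt_of_contDiffOn (by norm_num) hP.q_contDiffOn
  have hT := hP.T_pos
  refine ⟨A * (1 + P.T) * (9 * (1 + P.T) + 8) ^ 2, by positivity, fun m s hs hsT => ?_⟩
  set L := Real.log s with hL
  have hpow : ∀ β : ℝ, HasDerivAt (fun β : ℝ => s ^ (2 - β)) (-L * s ^ (2 - β)) β := by
    intro β
    have h1 : HasDerivAt (fun β : ℝ => 2 - β) (-1) β := (hasDerivAt_id β).const_sub 2
    refine (h1.const_rpow hs).congr_deriv ?_
    ring
  -- Each derivative of `s ^ (2 - β)` in `β` brings down a factor `-log s`.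
  refine m.abs_midpoint_sub_integral_le (g := fun β => P.q β * s ^ (2 - β))
    (g₁ := fun β => (q₁ β - P.q β * L) * s ^ (2 - β))
    (g₂ := fun β => (q₂ β - q₁ β * L) * s ^ (2 - β) + (q₁ β - P.q β * L) * (-L * s ^ (2 - β)))
    (fun β hβ => ?_) (fun β hβ => ?_) (fun β hβ => ?_)
  · refine ((hq β hβ).mul (hpow β).hasDerivWithinAt).congr_deriv ?_
    ring
  · exact ((hq₁ β hβ).sub ((hq β hβ).mul_const L)).mul (hpow β).hasDerivWithinAt
  · obtain ⟨hb0, hb1, hb2⟩ := hb β hβ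
    have hp0 : 0 ≤ s ^ (2 - β) := Real.rpow_nonneg hs.le _
    have hp1 : s ^ (2 - β) ≤ 1 + P.T :=
      (rpow_le_one_add hs.le (by linarith [hβ.2]) (by linarith [hβ.1])).trans (by linarith)
    have e : (q₂ β - q₁ β * L) * s ^ (2 - β) + (q₁ β - P.q β * L) * (-L * s ^ (2 - β))
        = (q₂ β - 2 * (q₁ β * L) + P.q β * L ^ 2) * s ^ (2 - β) := by ring
    have h1 : |q₂ β - 2 * (q₁ β * L) + P.q β * L ^ 2| ≤ A * (1 + |L|) ^ 2 := by
      have hL0 := abs_nonneg L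
      have ha : |q₁ β * L| ≤ A * |L| := by
        rw [abs_mul]; exact mul_le_mul_of_nonneg_right hb1 hL0
      have hc : |P.q β * L ^ 2| ≤ A * |L| ^ 2 := by
        rw [abs_mul, abs_pow]; exact mul_le_mul_of_nonneg_right hb0 (by positivity)
      rw [abs_le] at *
      constructor <;> nlinarith
    rw [e, abs_mul, abs_of_nonneg hp0]
    calc _ ≤ A * (1 + |L|) ^ 2 * (1 + P.T) := mul_le_mul h1 hp1 hp0 (by positivity)
      _ = A * (1 + P.T) * (1 + |L|) ^ 2 := by ring
      _ ≤ A * (1 + P.T) * ((9 * (1 + P.T) + 8) ^ 2 * s ^ (-(1 / 4) : ℝ)) := by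
        have := one_add_abs_log_sq_le hs hsT
        gcongr
      _ = _ := by ring

open MeasureTheory Filter Topology

theorem Data.p_mul_inv_Gamma (P : Data) (β z : ℝ) :
    P.p β * ((Real.Gamma (3 - β))⁻¹ * z) = P.q β * z := by
  rw [Data.q, mul_assoc]

theorem continuous_const_rpow_sub {s : ℝ} (hs : 0 < s) :
    Continuous (fun β : ℝ => s ^ (2 - β)) :=
  continuous_const.rpow (continuous_const.sub continuous_id) fun _ => Or.inl hs.ne'

/-- Justifies Fubini: the integrand is bounded on a rectangle of finite measure. The open rectangle
keeps the base `t - ξ` positive, hence the power jointly continuous. -/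
theorem Data.Admissible.integrable_rpow_mul (hP : P.Admissible) {g' : ℝ → ℝ} {t M : ℝ}
    (ht : t ≤ P.T) (hg' : ContinuousOn g' (Icc 0 P.T))
    (hM : ∀ s ∈ Icc 0 P.T, |g' s| ≤ M) :
    Integrable (Function.uncurry fun β ξ : ℝ => P.q β * (t - ξ) ^ (2 - β) * g' ξ)
      ((volume.restrict (Ioo 1 2)).prod (volume.restrict (Ioo 0 t))) := by
  obtain ⟨q₀, q₁, hq₀, hq₁, hq⟩ := hP.exists_q_bounds
  have hT := hP.T_pos
  rw [Measure.prod_restrict]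
  have hms : MeasurableSet (Ioo (1 : ℝ) 2 ×ˢ Ioo (0 : ℝ) t) :=
    measurableSet_Ioo.prod measurableSet_Ioo
  have hcont : ContinuousOn (Function.uncurry fun β ξ : ℝ => P.q β * (t - ξ) ^ (2 - β) * g' ξ)
      (Ioo (1 : ℝ) 2 ×ˢ Ioo (0 : ℝ) t) := by
    refine ContinuousOn.mul (ContinuousOn.mul ?_ ?_) ?_
    · exact hP.q_contDiffOn.continuousOn.comp continuousOn_fst
        fun z hz => Ioo_subset_Icc_self hz.1
    · refine ContinuousOn.rpow (by fun_prop) (by fun_prop) fun z hz => Or.inl ?_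
      exact (sub_pos.2 hz.2.2).ne'
    · exact hg'.comp continuousOn_snd fun z hz => ⟨hz.2.1.le, hz.2.2.le.trans ht⟩
  refine IntegrableOn.of_bound ?_ (hcont.aestronglyMeasurable hms) (q₁ * (1 + P.T) * M) ?_
  · rw [Measure.prod_prod]
    exact (ENNReal.mul_lt_top measure_Ioo_lt_top measure_Ioo_lt_top)
  · refine (ae_restrict_iff' hms).2 (Eventually.of_forall fun z hz => ?_)
    obtain ⟨⟨h1, h2⟩, h3, h4⟩ := hz
    have hβ : z.1 ∈ Icc (1 : ℝ) 2 := ⟨h1.le, h2.le⟩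
    simp only [Function.uncurry, norm_mul, Real.norm_eq_abs]
    have hr : 0 ≤ (t - z.2) ^ (2 - z.1) := Real.rpow_nonneg (by linarith) _
    rw [abs_of_pos (hP.q_pos hβ), abs_of_nonneg hr]
    have hr1 := rpow_le_one_add (s := t - z.2) (γ := 2 - z.1) (by linarith) (by linarith)
      (by linarith)
    exact mul_le_mul (mul_le_mul (hq _ hβ).2 (by linarith) hr hq₁.le)
      (hM _ ⟨h3.le, h4.le.trans ht⟩) (abs_nonneg _) (by positivity)

/-- The midpoint rule for the distributed-order fractional integral. -/
theorem Data.Admissible.exists_midpoint_frac (hP : P.Admissible) {M : ℝ} (hM0 : 0 ≤ M) :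
    ∃ A : ℝ, 0 ≤ A ∧ ∀ (m : Mesh) (g g' : ℝ → ℝ),
      (∀ s ∈ Icc 0 P.T, HasDerivWithinAt g (g' s) (Icc 0 P.T) s) →
      ContinuousOn g' (Icc 0 P.T) → (∀ s ∈ Icc 0 P.T, |g s| ≤ M) →
      (∀ s ∈ Icc 0 P.T, |g' s| ≤ M) → ∀ t ∈ Ioc 0 P.T,
      |m.Δβ * ∑ l ∈ Finset.Icc 1 m.K, P.p (m.β l) * frac g (m.β l) t
          - ∫ β in (1 : ℝ)..2, P.p β * frac g β t| ≤ A * t ^ (-(1 / 4) : ℝ) * m.Δβ ^ 2 := by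
  obtain ⟨A, hA, hmid⟩ := hP.exists_midpoint_rpow
  have hT := hP.T_pos
  -- The `1` comes from the boundary term with `g 0`, and `4 / 3 * T` from integrating `(t - ξ) ^
  -- (-1/4)`.
  refine ⟨A * M * (1 + 4 / 3 * P.T), by positivity, fun m g g' hg hg'c hM hM' t ht => ?_⟩
  have ht' : t ∈ Icc 0 P.T := ⟨ht.1.le, ht.2⟩
  have hΦ := hP.integrable_rpow_mul ht.2 hg'c hM'
  set Φ : ℝ → ℝ → ℝ := fun β ξ => P.q β * (t - ξ) ^ (2 - β) * g' ξ with hΦd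
  -- After integration by parts the order enters only through `q(β) s ^ (2 - β)`, for which the
  -- midpoint rule is known.
  have hfrac : ∀ β : ℝ, β < 2 → P.p β * frac g β t
      = P.q β * t ^ (2 - β) * g 0 + ∫ ξ in Ioo 0 t, Φ β ξ := by
    intro β hβ
    rw [frac_eq hβ hg hg'c ht', P.p_mul_inv_Gamma, mul_add, ← mul_assoc,
      intervalIntegral.integral_of_le ht.1.le, integral_Ioc_eq_integral_Ioo, ← integral_const_mul]
    simp only [hΦd, mul_assoc]
  have hΦ₁ : Integrable (fun β => ∫ ξ in Ioo 0 t, Φ β ξ) (volume.restrict (Ioo 1 2)) :=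
    hΦ.integral_prod_left
  have hint : ∫ β in (1 : ℝ)..2, P.p β * frac g β t
      = (∫ β in (1 : ℝ)..2, P.q β * t ^ (2 - β)) * g 0
        + ∫ ξ in Ioo 0 t, (∫ β in (1 : ℝ)..2, P.q β * (t - ξ) ^ (2 - β)) * g' ξ := by
    rw [intervalIntegral.integral_of_le one_le_two, integral_Ioc_eq_integral_Ioo,
      setIntegral_congr_fun measurableSet_Ioo (fun β hβ => hfrac β hβ.2),
      integral_add _ hΦ₁, integral_mul_const,
      intervalIntegral.integral_of_le one_le_two, integral_Ioc_eq_integral_Ioo,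
      integral_integral_swap hΦ]
    · congr 1
      refine integral_congr_ae (Eventually.of_forall fun ξ => ?_)
      simp only [hΦd]
      rw [integral_mul_const, intervalIntegral.integral_of_le one_le_two,
        integral_Ioc_eq_integral_Ioo]
    · refine Integrable.mul_const ?_ _
      have : ContinuousOn (fun β : ℝ => P.q β * t ^ (2 - β)) (Icc 1 2) :=
        hP.q_contDiffOn.continuousOn.mul (continuous_const_rpow_sub ht.1).continuousOn
      exact (this.integrableOn_compact isCompact_Icc).mono_set Ioo_subset_Icc_self
  have hΦl : ∀ l ∈ Finset.Icc 1 m.K, Integrable (Φ (m.β l)) (volume.restrict (Ioo 0 t)) := by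
    intro l hl
    have hβ := m.β_mem hl
    have : ContinuousOn (Φ (m.β l)) (Icc 0 t) := by
      refine ContinuousOn.mul (continuousOn_const.mul ?_) (hg'c.mono (Icc_subset_Icc_right ht.2))
      exact ((continuous_const.sub continuous_id).rpow_const
        fun _ => Or.inr (by linarith [hβ.2])).continuousOn
    exact (this.integrableOn_compact isCompact_Icc).mono_set Ioo_subset_Icc_self
  have hsum : m.Δβ * ∑ l ∈ Finset.Icc 1 m.K, P.p (m.β l) * frac g (m.β l) t
      = (m.Δβ * ∑ l ∈ Finset.Icc 1 m.K, P.q (m.β l) * t ^ (2 - m.β l)) * g 0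
        + ∫ ξ in Ioo 0 t, (m.Δβ * ∑ l ∈ Finset.Icc 1 m.K,
            P.q (m.β l) * (t - ξ) ^ (2 - m.β l)) * g' ξ := by
    rw [Finset.sum_congr rfl fun l hl => hfrac _ (m.β_mem hl).2, Finset.sum_add_distrib,
      ← integral_finsetSum _ hΦl, mul_add, ← Finset.sum_mul, mul_assoc, ← integral_const_mul]
    congr 1
    refine integral_congr_ae (Eventually.of_forall fun ξ => ?_)
    simp only [hΦd]
    rw [← Finset.sum_mul, mul_assoc]
  have hi1 : Integrable (fun ξ => (m.Δβ * ∑ l ∈ Finset.Icc 1 m.K,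
      P.q (m.β l) * (t - ξ) ^ (2 - m.β l)) * g' ξ) (volume.restrict (Ioo 0 t)) := by
    refine ((integrable_finsetSum _ hΦl).const_mul m.Δβ).congr (Eventually.of_forall fun ξ => ?_)
    simp only [hΦd]
    rw [← Finset.sum_mul, mul_assoc]
  have hi2 : Integrable (fun ξ => (∫ β in (1 : ℝ)..2, P.q β * (t - ξ) ^ (2 - β)) * g' ξ)
      (volume.restrict (Ioo 0 t)) := by
    refine hΦ.integral_prod_right.congr (Eventually.of_forall fun ξ => ?_)
    simp only [hΦd, Function.uncurry]
    rw [integral_mul_const, intervalIntegral.integral_of_le one_le_two,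
      integral_Ioc_eq_integral_Ioo]
  rw [hsum, hint, add_sub_add_comm, ← sub_mul, ← integral_sub hi1 hi2]
  simp only [← sub_mul]
  have hb1 : |(m.Δβ * ∑ l ∈ Finset.Icc 1 m.K, P.q (m.β l) * t ^ (2 - m.β l)
      - ∫ β in (1 : ℝ)..2, P.q β * t ^ (2 - β)) * g 0|
      ≤ A * t ^ (-(1 / 4) : ℝ) * m.Δβ ^ 2 * M := by
    rw [abs_mul]
    have := Real.rpow_nonneg ht.1.le (-(1 / 4) : ℝ)
    exact mul_le_mul (hmid m t ht.1 ht.2) (hM 0 ⟨le_rfl, hT.le⟩) (abs_nonneg _) (by positivity)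
  have hk : IntegrableOn (fun ξ : ℝ => A * (t - ξ) ^ (-(1 / 4) : ℝ) * m.Δβ ^ 2 * M)
      (Ioo 0 t) := by
    -- The order `5 / 4` is chosen because `1 - 5 / 4 = -1 / 4`.
    have h := intervalIntegrable_kernel (β := 5 / 4) (by norm_num) t 0 t
    rw [intervalIntegrable_iff_integrableOn_Ioo_of_le ht.1.le] at h
    have e : (1 : ℝ) - 5 / 4 = -(1 / 4) := by norm_num
    rw [e] at h
    exact ((h.const_mul A).mul_const _).mul_const _
  have hkint : ∫ ξ in Ioo 0 t, A * (t - ξ) ^ (-(1 / 4) : ℝ) * m.Δβ ^ 2 * M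
      = A * (4 / 3 * (t * t ^ (-(1 / 4) : ℝ))) * m.Δβ ^ 2 * M := by
    rw [integral_mul_const, integral_mul_const, integral_const_mul,
      ← integral_Ioc_eq_integral_Ioo, ← intervalIntegral.integral_of_le ht.1.le]
    have h := integral_kernel (β := 5 / 4) (by norm_num) t 0 t
    rw [show (1 : ℝ) - 5 / 4 = -(1 / 4) by norm_num, sub_self, sub_zero,
      Real.zero_rpow (by norm_num), sub_zero,
      show (2 : ℝ) - 5 / 4 = 1 + -(1 / 4) by norm_num, Real.rpow_add ht.1, Real.rpow_one] at h
    rw [h]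
    ring
  have hb2 := norm_integral_le_of_norm_le (f := fun ξ =>
    (m.Δβ * ∑ l ∈ Finset.Icc 1 m.K, P.q (m.β l) * (t - ξ) ^ (2 - m.β l)
      - ∫ β in (1 : ℝ)..2, P.q β * (t - ξ) ^ (2 - β)) * g' ξ) hk
    ((ae_restrict_iff' measurableSet_Ioo).2 (Eventually.of_forall fun ξ hξ => by
      rw [norm_mul, Real.norm_eq_abs, Real.norm_eq_abs]
      have := Real.rpow_nonneg (show 0 ≤ t - ξ by linarith [hξ.2]) (-(1 / 4) : ℝ)
      exact mul_le_mul (hmid m (t - ξ) (by linarith [hξ.2]) (by linarith [hξ.1, ht.2]))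
        (hM' ξ ⟨hξ.1.le, hξ.2.le.trans ht.2⟩) (abs_nonneg _) (by positivity)))
  rw [hkint, Real.norm_eq_abs] at hb2
  refine (abs_add_le _ _).trans ((add_le_add hb1 hb2).trans ?_)
  have h0 := Real.rpow_nonneg ht.1.le (-(1 / 4) : ℝ)
  have h1 : t * t ^ (-(1 / 4) : ℝ) ≤ P.T * t ^ (-(1 / 4) : ℝ) :=
    mul_le_mul_of_nonneg_right ht.2 h0
  calc _ ≤ A * t ^ (-(1 / 4) : ℝ) * m.Δβ ^ 2 * M
        + A * (4 / 3 * (P.T * t ^ (-(1 / 4) : ℝ))) * m.Δβ ^ 2 * M := by gcongr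
    _ = _ := by ring

/-! ### The memory integral at the initial time and the Caputo derivative -/

/-- The integrand is of size `t ^ (2 - β)`, which tends to zero for each `β < 2` but not uniformly
as `β → 2`; dominated convergence closes the gap. -/
theorem Data.Admissible.tendsto_integral_frac_zero (hP : P.Admissible) {g : ℝ → ℝ} {M : ℝ}
    (hg : ContinuousOn g (Icc 0 P.T)) (hM : ∀ s ∈ Icc 0 P.T, |g s| ≤ M) :
    Tendsto (fun t => ∫ β in (1 : ℝ)..2, P.p β * frac g β t) (𝓝[>] 0) (𝓝 0) := by
  obtain ⟨q₀, q₁, hq₀, hq₁, hq⟩ := hP.exists_q_bounds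
  have hT := hP.T_pos
  have hM0 : 0 ≤ M := (abs_nonneg _).trans (hM 0 ⟨le_rfl, hT.le⟩)
  have hmem : ∀ᶠ t in 𝓝[>] (0 : ℝ), t ∈ Ioo 0 P.T := Ioo_mem_nhdsGT hT
  have hlim : Tendsto (fun t : ℝ => ∫ β in (1 : ℝ)..2, q₁ * M * t ^ (2 - β)) (𝓝[>] 0)
      (𝓝 (∫ β in (1 : ℝ)..2, (0 : ℝ))) := by
    refine intervalIntegral.tendsto_integral_filter_of_dominated_convergence
      (fun _ => q₁ * M * (1 + P.T)) ?_ ?_ (by simp) ?_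
    · filter_upwards [hmem] with t ht
      exact (continuous_const.mul (continuous_const_rpow_sub ht.1)).aestronglyMeasurable
    · filter_upwards [hmem] with t ht
      refine Eventually.of_forall fun β hβ => ?_
      rw [uIoc_of_le one_le_two] at hβ
      have h0 : 0 ≤ t ^ (2 - β) := Real.rpow_nonneg ht.1.le _
      rw [Real.norm_eq_abs, abs_of_nonneg (by positivity)]
      have := rpow_le_one_add (γ := 2 - β) ht.1.le (by linarith [hβ.2]) (by linarith [hβ.1])
      gcongr
      linarith [ht.2]
    · have h2 : ∀ᵐ β : ℝ, β ≠ 2 := by simp [ae_iff]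
      filter_upwards [h2] with β hβ2 hβ
      rw [uIoc_of_le one_le_two] at hβ
      have hlt : 0 < 2 - β := by
        have := lt_of_le_of_ne hβ.2 hβ2
        linarith
      have h := ((Real.continuous_rpow_const hlt.le).tendsto (0 : ℝ)).const_mul (q₁ * M)
      rw [Real.zero_rpow hlt.ne', mul_zero] at h
      exact h.mono_left nhdsWithin_le_nhds
  rw [intervalIntegral.integral_zero] at hlim
  refine squeeze_zero_norm' ?_ hlim
  filter_upwards [hmem] with t ht
  refine intervalIntegral.norm_integral_le_of_norm_le one_le_two ?_
    ((continuous_const.mul (continuous_const_rpow_sub ht.1)).intervalIntegrable _ _)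
  have h2 : ∀ᵐ β : ℝ, β ≠ 2 := by simp [ae_iff]
  filter_upwards [h2] with β hβ2 hβ
  have hlt : β < 2 := lt_of_le_of_ne hβ.2 hβ2
  have hβ' : β ∈ Icc (1 : ℝ) 2 := ⟨hβ.1.le, hβ.2⟩
  have h := abs_frac_le hlt hg hM (t := t) ⟨ht.1.le, ht.2.le⟩
  rw [norm_mul, Real.norm_eq_abs, Real.norm_eq_abs, abs_of_pos (hP.p_pos β hβ')]
  calc P.p β * |frac g β t| ≤ P.p β * ((Real.Gamma (3 - β))⁻¹ * t ^ (2 - β) * M) :=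
        mul_le_mul_of_nonneg_left h (hP.p_pos β hβ').le
    _ = P.q β * (M * t ^ (2 - β)) := by rw [Data.q]; ring
    _ ≤ q₁ * (M * t ^ (2 - β)) := by
        have : 0 ≤ t ^ (2 - β) := Real.rpow_nonneg ht.1.le _
        gcongr
        exact (hq β hβ').2
    _ = _ := by ring

theorem iteratedDerivWithin_two_eq {F F₁ F₂ : ℝ → ℝ} {a b : ℝ} (hab : a < b)
    (hF : ∀ z ∈ Icc a b, HasDerivWithinAt F (F₁ z) (Icc a b) z)
    (hF₁ : ∀ z ∈ Icc a b, HasDerivWithinAt F₁ (F₂ z) (Icc a b) z) {z : ℝ} (hz : z ∈ Icc a b) :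
    iteratedDerivWithin 2 F (Icc a b) z = F₂ z := by
  have hu := uniqueDiffOn_Icc hab
  have h1 : EqOn (iteratedDerivWithin 1 F (Icc a b)) F₁ (Icc a b) := fun x hx => by
    rw [iteratedDerivWithin_one]
    exact (hF x hx).derivWithin (hu x hx)
  rw [show (2 : ℕ) = 1 + 1 from rfl, iteratedDerivWithin_succ, derivWithin_congr h1 (h1 hz)]
  exact (hF₁ z hz).derivWithin (hu z hz)

theorem caputo_eq_frac {T : ℝ} {v g : ℝ → ℝ}
    (hv : ∀ t ∈ Icc 0 T, iteratedDerivWithin 2 v (Icc 0 T) t = g t) {β t : ℝ}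
    (hβ : β ∈ Ioo (1 : ℝ) 2) (ht : t ∈ Icc 0 T) : caputo T v β t = frac g β t := by
  rw [caputo, if_neg hβ.1.ne', if_neg hβ.2.ne, frac, one_div]
  congr 1
  refine intervalIntegral.integral_congr fun ξ hξ => ?_
  rw [uIcc_of_le ht.1] at hξ
  rw [hv ξ ⟨hξ.1, hξ.2.trans ht.2⟩]

/-! ### Derivatives of the solution -/

/-- The family `D a b c` consists of the partial derivatives in the definition of `IsC443`. -/
structure IsDerivFamily (L₁ L₂ T : ℝ) (D : ℕ → ℕ → ℕ → ℝ → ℝ → ℝ → ℝ) : Prop where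
  cont : ∀ a b c, a ≤ 4 → b ≤ 4 → c ≤ 3 →
    ContinuousOn (fun z : ℝ × ℝ × ℝ => D a b c z.1 z.2.1 z.2.2) (box L₁ L₂ T)
  hx : ∀ a b c, a < 4 → b ≤ 4 → c ≤ 3 → ∀ x y t, (x, y, t) ∈ box L₁ L₂ T →
    HasDerivWithinAt (fun s => D a b c s y t) (D (a + 1) b c x y t) (Icc 0 L₁) x
  hy : ∀ a b c, a ≤ 4 → b < 4 → c ≤ 3 → ∀ x y t, (x, y, t) ∈ box L₁ L₂ T →
    HasDerivWithinAt (fun s => D a b c x s t) (D a (b + 1) c x y t) (Icc 0 L₂) y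
  ht : ∀ a b c, a ≤ 4 → b ≤ 4 → c < 3 → ∀ x y t, (x, y, t) ∈ box L₁ L₂ T →
    HasDerivWithinAt (fun s => D a b c x y s) (D a b (c + 1) x y t) (Icc 0 T) t

theorem IsDerivFamily.exists_bound {L₁ L₂ T : ℝ} {D : ℕ → ℕ → ℕ → ℝ → ℝ → ℝ → ℝ}
    (hD : IsDerivFamily L₁ L₂ T D) : ∃ M : ℝ, 0 ≤ M ∧ ∀ a b c, a ≤ 4 → b ≤ 4 → c ≤ 3 →
      ∀ x y t, (x, y, t) ∈ box L₁ L₂ T → |D a b c x y t| ≤ M := by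
  have hbox : IsCompact (box L₁ L₂ T) := isCompact_Icc.prod (isCompact_Icc.prod isCompact_Icc)
  have h : ∀ s : ℕ × ℕ × ℕ, ∃ B : ℝ, 0 ≤ B ∧ (s.1 ≤ 4 → s.2.1 ≤ 4 → s.2.2 ≤ 3 →
      ∀ x y t, (x, y, t) ∈ box L₁ L₂ T → |D s.1 s.2.1 s.2.2 x y t| ≤ B) := by
    intro s
    by_cases hs : s.1 ≤ 4 ∧ s.2.1 ≤ 4 ∧ s.2.2 ≤ 3
    · obtain ⟨B, hB⟩ := hbox.exists_bound_of_continuousOn (hD.cont _ _ _ hs.1 hs.2.1 hs.2.2)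
      exact ⟨|B|, abs_nonneg _, fun _ _ _ x y t h => (hB (x, y, t) h).trans (le_abs_self B)⟩
    · exact ⟨0, le_rfl, fun h1 h2 h3 => absurd ⟨h1, h2, h3⟩ hs⟩
  choose B hB0 hB using h
  refine ⟨∑ s ∈ Finset.range 5 ×ˢ Finset.range 5 ×ˢ Finset.range 4, B s,
    Finset.sum_nonneg fun s _ => hB0 s, fun a b c ha hb hc x y t h => ?_⟩
  refine (hB (a, b, c) ha hb hc x y t h).trans
    (Finset.single_le_sum (f := B) (fun s _ => hB0 s) ?_)
  simp only [Finset.mem_product, Finset.mem_range]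
  omega

theorem Data.mem_box {x y t : ℝ} (h : (x, y) ∈ P.Ω) (ht : t ∈ Icc 0 P.T) :
    (x, y, t) ∈ box P.L₁ P.L₂ P.T :=
  ⟨Ioo_subset_Icc_self h.1, Ioo_subset_Icc_self h.2, ht⟩

/-- The differential equation, up to the initial time. -/
theorem IsSolution.equation_frac {U : ℝ → ℝ → ℝ → ℝ} {D : ℕ → ℕ → ℕ → ℝ → ℝ → ℝ → ℝ}
    (hU : IsSolution P U) (hP : P.Admissible) (hD : IsDerivFamily P.L₁ P.L₂ P.T D)
    (hDU : ∀ x y t, (x, y, t) ∈ box P.L₁ P.L₂ P.T → D 0 0 0 x y t = U x y t)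
    {x y t : ℝ} (hxy : (x, y) ∈ P.Ω) (ht : t ∈ Icc 0 P.T) :
    ∫ β in (1 : ℝ)..2, P.p β * frac (D 0 0 2 x y) β t
      = D 2 0 0 x y t + D 0 2 0 x y t + P.f x y t (D 0 0 0 x y t) := by
  have hT := hP.T_pos
  have hpos : ∀ t ∈ Ioc 0 P.T, ∫ β in (1 : ℝ)..2, P.p β * frac (D 0 0 2 x y) β t
      = D 2 0 0 x y t + D 0 2 0 x y t + P.f x y t (D 0 0 0 x y t) := by
    intro t ht
    have ht' : t ∈ Icc 0 P.T := ⟨ht.1.le, ht.2⟩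
    have hb := Data.mem_box hxy ht'
    have h := hU.equation x y t hxy ht
    have hxx : iteratedDerivWithin 2 (fun s => U s y t) (Icc 0 P.L₁) x = D 2 0 0 x y t := by
      refine iteratedDerivWithin_two_eq (F₁ := fun s => D 1 0 0 s y t)
        (F₂ := fun s => D 2 0 0 s y t) hP.L₁_pos (fun z hz => ?_) (fun z hz => ?_) hb.1
      · exact (hD.hx 0 0 0 (by omega) (by omega) (by omega) z y t ⟨hz, hb.2⟩).congr
          (fun w hw => (hDU w y t ⟨hw, hb.2⟩).symm) (hDU z y t ⟨hz, hb.2⟩).symm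
      · exact hD.hx 1 0 0 (by omega) (by omega) (by omega) z y t ⟨hz, hb.2⟩
    have hyy : iteratedDerivWithin 2 (fun s => U x s t) (Icc 0 P.L₂) y = D 0 2 0 x y t := by
      refine iteratedDerivWithin_two_eq (F₁ := fun s => D 0 1 0 x s t)
        (F₂ := fun s => D 0 2 0 x s t) hP.L₂_pos (fun z hz => ?_) (fun z hz => ?_) hb.2.1
      · exact (hD.hy 0 0 0 (by omega) (by omega) (by omega) x z t ⟨hb.1, hz, ht'⟩).congr
          (fun w hw => (hDU x w t ⟨hb.1, hw, ht'⟩).symm) (hDU x z t ⟨hb.1, hz, ht'⟩).symm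
      · exact hD.hy 0 1 0 (by omega) (by omega) (by omega) x z t ⟨hb.1, hz, ht'⟩
    have htt : ∀ s ∈ Icc 0 P.T,
        iteratedDerivWithin 2 (fun s => U x y s) (Icc 0 P.T) s = D 0 0 2 x y s := by
      intro s hs
      refine iteratedDerivWithin_two_eq (F₁ := fun s => D 0 0 1 x y s)
        (F₂ := fun s => D 0 0 2 x y s) hT (fun z hz => ?_) (fun z hz => ?_) hs
      · exact (hD.ht 0 0 0 (by omega) (by omega) (by omega) x y z ⟨hb.1, hb.2.1, hz⟩).congr
          (fun w hw => (hDU x y w ⟨hb.1, hb.2.1, hw⟩).symm) (hDU x y z ⟨hb.1, hb.2.1, hz⟩).symm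
      · exact hD.ht 0 0 1 (by omega) (by omega) (by omega) x y z ⟨hb.1, hb.2.1, hz⟩
    rw [hxx, hyy, ← hDU x y t hb] at h
    -- The Caputo derivative has its own definition at `β = 1` and `β = 2`; these end points form a
    -- null set and are discarded.
    rw [← h, intervalIntegral.integral_of_le one_le_two, intervalIntegral.integral_of_le one_le_two,
      integral_Ioc_eq_integral_Ioo, integral_Ioc_eq_integral_Ioo]
    refine setIntegral_congr_fun measurableSet_Ioo fun β hβ => ?_
    rw [caputo_eq_frac htt hβ ht']
  -- At `t = 0` the limit from the right is taken. The memory integral tends to `0`, which is also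
  -- its value at `0`, and the right side is continuous.
  rcases ht.1.eq_or_lt with h0 | h0
  swap
  · exact hpos t ⟨h0, ht.2⟩
  subst h0
  have hline : ∀ a b c, a ≤ 4 → b ≤ 4 → c ≤ 3 → ContinuousOn (D a b c x y) (Icc 0 P.T) :=
    fun a b c ha hb hc => (hD.cont a b c ha hb hc).comp (f := fun s : ℝ => (x, y, s))
      (by fun_prop) fun s hs => Data.mem_box hxy hs
  obtain ⟨M, -, hM⟩ := hD.exists_bound
  have hl := hP.tendsto_integral_frac_zero (hline 0 0 2 (by omega) (by omega) (by omega))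
    (fun s hs => hM 0 0 2 (by omega) (by omega) (by omega) x y s (Data.mem_box hxy hs))
  have hcf : ContinuousOn (fun s => P.f x y s (D 0 0 0 x y s)) (Icc 0 P.T) := by
    refine hP.f_cont.comp (f := fun s : ℝ => ((x, y), (s, D 0 0 0 x y s))) ?_
      fun s hs => ⟨hxy, hs, trivial⟩
    have := hline 0 0 0 (by omega) (by omega) (by omega)
    fun_prop
  have hr : ContinuousOn (fun s => D 2 0 0 x y s + D 0 2 0 x y s + P.f x y s (D 0 0 0 x y s))
      (Icc 0 P.T) :=
    ((hline 2 0 0 (by omega) (by omega) (by omega)).add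
      (hline 0 2 0 (by omega) (by omega) (by omega))).add hcf
  have hr0 := (hr 0 ⟨le_rfl, hT.le⟩).tendsto.mono_left
    (nhdsWithin_le_of_mem (mem_of_superset (Ioc_mem_nhdsGT hT) Ioc_subset_Icc_self) :
      𝓝[>] (0 : ℝ) ≤ 𝓝[Icc 0 P.T] 0)
  have heq := tendsto_nhds_unique_of_eventuallyEq hl hr0
    (mem_of_superset (Ioc_mem_nhdsGT hT) fun s hs => hpos s hs)
  rw [← heq]
  simp [frac]

/-! ### The alternating direction procedure -/

theorem factorX_congr {μ h s : ℝ} {v w : ℕ → ℕ → ℝ} {i j : ℕ} (h1 : v (i - 1) j = w (i - 1) j)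
    (h2 : v i j = w i j) (h3 : v (i + 1) j = w (i + 1) j) :
    factorX μ h s v i j = factorX μ h s w i j := by
  simp only [factorX, dxx, dx, Nat.add_sub_cancel, h1, h2, h3]

/-- The product of the one-dimensional factors is the two-dimensional operator plus `1 / (4μ)` times
the mixed difference, which is the perturbation in the scheme. The condition `s ^ 2 = 1` covers both
signs. -/
theorem factorX_factorY {μ h k s : ℝ} (hμ : 0 < μ) (hs : s ^ 2 = 1) (v : ℕ → ℕ → ℝ) (i j : ℕ) :
    factorX μ h s (factorY μ k s v) i j
      = μ * v i j + s / 2 * (dxx h v i j + dyy k v i j) + 1 / (4 * μ) * dxx h (dyy k v) i j := by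
  have hr : 0 < Real.sqrt μ := Real.sqrt_pos.2 hμ
  have hr2 : Real.sqrt μ ^ 2 = μ := Real.sq_sqrt hμ.le
  have e : factorX μ h s (factorY μ k s v) i j
      = Real.sqrt μ ^ 2 * v i j
        + (Real.sqrt μ * (Real.sqrt μ)⁻¹) * (s / 2 * (dxx h v i j + dyy k v i j))
        + s ^ 2 * (1 / 4 * (Real.sqrt μ ^ 2)⁻¹ * dxx h (dyy k v) i j) := by
    simp only [factorX, factorY, dxx, dx]
    ring
  rw [e, mul_inv_cancel₀ hr.ne', hs, hr2]
  field_simp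

theorem IsADISolution.isSchemeSolution {m : Mesh} {u : GridFun} (hP : P.Admissible)
    (hu : IsADISolution P m u) : IsSchemeSolution P m u := by
  refine ⟨fun n i j hn hnN hij => ?_, hu.initial, hu.boundary⟩
  obtain ⟨w, hw1, hw2, hw3⟩ := hu.step n hn hnN
  have hτ := hP.τ_pos m
  have hμ := hP.μ_pos m
  -- The values prescribed for `w` at `i = 0` and `i = M₁` extend `w = factorY … (u n)` to the whole
  -- row, so `w` can be eliminated.
  have hwu : ∀ i' : ℕ, i' ≤ m.M₁ → w i' j = factorY (m.μ P) (m.h₂ P) (-1) (u n) i' j := by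
    intro i' hi'
    rcases Nat.eq_zero_or_pos i' with rfl | h0
    · exact (hw2 j hij.2.2.1 hij.2.2.2).1
    rcases hi'.eq_or_lt with rfl | h1
    · exact (hw2 j hij.2.2.1 hij.2.2.2).2
    · exact (hw3 i' j ⟨h0, h1, hij.2.2⟩).symm
  have h := hw1 i j hij
  rw [factorX_congr (hwu (i - 1) (by have := hij.2.1; omega)) (hwu i hij.2.1.le)
    (hwu (i + 1) hij.2.1), factorX_factorY hμ (by norm_num), factorX_factorY hμ (by norm_num)] at h
  have hmem : ∀ l ∈ Finset.Icc 1 m.K,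
      P.p (m.β l) * (m.τ P ^ (1 - m.β l) / Real.Gamma (3 - m.β l)) *
          (coeff (m.β l) 0 * dt (m.τ P) u n i j
            - ∑ k ∈ Finset.Ico 1 n,
                (coeff (m.β l) (n - k - 1) - coeff (m.β l) (n - k)) * dt (m.τ P) u k i j
            - coeff (m.β l) (n - 1) * P.ψ₂ (m.x P i) (m.y P j))
      = P.p (m.β l) * (1 / (m.τ P ^ m.β l * Real.Gamma (3 - m.β l))) * (u n i j - u (n - 1) i j)
        - P.p (m.β l) * (1 / (m.τ P ^ m.β l * Real.Gamma (3 - m.β l))) *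
              (∑ k ∈ Finset.Ico 1 n,
                  (coeff (m.β l) (n - k - 1) - coeff (m.β l) (n - k)) *
                    (u k i j - u (k - 1) i j)
                + m.τ P * coeff (m.β l) (n - 1) * P.ψ₂ (m.x P i) (m.y P j)) := by
    intro l hl
    have hβ := m.β_mem hl
    have hp : 0 < m.τ P ^ m.β l := Real.rpow_pos_of_pos hτ _
    have hΓ : 0 < Real.Gamma (3 - m.β l) := Real.Gamma_pos_of_pos (by linarith [hβ.2])
    have hs : ∑ k ∈ Finset.Ico 1 n,
        (coeff (m.β l) (n - k - 1) - coeff (m.β l) (n - k)) * dt (m.τ P) u k i j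
        = (∑ k ∈ Finset.Ico 1 n,
        (coeff (m.β l) (n - k - 1) - coeff (m.β l) (n - k)) * (u k i j - u (k - 1) i j)) / m.τ P := by
      rw [Finset.sum_div]
      refine Finset.sum_congr rfl fun k _ => ?_
      rw [dt]; ring
    rw [hs, coeff_zero hβ.2, Real.rpow_sub hτ, Real.rpow_one, dt]
    field_simp
    ring
  have hdd : m.τ P / (4 * m.μ P) * dxx (m.h₁ P) (dyy (m.h₂ P) (dt (m.τ P) u n)) i j
      = 1 / (4 * m.μ P) * dxx (m.h₁ P) (dyy (m.h₂ P) (u n)) i j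
        - 1 / (4 * m.μ P) * dxx (m.h₁ P) (dyy (m.h₂ P) (u (n - 1))) i j := by
    have : dxx (m.h₁ P) (dyy (m.h₂ P) (dt (m.τ P) u n)) i j
        = (dxx (m.h₁ P) (dyy (m.h₂ P) (u n)) i j
          - dxx (m.h₁ P) (dyy (m.h₂ P) (u (n - 1))) i j) / m.τ P := by
      simp only [dxx, dx, dyy, dy, dt]; ring
    rw [this]
    field_simp
  have hmx : dxx (m.h₁ P) (mean u n) i j
      = (dxx (m.h₁ P) (u n) i j + dxx (m.h₁ P) (u (n - 1)) i j) / 2 := by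
    simp only [dxx, dx, mean]; ring
  have hmy : dyy (m.h₂ P) (mean u n) i j
      = (dyy (m.h₂ P) (u n) i j + dyy (m.h₂ P) (u (n - 1)) i j) / 2 := by
    simp only [dyy, dy, mean]; ring
  have hμd : m.Δβ * ((∑ l ∈ Finset.Icc 1 m.K,
      P.p (m.β l) * (1 / (m.τ P ^ m.β l * Real.Gamma (3 - m.β l)))) * (u n i j - u (n - 1) i j))
      = m.μ P * (u n i j - u (n - 1) i j) := by
    rw [Mesh.μ]; ring
  rw [Finset.sum_congr rfl hmem, Finset.sum_sub_distrib, ← Finset.sum_mul, mul_sub, hμd, hdd,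
    hmx, hmy]
  linarith

/-! ### Truncation errors -/

theorem Mesh.x_succ (m : Mesh) (i : ℕ) : m.x P (i + 1) = m.x P i + m.h₁ P := by
  rw [Mesh.x, Mesh.x]; push_cast; ring

theorem Mesh.y_succ (m : Mesh) (j : ℕ) : m.y P (j + 1) = m.y P j + m.h₂ P := by
  rw [Mesh.y, Mesh.y]; push_cast; ring

theorem Mesh.t_succ (m : Mesh) (n : ℕ) : m.t P (n + 1) = m.t P n + m.τ P := by
  rw [Mesh.t, Mesh.t]; push_cast; ring

theorem Data.Admissible.x_mem (hP : P.Admissible) (m : Mesh) {i : ℕ} (hi : i ≤ m.M₁) :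
    m.x P i ∈ Icc 0 P.L₁ := by
  have h := (hP.h₁_pos m).le
  rw [← m.M₁_mul_h₁]
  exact ⟨mul_nonneg (Nat.cast_nonneg _) h, mul_le_mul_of_nonneg_right (by exact_mod_cast hi) h⟩

theorem Data.Admissible.y_mem (hP : P.Admissible) (m : Mesh) {j : ℕ} (hj : j ≤ m.M₂) :
    m.y P j ∈ Icc 0 P.L₂ := by
  have h := (hP.h₂_pos m).le
  rw [← m.M₂_mul_h₂]
  exact ⟨mul_nonneg (Nat.cast_nonneg _) h, mul_le_mul_of_nonneg_right (by exact_mod_cast hj) h⟩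

theorem Data.Admissible.t_mem (hP : P.Admissible) (m : Mesh) {n : ℕ} (hn : n ≤ m.N) :
    m.t P n ∈ Icc 0 P.T := by
  have h := (hP.τ_pos m).le
  rw [← m.N_mul_τ]
  exact ⟨mul_nonneg (Nat.cast_nonneg _) h, mul_le_mul_of_nonneg_right (by exact_mod_cast hn) h⟩

theorem Data.Admissible.node_mem (hP : P.Admissible) (m : Mesh) {i j : ℕ} (h : m.Interior i j) :
    (m.x P i, m.y P j) ∈ P.Ω := by
  obtain ⟨h1, h2, h3, h4⟩ := h
  have hh₁ := hP.h₁_pos m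
  have hh₂ := hP.h₂_pos m
  refine ⟨⟨mul_pos (by exact_mod_cast h1) hh₁, ?_⟩, ⟨mul_pos (by exact_mod_cast h3) hh₂, ?_⟩⟩
  · rw [← m.M₁_mul_h₁]
    exact mul_lt_mul_of_pos_right (by exact_mod_cast h2) hh₁
  · rw [← m.M₂_mul_h₂]
    exact mul_lt_mul_of_pos_right (by exact_mod_cast h4) hh₂

theorem Data.Admissible.boundary_node_mem (hP : P.Admissible) (m : Mesh) {i j : ℕ}
    (h : m.Boundary i j) : (m.x P i, m.y P j) ∈ frontier P.Ω := by
  obtain ⟨hi, hj, h⟩ := h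
  have hx := hP.x_mem m hi
  have hy := hP.y_mem m hj
  rw [Data.Ω, frontier_prod_eq, frontier_Ioo hP.L₁_pos, frontier_Ioo hP.L₂_pos,
    closure_Ioo hP.L₁_pos.ne, closure_Ioo hP.L₂_pos.ne]
  rcases h with rfl | rfl | rfl | rfl
  · exact Or.inr ⟨by simp [Mesh.x], hy⟩
  · exact Or.inr ⟨by simp [Mesh.x, m.M₁_mul_h₁], hy⟩
  · exact Or.inl ⟨hx, by simp [Mesh.y]⟩
  · exact Or.inl ⟨hx, by simp [Mesh.y, m.M₂_mul_h₂]⟩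

theorem dxx_eq (h : ℝ) (v : ℕ → ℕ → ℝ) (i j : ℕ) :
    dxx h v i j = (v (i + 1) j - 2 * v i j + v (i - 1) j) / h ^ 2 := by
  simp only [dxx, dx, Nat.add_sub_cancel]
  ring

theorem dyy_eq (h : ℝ) (v : ℕ → ℕ → ℝ) (i j : ℕ) :
    dyy h v i j = (v i (j + 1) - 2 * v i j + v i (j - 1)) / h ^ 2 := by
  simp only [dyy, dy, Nat.add_sub_cancel]
  ring

/-- The restriction of a function to the grid. -/
def Mesh.restrict (m : Mesh) (P : Data) (F : ℝ → ℝ → ℝ → ℝ) : GridFun :=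
  fun n i j => F (m.x P i) (m.y P j) (m.t P n)

section Truncation

variable {D : ℕ → ℕ → ℕ → ℝ → ℝ → ℝ → ℝ} {M : ℝ} {m : Mesh} {n i j : ℕ}

theorem Mesh.x_pred {m : Mesh} {i : ℕ} (hi : 1 ≤ i) : m.x P (i - 1) = m.x P i - m.h₁ P := by
  obtain ⟨k, rfl⟩ := Nat.exists_eq_add_of_le' hi
  rw [Nat.add_sub_cancel, m.x_succ]; ring

theorem Mesh.y_pred {m : Mesh} {j : ℕ} (hj : 1 ≤ j) : m.y P (j - 1) = m.y P j - m.h₂ P := by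
  obtain ⟨k, rfl⟩ := Nat.exists_eq_add_of_le' hj
  rw [Nat.add_sub_cancel, m.y_succ]; ring

theorem IsDerivFamily.abs_dxx_sub_le (hP : P.Admissible) (hD : IsDerivFamily P.L₁ P.L₂ P.T D)
    (hM : ∀ a b c, a ≤ 4 → b ≤ 4 → c ≤ 3 →
      ∀ x y t, (x, y, t) ∈ box P.L₁ P.L₂ P.T → |D a b c x y t| ≤ M)
    (hij : m.Interior i j) (hn : n ≤ m.N) :
    |dxx (m.h₁ P) (m.restrict P (D 0 0 0) n) i j - m.restrict P (D 2 0 0) n i j|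
      ≤ 2 * M * m.h₁ P ^ 2 := by
  obtain ⟨h1, h2, h3, h4⟩ := hij
  have hh := hP.h₁_pos m
  have hy := hP.y_mem m h4.le
  have ht := hP.t_mem m hn
  have hd : ∀ a, a < 4 → ∀ z ∈ Icc 0 P.L₁, HasDerivWithinAt
      (fun s => D a 0 0 s (m.y P j) (m.t P n)) (D (a + 1) 0 0 z (m.y P j) (m.t P n))
      (Icc 0 P.L₁) z :=
    fun a ha z hz => hD.hx a 0 0 ha (by omega) (by omega) z _ _ ⟨hz, hy, ht⟩
  have h := abs_second_diff_sub_le hh.le (hd 0 (by omega)) (hd 1 (by omega)) (hd 2 (by omega))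
    (hd 3 (by omega))
    (fun z hz => hM 4 0 0 (by omega) (by omega) (by omega) z _ _ ⟨hz, hy, ht⟩)
    (x := m.x P i) (by rw [← Mesh.x_pred h1]; exact (hP.x_mem m (by omega)).1)
    (by rw [← Mesh.x_succ]; exact (hP.x_mem m h2).2)
  rw [dxx_eq]
  simp only [Mesh.restrict]
  rw [m.x_succ, Mesh.x_pred h1]
  set X := D 0 0 0 (m.x P i + m.h₁ P) (m.y P j) (m.t P n)
      - 2 * D 0 0 0 (m.x P i) (m.y P j) (m.t P n)
      + D 0 0 0 (m.x P i - m.h₁ P) (m.y P j) (m.t P n)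
  have e : X / m.h₁ P ^ 2 - D 2 0 0 (m.x P i) (m.y P j) (m.t P n)
      = (X - m.h₁ P ^ 2 * D 2 0 0 (m.x P i) (m.y P j) (m.t P n)) / m.h₁ P ^ 2 := by
    field_simp
  rw [e, abs_div, abs_of_pos (pow_pos hh 2), div_le_iff₀ (pow_pos hh 2)]
  exact h.trans (le_of_eq (by ring))

theorem IsDerivFamily.abs_dyy_sub_le (hP : P.Admissible) (hD : IsDerivFamily P.L₁ P.L₂ P.T D)
    (hM : ∀ a b c, a ≤ 4 → b ≤ 4 → c ≤ 3 →
      ∀ x y t, (x, y, t) ∈ box P.L₁ P.L₂ P.T → |D a b c x y t| ≤ M)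
    (hij : m.Interior i j) (hn : n ≤ m.N) :
    |dyy (m.h₂ P) (m.restrict P (D 0 0 0) n) i j - m.restrict P (D 0 2 0) n i j|
      ≤ 2 * M * m.h₂ P ^ 2 := by
  obtain ⟨h1, h2, h3, h4⟩ := hij
  have hh := hP.h₂_pos m
  have hx := hP.x_mem m h2.le
  have ht := hP.t_mem m hn
  have hd : ∀ b, b < 4 → ∀ z ∈ Icc 0 P.L₂, HasDerivWithinAt
      (fun s => D 0 b 0 (m.x P i) s (m.t P n)) (D 0 (b + 1) 0 (m.x P i) z (m.t P n))
      (Icc 0 P.L₂) z :=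
    fun b hb z hz => hD.hy 0 b 0 (by omega) hb (by omega) _ z _ ⟨hx, hz, ht⟩
  have h := abs_second_diff_sub_le hh.le (hd 0 (by omega)) (hd 1 (by omega)) (hd 2 (by omega))
    (hd 3 (by omega))
    (fun z hz => hM 0 4 0 (by omega) (by omega) (by omega) _ z _ ⟨hx, hz, ht⟩)
    (x := m.y P j) (by rw [← Mesh.y_pred h3]; exact (hP.y_mem m (by omega)).1)
    (by rw [← Mesh.y_succ]; exact (hP.y_mem m h4).2)
  rw [dyy_eq]
  simp only [Mesh.restrict]
  rw [m.y_succ, Mesh.y_pred h3]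
  set X := D 0 0 0 (m.x P i) (m.y P j + m.h₂ P) (m.t P n)
      - 2 * D 0 0 0 (m.x P i) (m.y P j) (m.t P n)
      + D 0 0 0 (m.x P i) (m.y P j - m.h₂ P) (m.t P n)
  have e : X / m.h₂ P ^ 2 - D 0 2 0 (m.x P i) (m.y P j) (m.t P n)
      = (X - m.h₂ P ^ 2 * D 0 2 0 (m.x P i) (m.y P j) (m.t P n)) / m.h₂ P ^ 2 := by
    field_simp
  rw [e, abs_div, abs_of_pos (pow_pos hh 2), div_le_iff₀ (pow_pos hh 2)]
  exact h.trans (le_of_eq (by ring))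

theorem IsDerivFamily.abs_time_diff_le (hP : P.Admissible) (hD : IsDerivFamily P.L₁ P.L₂ P.T D)
    (hM : ∀ a b c, a ≤ 4 → b ≤ 4 → c ≤ 3 →
      ∀ x y t, (x, y, t) ∈ box P.L₁ P.L₂ P.T → |D a b c x y t| ≤ M)
    {a b : ℕ} (ha : a ≤ 4) (hb : b ≤ 4) {x y : ℝ} (hx : x ∈ Icc 0 P.L₁) (hy : y ∈ Icc 0 P.L₂)
    (hn : n + 1 ≤ m.N) :
    |D a b 0 x y (m.t P (n + 1)) - D a b 0 x y (m.t P n)| ≤ M * m.τ P := by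
  have h := abs_sub_le_of_deriv (F := D a b 0 x y) (F₁ := D a b 1 x y)
    (fun z hz => hD.ht a b 0 ha hb (by omega) x y z ⟨hx, hy, hz⟩)
    (fun z hz => hM a b 1 ha hb (by omega) x y z ⟨hx, hy, hz⟩)
    (hP.t_mem m (show n ≤ m.N by omega)) (hP.t_mem m hn)
  rw [m.t_succ] at h ⊢
  rwa [add_sub_cancel_left, abs_of_pos (hP.τ_pos m)] at h

/-- The mean value inequality in `t` and the second-difference bound in each space variable reduce
this to the derivative `D 2 2 1`; each space direction costs a factor `2`. -/
theorem IsDerivFamily.abs_dxx_dyy_dt_le (hP : P.Admissible) (hD : IsDerivFamily P.L₁ P.L₂ P.T D)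
    (hM : ∀ a b c, a ≤ 4 → b ≤ 4 → c ≤ 3 →
      ∀ x y t, (x, y, t) ∈ box P.L₁ P.L₂ P.T → |D a b c x y t| ≤ M)
    (hij : m.Interior i j) (hn : n + 1 ≤ m.N) :
    |dxx (m.h₁ P) (dyy (m.h₂ P) (dt (m.τ P) (m.restrict P (D 0 0 0)) (n + 1))) i j| ≤ 4 * M := by
  obtain ⟨h1, h2, h3, h4⟩ := hij
  have hh₁ := hP.h₁_pos m
  have hh₂ := hP.h₂_pos m
  have hτ := hP.τ_pos m
  have ht := hP.t_mem m hn
  have ht' := hP.t_mem m (show n ≤ m.N by omega)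
  have hy := hP.y_mem m h4.le
  have hyp : m.y P j + m.h₂ P ∈ Icc 0 P.L₂ := by
    rw [← m.y_succ]; exact hP.y_mem m h4
  have hym : m.y P j - m.h₂ P ∈ Icc 0 P.L₂ := by
    rw [← Mesh.y_pred h3]; exact hP.y_mem m (by omega)
  set H : ℕ → ℝ → ℝ → ℝ := fun a z y => D a 0 0 z y (m.t P (n + 1)) - D a 0 0 z y (m.t P n)
  have hH : ∀ a, a < 4 → ∀ y ∈ Icc 0 P.L₂, ∀ z ∈ Icc 0 P.L₁,
      HasDerivWithinAt (fun s => H a s y) (H (a + 1) z y) (Icc 0 P.L₁) z :=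
    fun a ha y hy z hz =>
      (hD.hx a 0 0 ha (by omega) (by omega) z y _ ⟨hz, hy, ht⟩).sub
        (hD.hx a 0 0 ha (by omega) (by omega) z y _ ⟨hz, hy, ht'⟩)
  have hy2 : ∀ z ∈ Icc 0 P.L₁, |H 2 z (m.y P j + m.h₂ P) - 2 * H 2 z (m.y P j)
      + H 2 z (m.y P j - m.h₂ P)| ≤ 2 * (M * m.τ P) * m.h₂ P ^ 2 := by
    intro z hz
    exact abs_second_diff_le (F := fun s => H 2 z s)
      (F₁ := fun s => D 2 1 0 z s (m.t P (n + 1)) - D 2 1 0 z s (m.t P n))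
      (F₂ := fun s => D 2 2 0 z s (m.t P (n + 1)) - D 2 2 0 z s (m.t P n)) hh₂.le
      (fun s hs => (hD.hy 2 0 0 (by omega) (by omega) (by omega) z s _ ⟨hz, hs, ht⟩).sub
        (hD.hy 2 0 0 (by omega) (by omega) (by omega) z s _ ⟨hz, hs, ht'⟩))
      (fun s hs => (hD.hy 2 1 0 (by omega) (by omega) (by omega) z s _ ⟨hz, hs, ht⟩).sub
        (hD.hy 2 1 0 (by omega) (by omega) (by omega) z s _ ⟨hz, hs, ht'⟩))
      (fun s hs => hD.abs_time_diff_le hP hM (by omega) (by omega) hz hs hn) hym.1 hyp.2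
  have hG : ∀ a, a < 4 → ∀ z ∈ Icc 0 P.L₁, HasDerivWithinAt
      (fun s => H a s (m.y P j + m.h₂ P) - 2 * H a s (m.y P j) + H a s (m.y P j - m.h₂ P))
      (H (a + 1) z (m.y P j + m.h₂ P) - 2 * H (a + 1) z (m.y P j)
        + H (a + 1) z (m.y P j - m.h₂ P)) (Icc 0 P.L₁) z :=
    fun a ha z hz => ((hH a ha _ hyp z hz).sub ((hH a ha _ hy z hz).const_mul 2)).add
      (hH a ha _ hym z hz)
  have h := abs_second_diff_le hh₁.le (hG 0 (by omega)) (hG 1 (by omega)) hy2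
    (x := m.x P i) (by rw [← Mesh.x_pred h1]; exact (hP.x_mem m (by omega)).1)
    (by rw [← Mesh.x_succ]; exact (hP.x_mem m h2).2)
  have hp : 0 < m.τ P * m.h₂ P ^ 2 * m.h₁ P ^ 2 := by positivity
  have e : dxx (m.h₁ P) (dyy (m.h₂ P) (dt (m.τ P) (m.restrict P (D 0 0 0)) (n + 1))) i j
      = (H 0 (m.x P i + m.h₁ P) (m.y P j + m.h₂ P) - 2 * H 0 (m.x P i + m.h₁ P) (m.y P j)
          + H 0 (m.x P i + m.h₁ P) (m.y P j - m.h₂ P)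
        - 2 * (H 0 (m.x P i) (m.y P j + m.h₂ P) - 2 * H 0 (m.x P i) (m.y P j)
          + H 0 (m.x P i) (m.y P j - m.h₂ P))
        + (H 0 (m.x P i - m.h₁ P) (m.y P j + m.h₂ P) - 2 * H 0 (m.x P i - m.h₁ P) (m.y P j)
          + H 0 (m.x P i - m.h₁ P) (m.y P j - m.h₂ P)))
        / (m.τ P * m.h₂ P ^ 2 * m.h₁ P ^ 2) := by
    simp only [dxx_eq, dyy_eq, dt, Mesh.restrict, Nat.add_sub_cancel, m.x_succ, m.y_succ,
      Mesh.x_pred h1, Mesh.y_pred h3, H]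
    field_simp
  rw [e, abs_div, abs_of_pos hp, div_le_iff₀ hp]
  exact h.trans (le_of_eq (by ring))

/-- The comparison is with the lower level `n`, where the source is evaluated; shifting from the
half level costs only `O(τ)`. -/
theorem IsDerivFamily.abs_laplace_mean_sub_le (hP : P.Admissible)
    (hD : IsDerivFamily P.L₁ P.L₂ P.T D)
    (hM : ∀ a b c, a ≤ 4 → b ≤ 4 → c ≤ 3 →
      ∀ x y t, (x, y, t) ∈ box P.L₁ P.L₂ P.T → |D a b c x y t| ≤ M)
    (hij : m.Interior i j) (hn : n + 1 ≤ m.N) :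
    |dxx (m.h₁ P) (mean (m.restrict P (D 0 0 0)) (n + 1)) i j
        + dyy (m.h₂ P) (mean (m.restrict P (D 0 0 0)) (n + 1)) i j
        - (m.restrict P (D 2 0 0) n i j + m.restrict P (D 0 2 0) n i j)|
      ≤ 2 * M * m.h₁ P ^ 2 + 2 * M * m.h₂ P ^ 2 + M * m.τ P := by
  have hx := hP.x_mem m hij.2.1.le
  have hy := hP.y_mem m hij.2.2.2.le
  have x1 := hD.abs_dxx_sub_le hP hM hij hn
  have x0 := hD.abs_dxx_sub_le hP hM hij (show n ≤ m.N by omega)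
  have y1 := hD.abs_dyy_sub_le hP hM hij hn
  have y0 := hD.abs_dyy_sub_le hP hM hij (show n ≤ m.N by omega)
  have tx : |m.restrict P (D 2 0 0) (n + 1) i j - m.restrict P (D 2 0 0) n i j| ≤ M * m.τ P :=
    hD.abs_time_diff_le hP hM (by omega) (by omega) hx hy hn
  have ty : |m.restrict P (D 0 2 0) (n + 1) i j - m.restrict P (D 0 2 0) n i j| ≤ M * m.τ P :=
    hD.abs_time_diff_le hP hM (by omega) (by omega) hx hy hn
  have ex : dxx (m.h₁ P) (mean (m.restrict P (D 0 0 0)) (n + 1)) i j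
      = (dxx (m.h₁ P) (m.restrict P (D 0 0 0) (n + 1)) i j
        + dxx (m.h₁ P) (m.restrict P (D 0 0 0) n) i j) / 2 := by
    simp only [dxx, dx, mean, Nat.add_sub_cancel]; ring
  have ey : dyy (m.h₂ P) (mean (m.restrict P (D 0 0 0)) (n + 1)) i j
      = (dyy (m.h₂ P) (m.restrict P (D 0 0 0) (n + 1)) i j
        + dyy (m.h₂ P) (m.restrict P (D 0 0 0) n) i j) / 2 := by
    simp only [dyy, dy, mean, Nat.add_sub_cancel]; ring
  rw [ex, ey]
  rw [abs_le] at *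
  constructor <;> linarith [x1.1, x1.2, x0.1, x0.2, y1.1, y1.2, y0.1, y0.2, tx.1, tx.2, ty.1, ty.2]

end Truncation

/-! ### Consistency of the memory term -/

/-- The discrete memory term in terms of the memory weights. -/
theorem Mesh.memory_eq (m : Mesh) (w : ℕ → ℝ) (n : ℕ) (ψ : ℝ) :
    m.Δβ * ∑ l ∈ Finset.Icc 1 m.K,
        P.p (m.β l) * (m.τ P ^ (1 - m.β l) / Real.Gamma (3 - m.β l)) *
          (coeff (m.β l) 0 * w n
            - ∑ k ∈ Finset.Ico 1 n,
                (coeff (m.β l) (n - k - 1) - coeff (m.β l) (n - k)) * w k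
            - coeff (m.β l) (n - 1) * ψ)
    = m.weight P 0 * w n
        - ∑ k ∈ Finset.Ico 1 n, (m.weight P (n - k - 1) - m.weight P (n - k)) * w k
        - m.weight P (n - 1) * ψ := by
  have h : ∑ k ∈ Finset.Ico 1 n, (m.weight P (n - k - 1) - m.weight P (n - k)) * w k
      = m.Δβ * ∑ l ∈ Finset.Icc 1 m.K,
        P.p (m.β l) * (m.τ P ^ (1 - m.β l) / Real.Gamma (3 - m.β l)) *
          ∑ k ∈ Finset.Ico 1 n, (coeff (m.β l) (n - k - 1) - coeff (m.β l) (n - k)) * w k := by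
    simp only [Finset.mul_sum]
    rw [Finset.sum_comm]
    refine Finset.sum_congr rfl fun k _ => ?_
    rw [Mesh.weight, Mesh.weight, ← mul_sub, ← Finset.sum_sub_distrib, mul_assoc, Finset.sum_mul,
      Finset.mul_sum]
    refine Finset.sum_congr rfl fun l _ => ?_
    ring
  rw [h]
  simp only [mul_sub, Finset.sum_sub_distrib, Mesh.weight]
  congr 1
  · congr 1
    rw [mul_assoc, Finset.sum_mul]
    simp only [mul_assoc]
  · rw [mul_assoc, Finset.sum_mul]
    simp only [mul_assoc]

/-- Consistency of the distributed-order memory term. -/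
theorem Data.Admissible.exists_memory_consistency (hP : P.Admissible) {M : ℝ} (hM0 : 0 ≤ M) :
    ∃ A : ℝ, 0 ≤ A ∧ ∀ (m : Mesh) (v v' g g' : ℝ → ℝ),
      (∀ t ∈ Icc 0 P.T, HasDerivWithinAt v (v' t) (Icc 0 P.T) t) →
      (∀ t ∈ Icc 0 P.T, HasDerivWithinAt v' (g t) (Icc 0 P.T) t) →
      (∀ t ∈ Icc 0 P.T, HasDerivWithinAt g (g' t) (Icc 0 P.T) t) →
      ContinuousOn g' (Icc 0 P.T) →
      (∀ t ∈ Icc 0 P.T, |g t| ≤ M) → (∀ t ∈ Icc 0 P.T, |g' t| ≤ M) →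
      ∀ w : ℕ → ℝ, (∀ k, w (k + 1) = (v (m.t P (k + 1)) - v (m.t P k)) / m.τ P) →
      ∀ n, n + 1 ≤ m.N →
      |m.weight P 0 * w (n + 1)
          - ∑ k ∈ Finset.Ico 1 (n + 1),
              (m.weight P (n + 1 - k - 1) - m.weight P (n + 1 - k)) * w k
          - m.weight P n * v' 0 - ∫ β in (1 : ℝ)..2, P.p β * frac g β (m.t P n)|
        ≤ M * m.τ P * m.weight P n
          + A * (m.τ P + m.Δβ ^ 2 * (m.t P n) ^ (-(1 / 4) : ℝ)) := by
  obtain ⟨q₀, q₁, hq₀, hq₁, hq⟩ := hP.exists_q_bounds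
  obtain ⟨A, hA, hmid⟩ := hP.exists_midpoint_frac hM0
  have hT := hP.T_pos
  refine ⟨3 * M * (q₁ * (1 + P.T)) + A, by positivity,
    fun m v v' g g' hv hv' hg hg'c hM hM' w hw n hn => ?_⟩
  have hτ := hP.τ_pos m
  have ht := hP.t_mem m (show n ≤ m.N by omega)
  have hθ := Real.rpow_nonneg ht.1 (-(1 / 4) : ℝ)
  have h1 : |m.Δβ * ∑ l ∈ Finset.Icc 1 m.K, P.p (m.β l) * frac g (m.β l) (m.t P n)
      - ∫ β in (1 : ℝ)..2, P.p β * frac g β (m.t P n)|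
      ≤ A * (m.t P n) ^ (-(1 / 4) : ℝ) * m.Δβ ^ 2 := by
    rcases ht.1.eq_or_lt with h0 | h0
    -- At time `0` the fractional integrals run over a degenerate interval, so the left side
    -- vanishes.
    · rw [← h0] at hθ ⊢
      simp only [frac, intervalIntegral.integral_same, mul_zero, Finset.sum_const_zero,
        intervalIntegral.integral_zero, sub_zero, abs_zero]
      positivity
    · exact hmid m g g' hg hg'c hM hM' _ ⟨h0, ht.2⟩
  have hmem := m.memory_eq (P := P) w (n + 1) (v' 0)
  rw [Nat.add_sub_cancel] at hmem
  rw [← hmem]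
  set Y : ℕ → ℝ := fun l => m.τ P ^ (1 - m.β l) / Real.Gamma (3 - m.β l) *
    (coeff (m.β l) 0 * w (n + 1) - ∑ k ∈ Finset.Ico 1 (n + 1),
      (coeff (m.β l) (n + 1 - k - 1) - coeff (m.β l) (n + 1 - k)) * w k
      - coeff (m.β l) n * v' 0) with hY
  have h2 : |m.Δβ * ∑ l ∈ Finset.Icc 1 m.K, P.p (m.β l) * Y l
      - m.Δβ * ∑ l ∈ Finset.Icc 1 m.K, P.p (m.β l) * frac g (m.β l) (m.t P n)|
      ≤ M * m.τ P * m.weight P n + 3 * M * m.τ P * (q₁ * (1 + P.T)) := by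
    rw [← mul_sub, ← Finset.sum_sub_distrib, abs_mul, abs_of_pos m.Δβ_pos]
    have hl : ∀ l ∈ Finset.Icc 1 m.K,
        |P.p (m.β l) * Y l - P.p (m.β l) * frac g (m.β l) (m.t P n)|
        ≤ M * m.τ P * (P.q (m.β l) * (m.τ P ^ (1 - m.β l) * coeff (m.β l) n))
          + 3 * M * m.τ P * (P.q (m.β l) * (m.t P n) ^ (2 - m.β l)) := by
      intro l hl
      have hβ := m.β_mem hl
      have hp := (hP.p_pos (m.β l) ⟨hβ.1.le, hβ.2.le⟩).le
      have h := abs_memory_sub_frac_le hβ.2 hτ hv hv' hg hM hM' (m := n) (w := w)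
        (by exact (hP.t_mem m hn).2) hw
      rw [← mul_sub, abs_mul, abs_of_nonneg hp]
      refine (mul_le_mul_of_nonneg_left h hp).trans (le_of_eq ?_)
      -- Splitting off one factor `τ` turns `fracCoeff` into `τ` times a summand of the memory
      -- weight.
      rw [fracCoeff, Data.q, show 2 - m.β l = 1 + (1 - m.β l) by ring, Real.rpow_add hτ,
        Real.rpow_one, Mesh.t]
      ring
    refine (mul_le_mul_of_nonneg_left ((Finset.abs_sum_le_sum_abs _ _).trans
      (Finset.sum_le_sum hl)) m.Δβ_pos.le).trans ?_
    rw [Finset.sum_add_distrib, ← Finset.mul_sum, ← Finset.mul_sum, mul_add,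
      mul_left_comm, ← m.weight_eq, mul_left_comm m.Δβ]
    have h3 : m.Δβ * ∑ l ∈ Finset.Icc 1 m.K, P.q (m.β l) * (m.t P n) ^ (2 - m.β l)
        ≤ q₁ * (1 + P.T) := by
      refine m.Δβ_mul_sum_le (g := fun β => P.q β * (m.t P n) ^ (2 - β)) fun β hβ => ?_
      refine mul_le_mul (hq β ⟨hβ.1.le, hβ.2.le⟩).2 ?_ (Real.rpow_nonneg ht.1 _) hq₁.le
      have := rpow_le_one_add (γ := 2 - β) ht.1 (by linarith [hβ.2]) (by linarith [hβ.1])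
      linarith [ht.2]
    gcongr
  have h4 : ∑ l ∈ Finset.Icc 1 m.K, P.p (m.β l) * Y l = ∑ l ∈ Finset.Icc 1 m.K,
      P.p (m.β l) * (m.τ P ^ (1 - m.β l) / Real.Gamma (3 - m.β l)) *
          (coeff (m.β l) 0 * w (n + 1)
            - ∑ k ∈ Finset.Ico 1 (n + 1),
                (coeff (m.β l) (n + 1 - k - 1) - coeff (m.β l) (n + 1 - k)) * w k
            - coeff (m.β l) n * v' 0) :=
    Finset.sum_congr rfl fun l _ => by rw [hY]; ring
  rw [← h4]
  have hs : 0 ≤ 3 * M * (q₁ * (1 + P.T)) * (m.Δβ ^ 2 * (m.t P n) ^ (-(1 / 4) : ℝ)) := by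
    positivity
  have hs' : 0 ≤ A * m.τ P := by positivity
  refine (abs_sub_le _ _ _).trans ((add_le_add h2 h1).trans ?_)
  nlinarith

/-- The summand is `t ^ (-1/2)`, compared with the increments of `2 √t`: with `τ = a² - b²`, the
claim `τ / a ≤ 2 (a - b)` is `(a - b)² ≥ 0`. The term `k = 0` vanishes because `0 ^ (-1/4)` is `0`
by convention. -/
theorem sum_rpow_sq_le {τ : ℝ} (hτ : 0 < τ) (n : ℕ) :
    τ * ∑ k ∈ Finset.range (n + 1), (((k : ℝ) * τ) ^ (-(1 / 4) : ℝ)) ^ 2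
      ≤ 2 * Real.sqrt (n * τ) := by
  induction n with
  | zero => simp [Real.zero_rpow]
  | succ n ih =>
    rw [Finset.sum_range_succ, mul_add]
    have hs : 0 < ((n + 1 : ℕ) : ℝ) * τ := by positivity
    set a := Real.sqrt (((n + 1 : ℕ) : ℝ) * τ) with ha
    set b := Real.sqrt ((n : ℝ) * τ) with hb
    have ha0 : 0 < a := Real.sqrt_pos.2 hs
    have hb0 : 0 ≤ b := Real.sqrt_nonneg _
    have ha2 : a ^ 2 = ((n + 1 : ℕ) : ℝ) * τ := Real.sq_sqrt hs.le
    have hb2 : b ^ 2 = (n : ℝ) * τ := Real.sq_sqrt (by positivity)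
    have hab : τ = a ^ 2 - b ^ 2 := by rw [ha2, hb2]; push_cast; ring
    have hle : b ≤ a := by nlinarith
    have e : ((((n + 1 : ℕ) : ℝ) * τ) ^ (-(1 / 4) : ℝ)) ^ 2 = a⁻¹ := by
      rw [← Real.rpow_natCast, ← Real.rpow_mul hs.le, ha, Real.sqrt_eq_rpow,
        ← Real.rpow_neg hs.le]
      norm_num
    rw [e]
    have : τ * a⁻¹ ≤ 2 * a - 2 * b := by
      rw [← div_eq_mul_inv, div_le_iff₀ ha0]
      nlinarith [mul_nonneg (sub_nonneg.2 hle) (sub_nonneg.2 hle)]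
    linarith

/-- The boundary condition is imposed for `t < T`, but the scheme uses `φ` at `T` too; continuity of
both sides closes the interval. -/
theorem IsSolution.boundary_closed {U : ℝ → ℝ → ℝ → ℝ} {D : ℕ → ℕ → ℕ → ℝ → ℝ → ℝ → ℝ}
    (hU : IsSolution P U) (hP : P.Admissible) (hD : IsDerivFamily P.L₁ P.L₂ P.T D)
    (hDU : ∀ x y t, (x, y, t) ∈ box P.L₁ P.L₂ P.T → D 0 0 0 x y t = U x y t)
    {x y t : ℝ} (hx : x ∈ Icc 0 P.L₁) (hy : y ∈ Icc 0 P.L₂) (hxy : (x, y) ∈ frontier P.Ω)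
    (ht : t ∈ Icc 0 P.T) : D 0 0 0 x y t = P.φ x y t := by
  have hT := hP.T_pos
  have hlt : ∀ t ∈ Ico 0 P.T, D 0 0 0 x y t = P.φ x y t := fun t ht => by
    rw [hDU x y t ⟨hx, hy, ht.1, ht.2.le⟩, hU.boundary x y t hxy ht]
  rcases ht.2.lt_or_eq with h | rfl
  · exact hlt t ⟨ht.1, h⟩
  have hc1 : ContinuousOn (D 0 0 0 x y) (Icc 0 P.T) :=
    (hD.cont 0 0 0 (by omega) (by omega) (by omega)).comp (f := fun s : ℝ => (x, y, s))
      (by fun_prop) fun s hs => ⟨hx, hy, hs⟩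
  have hc2 : ContinuousOn (P.φ x y) (Icc 0 P.T) :=
    hP.φ_cont.comp (f := fun s : ℝ => ((x, y), s)) (by fun_prop) fun s hs => ⟨hxy, hs⟩
  have hle : 𝓝[<] P.T ≤ 𝓝[Icc 0 P.T] P.T :=
    nhdsWithin_le_of_mem (mem_of_superset (Ico_mem_nhdsLT hT) Ico_subset_Icc_self)
  exact tendsto_nhds_unique_of_eventuallyEq ((hc1 _ ht).tendsto.mono_left hle)
    ((hc2 _ ht).tendsto.mono_left hle) (mem_of_superset (Ico_mem_nhdsLT hT) hlt)

/-! ### The error estimate -/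

/-- The residual of the exact solution in the difference scheme. -/
theorem IsSolution.exists_residual_bound {U : ℝ → ℝ → ℝ → ℝ} {D : ℕ → ℕ → ℕ → ℝ → ℝ → ℝ → ℝ}
    (hU : IsSolution P U) (hP : P.Admissible) (hD : IsDerivFamily P.L₁ P.L₂ P.T D)
    (hDU : ∀ x y t, (x, y, t) ∈ box P.L₁ P.L₂ P.T → D 0 0 0 x y t = U x y t) :
    ∃ A B : ℝ, ∀ (m : Mesh) (n i j : ℕ), n + 1 ≤ m.N → m.Interior i j →
      |m.weight P 0 * dt (m.τ P) (m.restrict P (D 0 0 0)) (n + 1) i j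
          - ∑ k ∈ Finset.Ico 1 (n + 1), (m.weight P (n + 1 - k - 1) - m.weight P (n + 1 - k)) *
              dt (m.τ P) (m.restrict P (D 0 0 0)) k i j
          - m.weight P n * P.ψ₂ (m.x P i) (m.y P j)
          + m.τ P / (4 * m.μ P) *
            dxx (m.h₁ P) (dyy (m.h₂ P) (dt (m.τ P) (m.restrict P (D 0 0 0)) (n + 1))) i j
          - (dxx (m.h₁ P) (mean (m.restrict P (D 0 0 0)) (n + 1)) i j
            + dyy (m.h₂ P) (mean (m.restrict P (D 0 0 0)) (n + 1)) i j
            + P.f (m.x P i) (m.y P j) (m.t P n) (m.restrict P (D 0 0 0) n i j))|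
        ≤ A * ((m.τ P + m.h₁ P ^ 2 + m.h₂ P ^ 2 + m.Δβ ^ 2) *
            (1 + (m.t P n) ^ (-(1 / 4) : ℝ))) + B * m.τ P * m.weight P n := by
  obtain ⟨M, hM0, hM⟩ := hD.exists_bound
  obtain ⟨A, hA, hmem⟩ := hP.exists_memory_consistency hM0
  obtain ⟨c, hc, hcw⟩ := hP.exists_le_weight
  have hT := hP.T_pos
  refine ⟨A + P.T * M / c + 3 * M, M, fun m n i j hn hij => ?_⟩
  have hτ := hP.τ_pos m
  have hμ := hP.μ_pos m
  have hx := hP.x_mem m hij.2.1.le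
  have hy := hP.y_mem m hij.2.2.2.le
  have hΩ := hP.node_mem m hij
  have ht := hP.t_mem m (show n ≤ m.N by omega)
  have hθ := Real.rpow_nonneg ht.1 (-(1 / 4) : ℝ)
  have hψ : D 0 0 1 (m.x P i) (m.y P j) 0 = P.ψ₂ (m.x P i) (m.y P j) := by
    rw [← hU.initial_velocity _ _ hΩ]
    have h0 : (0 : ℝ) ∈ Icc 0 P.T := ⟨le_rfl, hT.le⟩
    refine (HasDerivWithinAt.derivWithin ?_ (uniqueDiffOn_Icc hT 0 h0)).symm
    exact (hD.ht 0 0 0 (by omega) (by omega) (by omega) _ _ 0 ⟨hx, hy, h0⟩).congr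
      (fun w hw => (hDU _ _ w ⟨hx, hy, hw⟩).symm) (hDU _ _ 0 ⟨hx, hy, h0⟩).symm
  have e1 := hmem m (D 0 0 0 (m.x P i) (m.y P j)) (D 0 0 1 (m.x P i) (m.y P j))
    (D 0 0 2 (m.x P i) (m.y P j)) (D 0 0 3 (m.x P i) (m.y P j))
    (fun t ht => hD.ht 0 0 0 (by omega) (by omega) (by omega) _ _ t ⟨hx, hy, ht⟩)
    (fun t ht => hD.ht 0 0 1 (by omega) (by omega) (by omega) _ _ t ⟨hx, hy, ht⟩)
    (fun t ht => hD.ht 0 0 2 (by omega) (by omega) (by omega) _ _ t ⟨hx, hy, ht⟩)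
    ((hD.cont 0 0 3 (by omega) (by omega) (by omega)).comp
      (f := fun s : ℝ => (m.x P i, m.y P j, s)) (by fun_prop) fun s hs => ⟨hx, hy, hs⟩)
    (fun t ht => hM 0 0 2 (by omega) (by omega) (by omega) _ _ t ⟨hx, hy, ht⟩)
    (fun t ht => hM 0 0 3 (by omega) (by omega) (by omega) _ _ t ⟨hx, hy, ht⟩)
    (fun k => dt (m.τ P) (m.restrict P (D 0 0 0)) k i j) (fun k => rfl) n hn
  rw [hψ, hU.equation_frac hP hD hDU hΩ ht] at e1
  have e2 : |m.τ P / (4 * m.μ P) *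
      dxx (m.h₁ P) (dyy (m.h₂ P) (dt (m.τ P) (m.restrict P (D 0 0 0)) (n + 1))) i j|
      ≤ P.T * M / c * m.τ P := by
    have h := hD.abs_dxx_dyy_dt_le hP hM hij hn
    have hw := hcw m 0 m.N_pos
    rw [← hP.τ_mul_μ] at hw
    have hτT : m.τ P ≤ P.T := by
      have := (hP.t_mem m (show 1 ≤ m.N by omega)).2
      simpa [Mesh.t] using this
    -- Since `τ μ ≥ c`, the perturbation is `O(τ²)`; one factor `τ ≤ T` is spent to write it as
    -- `O(τ)`.
    have h1 : m.τ P / m.μ P ≤ P.T / c * m.τ P := by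
      rw [div_le_iff₀ hμ, div_mul_eq_mul_div, div_mul_eq_mul_div, le_div_iff₀ hc]
      calc m.τ P * c ≤ m.τ P * (m.τ P * m.μ P) := by gcongr
        _ ≤ P.T * (m.τ P * m.μ P) := by gcongr
        _ = _ := by ring
    rw [abs_mul, abs_of_pos (by positivity)]
    calc _ ≤ m.τ P / (4 * m.μ P) * (4 * M) := by gcongr
      _ = m.τ P / m.μ P * M := by field_simp
      _ ≤ P.T / c * m.τ P * M := by gcongr
      _ = _ := by ring
  have e3 := hD.abs_laplace_mean_sub_le hP hM hij hn
  simp only [Mesh.restrict] at e3 e1 e2 ⊢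
  set θ := (m.t P n) ^ (-(1 / 4) : ℝ)
  set ε := m.τ P + m.h₁ P ^ 2 + m.h₂ P ^ 2 + m.Δβ ^ 2 with hε
  have hε0 : 0 ≤ ε := by positivity
  have s1 : A * (m.τ P + m.Δβ ^ 2 * θ) ≤ A * (ε * (1 + θ)) := by
    refine mul_le_mul_of_nonneg_left ?_ hA
    have h1 : m.Δβ ^ 2 * θ ≤ ε * θ := by
      refine mul_le_mul_of_nonneg_right ?_ hθ
      rw [hε]; linarith [sq_nonneg (m.h₁ P), sq_nonneg (m.h₂ P)]
    have h2 : m.τ P ≤ ε := by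
      rw [hε]; linarith [sq_nonneg (m.h₁ P), sq_nonneg (m.h₂ P), sq_nonneg m.Δβ]
    linarith
  have s2 : P.T * M / c * m.τ P ≤ P.T * M / c * (ε * (1 + θ)) := by
    refine mul_le_mul_of_nonneg_left ?_ (by positivity)
    have h1 := mul_nonneg hε0 hθ
    rw [mul_add, mul_one]
    rw [hε] at h1 ⊢; linarith [sq_nonneg (m.h₁ P), sq_nonneg (m.h₂ P), sq_nonneg m.Δβ]
  have s3 : 2 * M * m.h₁ P ^ 2 + 2 * M * m.h₂ P ^ 2 + M * m.τ P ≤ 3 * M * (ε * (1 + θ)) := by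
    have h1 := mul_nonneg hε0 hθ
    have h2 : 2 * m.h₁ P ^ 2 + 2 * m.h₂ P ^ 2 + m.τ P ≤ 3 * (ε * (1 + θ)) := by
      rw [mul_add, mul_one]
      rw [hε] at h1 ⊢; linarith [sq_nonneg (m.h₁ P), sq_nonneg (m.h₂ P), sq_nonneg m.Δβ]
    nlinarith
  have hB : (A + P.T * M / c + 3 * M) * (ε * (1 + θ))
      = A * (ε * (1 + θ)) + P.T * M / c * (ε * (1 + θ)) + 3 * M * (ε * (1 + θ)) := by ring
  rw [hB]
  rw [abs_le] at e1 e2 e3 ⊢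
  constructor <;> linarith [e1.1, e1.2, e2.1, e2.2, e3.1, e3.2]

theorem Mesh.interior_of_mem {m : Mesh} {i j : ℕ} (hi : i ∈ Finset.Ico 1 m.M₁)
    (hj : j ∈ Finset.Ico 1 m.M₂) : m.Interior i j :=
  ⟨(Finset.mem_Ico.1 hi).1, (Finset.mem_Ico.1 hi).2, (Finset.mem_Ico.1 hj).1,
    (Finset.mem_Ico.1 hj).2⟩

/-- The error of the difference scheme satisfies the error equation. -/
theorem IsSchemeSolution.isErrorGrid {U : ℝ → ℝ → ℝ → ℝ} {D : ℕ → ℕ → ℕ → ℝ → ℝ → ℝ → ℝ}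
    (hU : IsSolution P U) (hP : P.Admissible) (hD : IsDerivFamily P.L₁ P.L₂ P.T D)
    (hDU : ∀ x y t, (x, y, t) ∈ box P.L₁ P.L₂ P.T → D 0 0 0 x y t = U x y t)
    {m : Mesh} {u : GridFun} (hu : IsSchemeSolution P m u) :
    IsErrorGrid m.M₁ m.M₂ m.N (m.h₁ P) (m.h₂ P) (m.τ P) (m.τ P / (4 * m.μ P)) (m.weight P)
      (fun n i j =>
        (m.weight P 0 * dt (m.τ P) (m.restrict P (D 0 0 0)) n i j
          - ∑ k ∈ Finset.Ico 1 n, (m.weight P (n - k - 1) - m.weight P (n - k)) *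
              dt (m.τ P) (m.restrict P (D 0 0 0)) k i j
          - m.weight P (n - 1) * P.ψ₂ (m.x P i) (m.y P j)
          + m.τ P / (4 * m.μ P) *
            dxx (m.h₁ P) (dyy (m.h₂ P) (dt (m.τ P) (m.restrict P (D 0 0 0)) n)) i j
          - (dxx (m.h₁ P) (mean (m.restrict P (D 0 0 0)) n) i j
            + dyy (m.h₂ P) (mean (m.restrict P (D 0 0 0)) n) i j
            + P.f (m.x P i) (m.y P j) (m.t P (n - 1)) (m.restrict P (D 0 0 0) (n - 1) i j)))
        + (P.f (m.x P i) (m.y P j) (m.t P (n - 1)) (m.restrict P (D 0 0 0) (n - 1) i j)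
          - P.f (m.x P i) (m.y P j) (m.t P (n - 1)) (u (n - 1) i j)))
      (fun n i j => m.restrict P (D 0 0 0) n i j - u n i j) := by
  set V := m.restrict P (D 0 0 0) with hV
  have hbd : ∀ n i j, n ≤ m.N → m.Boundary i j → V n i j - u n i j = 0 := by
    intro n i j hn hij
    rw [hu.boundary n i j hn hij, sub_eq_zero]
    exact hU.boundary_closed hP hD hDU (hP.x_mem m hij.1) (hP.y_mem m hij.2.1)
      (hP.boundary_node_mem m hij) (hP.t_mem m hn)
  refine ⟨fun n i j hn hnN hi hj => ?_, fun i j hi hj => ?_,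
    fun n i j hn hi hj hij => hbd n i j hn ⟨hi, hj, hij⟩⟩
  · have h := hu.step n i j hn hnN (Mesh.interior_of_mem hi hj)
    rw [m.memory_eq (fun k => dt (m.τ P) u k i j)] at h
    have hdt : ∀ k, dt (m.τ P) (fun n i j => V n i j - u n i j) k i j
        = dt (m.τ P) V k i j - dt (m.τ P) u k i j := by
      intro k; simp only [dt]; ring
    have hdd : dxx (m.h₁ P) (dyy (m.h₂ P) (dt (m.τ P) (fun n i j => V n i j - u n i j) n)) i j
        = dxx (m.h₁ P) (dyy (m.h₂ P) (dt (m.τ P) V n)) i j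
          - dxx (m.h₁ P) (dyy (m.h₂ P) (dt (m.τ P) u n)) i j := by
      simp only [dxx, dx, dyy, dy, dt]; ring
    have hmx : dxx (m.h₁ P) (mean (fun n i j => V n i j - u n i j) n) i j
        = dxx (m.h₁ P) (mean V n) i j - dxx (m.h₁ P) (mean u n) i j := by
      simp only [dxx, dx, mean]; ring
    have hmy : dyy (m.h₂ P) (mean (fun n i j => V n i j - u n i j) n) i j
        = dyy (m.h₂ P) (mean V n) i j - dyy (m.h₂ P) (mean u n) i j := by
      simp only [dyy, dy, mean]; ring
    simp only [hdt, mul_sub, Finset.sum_sub_distrib]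
    rw [hdd, hmx, hmy]
    linarith
  · by_cases hij : m.Interior i j
    · have hΩ := hP.node_mem m hij
      simp only [hV, Mesh.restrict, Mesh.t, Nat.cast_zero, zero_mul]
      rw [hu.initial i j hij, hDU _ _ 0 (Data.mem_box hΩ ⟨le_rfl, hP.T_pos.le⟩),
        hU.initial _ _ hΩ, sub_self]
    -- Nodes that are not interior lie on the boundary, where the values at time `0` come from the
    -- boundary condition.
    · refine hbd 0 i j (Nat.zero_le _) ⟨hi, hj, ?_⟩
      simp only [Mesh.Interior] at hij
      omega

theorem Data.Admissible.exists_error_estimate (hP : P.Admissible) {U : ℝ → ℝ → ℝ → ℝ}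
    (hU : IsSolution P U) {D : ℕ → ℕ → ℕ → ℝ → ℝ → ℝ → ℝ} (hD : IsDerivFamily P.L₁ P.L₂ P.T D)
    (hDU : ∀ x y t, (x, y, t) ∈ box P.L₁ P.L₂ P.T → D 0 0 0 x y t = U x y t) :
    ∃ K : ℝ, 0 ≤ K ∧ ∀ (m : Mesh) (u : GridFun), IsSchemeSolution P m u → ∀ n ≤ m.N,
      ∑ s ∈ Finset.Ico 1 m.M₁ ×ˢ Finset.Ico 1 m.M₂,
          (m.restrict P (D 0 0 0) n s.1 s.2 - u n s.1 s.2) ^ 2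
        ≤ (Finset.Ico 1 m.M₁ ×ˢ Finset.Ico 1 m.M₂).card *
          (K * (m.τ P + m.h₁ P ^ 2 + m.h₂ P ^ 2 + m.Δβ ^ 2) ^ 2) := by
  obtain ⟨A, B, hres⟩ := hU.exists_residual_bound hP hD hDU
  obtain ⟨c, hc, hcw⟩ := hP.exists_le_weight
  obtain ⟨W, hW, hws⟩ := hP.exists_sum_weight_le
  obtain ⟨Lf, hLf, hlip⟩ := hP.f_lipschitz
  have hT := hP.T_pos
  refine ⟨2 * P.T / c * (4 / c * (2 * A ^ 2 * (P.T + 2 * Real.sqrt P.T)) + B ^ 2 * W)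
    * Real.exp (8 * P.T ^ 2 * Lf ^ 2 / c ^ 2), by positivity, fun m u hu n hn => ?_⟩
  have hτ := hP.τ_pos m
  have hμ := hP.μ_pos m
  set ε := m.τ P + m.h₁ P ^ 2 + m.h₂ P ^ 2 + m.Δβ ^ 2 with hε
  have hτε : m.τ P ≤ ε := by
    rw [hε]; linarith [sq_nonneg (m.h₁ P), sq_nonneg (m.h₂ P), sq_nonneg m.Δβ]
  set S : ℕ → ℝ := fun n => A * (ε * (1 + (m.t P (n - 1)) ^ (-(1 / 4) : ℝ))) with hS
  have hSb : m.τ P * ∑ k ∈ Finset.range m.N, S (k + 1) ^ 2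
      ≤ 2 * A ^ 2 * (P.T + 2 * Real.sqrt P.T) * ε ^ 2 := by
    have hterm : ∀ k ∈ Finset.range m.N, S (k + 1) ^ 2
        ≤ 2 * A ^ 2 * ε ^ 2 * (1 + (((k : ℝ) * m.τ P) ^ (-(1 / 4) : ℝ)) ^ 2) := by
      intro k _
      simp only [hS, Nat.add_sub_cancel, Mesh.t]
      set θ := ((k : ℝ) * m.τ P) ^ (-(1 / 4) : ℝ)
      calc (A * (ε * (1 + θ))) ^ 2 = A ^ 2 * ε ^ 2 * (1 + θ) ^ 2 := by ring
        _ ≤ A ^ 2 * ε ^ 2 * (2 * (1 + θ ^ 2)) := by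
          gcongr; nlinarith [sq_nonneg (1 - θ)]
        _ = _ := by ring
    have h1 := Finset.sum_le_sum hterm
    rw [← Finset.mul_sum, Finset.sum_add_distrib] at h1
    simp only [Finset.sum_const, Finset.card_range, nsmul_eq_mul, mul_one] at h1
    -- The residuals use the times `t₀, …` up to the last but one level, hence the shift by one
    -- before `sum_rpow_sq_le`.
    obtain ⟨N, hN⟩ := Nat.exists_eq_add_of_le' m.N_pos
    have h2 := sum_rpow_sq_le hτ N
    have h3 : Real.sqrt ((N : ℝ) * m.τ P) ≤ Real.sqrt P.T := by
      refine Real.sqrt_le_sqrt ?_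
      rw [← m.N_mul_τ, hN]
      push_cast
      nlinarith
    rw [← hN] at h2
    calc _ ≤ m.τ P * (2 * A ^ 2 * ε ^ 2 * (m.N
            + ∑ k ∈ Finset.range m.N, (((k : ℝ) * m.τ P) ^ (-(1 / 4) : ℝ)) ^ 2)) := by gcongr
      _ = 2 * A ^ 2 * ε ^ 2 * (m.N * m.τ P
            + m.τ P * ∑ k ∈ Finset.range m.N, (((k : ℝ) * m.τ P) ^ (-(1 / 4) : ℝ)) ^ 2) := by ring
      _ ≤ 2 * A ^ 2 * ε ^ 2 * (P.T + 2 * Real.sqrt P.T) := by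
        rw [m.N_mul_τ]
        refine mul_le_mul_of_nonneg_left ?_ (by positivity)
        linarith
      _ = _ := by ring
  have h := stability (Lf := Lf) (B := B) m.M₁_pos m.M₂_pos hτ (by positivity) hc m.N_mul_τ.le
    (hP.weight_antitone m) (hcw m) (hws m) hSb
    (hu.isErrorGrid hU hP hD hDU) (fun n i j hn hnN hi hj => by
      have hij := Mesh.interior_of_mem hi hj
      obtain ⟨k, rfl⟩ := Nat.exists_eq_add_of_le' hn
      have hr := hres m k i j hnN hij
      have hl := hlip (m.x P i) (m.y P j) (m.t P k) (hP.node_mem m hij)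
        (hP.t_mem m (by omega)) (m.restrict P (D 0 0 0) k i j) (u k i j)
      simp only [Nat.add_sub_cancel, hS]
      refine (abs_add_le _ _).trans ((add_le_add hr hl).trans (le_of_eq ?_))
      ring) hn
  refine h.trans ?_
  rw [mul_assoc]
  refine mul_le_mul_of_nonneg_left ?_ (Nat.cast_nonneg _)
  calc _ ≤ 2 * P.T / c * (4 / c * (2 * A ^ 2 * (P.T + 2 * Real.sqrt P.T) * ε ^ 2)
          + B ^ 2 * ε ^ 2 * W) * Real.exp (8 * P.T ^ 2 * Lf ^ 2 / c ^ 2) := by gcongr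
    _ = _ := by ring

end DistributedWave

end

/-! ### Passage to the discrete norm -/

theorem mainTheorem2 (P : DistributedWave.Data) (hP : P.Admissible) (U : ℝ → ℝ → ℝ → ℝ)
    (hU : DistributedWave.IsSolution P U)
    (hreg : DistributedWave.IsC443 P.L₁ P.L₂ P.T U) :
    ∃ C : ℝ, 0 < C ∧ ∀ (m : DistributedWave.Mesh) (u : DistributedWave.GridFun),
      (DistributedWave.IsSchemeSolution P m u ∨ DistributedWave.IsADISolution P m u) →
      ∀ n : ℕ, n ≤ m.N →
        m.norm P (fun i j => U (m.x P i) (m.y P j) (m.t P n) - u n i j)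
          ≤ C * (m.τ P + m.h₁ P ^ 2 + m.h₂ P ^ 2 + m.Δβ ^ 2) := by
  obtain ⟨D, hDU, hc, hx, hy, ht⟩ := hreg
  have hD : DistributedWave.IsDerivFamily P.L₁ P.L₂ P.T D := ⟨hc, hx, hy, ht⟩
  obtain ⟨K, hK, hest⟩ := hP.exists_error_estimate hU hD hDU
  have hL₁ := hP.L₁_pos
  have hL₂ := hP.L₂_pos
  -- The `+ 1` only ensures positivity, since `K` may be zero.
  refine ⟨Real.sqrt (P.L₁ * P.L₂ * K) + 1, by positivity, fun m u hu n hn => ?_⟩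
  have hu' : DistributedWave.IsSchemeSolution P m u := hu.elim id fun h => h.isSchemeSolution hP
  have h := hest m u hu' n hn
  have hh₁ := hP.h₁_pos m
  have hh₂ := hP.h₂_pos m
  have hτ := hP.τ_pos m
  set ε := m.τ P + m.h₁ P ^ 2 + m.h₂ P ^ 2 + m.Δβ ^ 2 with hε
  have hε0 : 0 ≤ ε := by positivity
  have hsum : ∑ i ∈ Finset.Ico 1 m.M₁, ∑ j ∈ Finset.Ico 1 m.M₂,
      |U (m.x P i) (m.y P j) (m.t P n) - u n i j| ^ 2
      = ∑ s ∈ Finset.Ico 1 m.M₁ ×ˢ Finset.Ico 1 m.M₂,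
          (m.restrict P (D 0 0 0) n s.1 s.2 - u n s.1 s.2) ^ 2 := by
    rw [Finset.sum_product]
    refine Finset.sum_congr rfl fun i hi => Finset.sum_congr rfl fun j hj => ?_
    rw [sq_abs, DistributedWave.Mesh.restrict,
      hDU _ _ _ (DistributedWave.Data.mem_box
        (hP.node_mem m (DistributedWave.Mesh.interior_of_mem hi hj)) (hP.t_mem m hn))]
  -- The cells attached to the interior nodes have total area at most that of the rectangle.
  have hcard : m.h₁ P * m.h₂ P * ((Finset.Ico 1 m.M₁ ×ˢ Finset.Ico 1 m.M₂).card : ℝ)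
      ≤ P.L₁ * P.L₂ := by
    rw [Finset.card_product, Nat.card_Ico, Nat.card_Ico, ← m.M₁_mul_h₁, ← m.M₂_mul_h₂]
    push_cast
    have h1 : ((m.M₁ - 1 : ℕ) : ℝ) ≤ m.M₁ := by exact_mod_cast Nat.sub_le _ _
    have h2 : ((m.M₂ - 1 : ℕ) : ℝ) ≤ m.M₂ := by exact_mod_cast Nat.sub_le _ _
    calc m.h₁ P * m.h₂ P * (((m.M₁ - 1 : ℕ) : ℝ) * ((m.M₂ - 1 : ℕ) : ℝ))
        ≤ m.h₁ P * m.h₂ P * (m.M₁ * m.M₂) := by gcongr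
      _ = _ := by ring
  rw [DistributedWave.Mesh.norm, hsum]
  calc _ ≤ Real.sqrt (P.L₁ * P.L₂ * K * ε ^ 2) := by
        refine Real.sqrt_le_sqrt ?_
        calc _ ≤ m.h₁ P * m.h₂ P * ((Finset.Ico 1 m.M₁ ×ˢ Finset.Ico 1 m.M₂).card
              * (K * ε ^ 2)) := by gcongr
          _ = m.h₁ P * m.h₂ P * ((Finset.Ico 1 m.M₁ ×ˢ Finset.Ico 1 m.M₂).card : ℝ)
              * (K * ε ^ 2) := by ring
          _ ≤ P.L₁ * P.L₂ * (K * ε ^ 2) := by gcongr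
          _ = _ := by ring
    _ = Real.sqrt (P.L₁ * P.L₂ * K) * ε := by
        rw [Real.sqrt_mul (by positivity), Real.sqrt_sq hε0]
    _ ≤ _ := by
        gcongr
        linarith
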